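/- Notation. All meromorphic functions are meromorphic in $\mathbb{C}$, and $T(r,\cdot)$ is the Nevanlinna characteristic. For a non-constant meromorphic $f$, $S(r,f)$ denotes any quantity that is $o(T(r,f))$ as $r\to\infty$, $r\notin E$, for some set $E$ of finite Lebesgue measure; a meromorphic function $a$ is small with respect to $f$ if $T(r,a)=S(r,f)$. For $a\in\mathbb{C}\cup\{\infty\}$ and an integer $p\ge 1$, let $\overline N(r,a;f\mid\ge i)$ be the reduced counting function of the $a$-points of $f$ of multiplicity at least $i$, $\overline N(r,a;f)=\overline N(r,a;f\mid\ge 1)$, $N_p(r,a;f)=\sum_{i=1}^{p}\overline N(r,a;f\mid\ge i)$, $$\delta_p(a,f)=1-\limsup_{r\to\infty}\frac{N_p(r,a;f)}{T(r,f)},\qquad \Theta(a,f)=1-\limsup_{r\to\infty}\frac{\overline N(r,a;f)}{T(r,f)}.$$ For $l\in\{0,1,2,\dots\}\cup\{\infty\}$, two meromorphic functions $F,G$ share $(0,l)$ if $F$ and $G$ have the same zeros when a zero of multiplicity $m$ is counted $m$ times if $m\le l$ and $l+1$ times if $m>l$; that is, $\min\{m_F(z),l+1\}=\min\{m_G(z),l+1\}$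 for every $z\in\mathbb{C}$, where $m_F(z)$ is the multiplicity of $z$ as a zero of $F$ ($0$ if $z$ is not a zero, $\infty$ if $F\equiv 0$). For a positive integer $n$ put $\mu_2=\min\{n,2\}$ and $\mu_2^*=3-\mu_2$. A differential polynomial in $f$ is a finite non-empty sum $P[f]=\sum_{j=1}^t b_jM_j[f]$, where $M_j[f]=\prod_i (f^{(i)})^{n_{ij}}$ are pairwise distinct differential monomials ($n_{ij}\ge 0$ integers) and the coefficients $b_j\not\equiv 0$ are meromorphic with $T(r,b_j)=S(r,f)$. With $d(M_j)=\sum_i n_{ij}$ and $\Gamma_{M_j}=\sum_i (i+1)n_{ij}$, put $\overline d(P)=\max_j d(M_j)$, $\underline d(P)=\min_j d(M_j)$, $\Gamma_P=\max_j\Gamma_{M_j}$; the order of $P[f]$ is the highest order of a derivative of $f$ occurring in some $M_j$; and $P[f]$ is homogeneous if $\overline d(P)=\underline d(P)$. Theorem. Let $k\ge 1$ and $n\ge 1$ be integers and $f$ a non-constant meromorphic function. Let $P[f]$ be a homogeneous differential polynomial in $f$ of order $k$ such that $\Gamma_P>(k+1)\underline d(P)-2$. Let $a=a(z)\not\equiv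 0,\infty$ be a small function with respect to $f$, and suppose that $f^n-a$ and $P[f]-a$ share $(0,l)$. If $l\ge 2$ and $$(\Gamma_P-\underline d(P)+3)\,\Theta(\infty,f)+\mu_2\delta_{\mu_2^*}(0,f)+\underline d(P)\,\delta_{2+\Gamma_P-\underline d(P)}(0,f)>\Gamma_P+\mu_2+3-n,$$ or $l=1$ and $$\left(\Gamma_P-\underline d(P)+\tfrac72\right)\Theta(\infty,f)+\tfrac12\Theta(0,f)+\mu_2\delta_{\mu_2^*}(0,f)+\underline d(P)\,\delta_{2+\Gamma_P-\underline d(P)}(0,f)>\Gamma_P+\mu_2+4-n,$$ or $l=0$ and $$(2(\Gamma_P-\underline d(P))+6)\,\Theta(\infty,f)+2\Theta(0,f)+\mu_2\delta_{\mu_2^*}(0,f)+\underline d(P)\,\delta_{1+\Gamma_P-\underline d(P)}(0,f)+\underline d(P)\,\delta_{2+\Gamma_P-\underline d(P)}(0,f)>2\Gamma_P+\mu_2+8-n,$$ then $f^n\equiv P[f]$. -/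

import Mathlib

open Filter Set MeasureTheory

noncomputable section

namespace Nevanlinna

/-! Meromorphic functions on the plane are functions `ℂ → ℂ` satisfying `Meromorphic`. Their values on
a discrete closed set carry no information, so identities between them are equalities on a codiscrete
set, written `=ᶠ[codiscrete ℂ]`. -/

/-- `f` is not (identically equal to) a constant. -/
def NonConstant (f : ℂ → ℂ) : Prop :=
  ∀ c : ℂ, ¬ f =ᶠ[codiscrete ℂ] fun _ ↦ c

/-- The Nevanlinna characteristic `T(r, f)`. -/
abbrev T (f : ℂ → ℂ) : ℝ → ℝ := ValueDistribution.characteristic f ⊤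

/-- The `a`-points of `f` with their multiplicities, for `a ∈ ℂ ∪ {∞}` (where `∞` is `⊤`). -/
def pointDivisor (f : ℂ → ℂ) (a : WithTop ℂ) : Function.locallyFinsupp ℂ ℤ :=
  if a = ⊤ then (MeromorphicOn.divisor f univ)⁻
  else (MeromorphicOn.divisor (f · - a.untop₀) univ)⁺

/-- The reduced divisor of those points whose multiplicity in `D` is positive and at least `i`. -/
def reducedGE (D : Function.locallyFinsupp ℂ ℤ) (i : ℕ) : Function.locallyFinsupp ℂ ℤ where
  toFun z := if 0 < D z ∧ (i : ℤ) ≤ D z then 1 else 0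
  supportWithinDomain' := subset_univ _
  supportLocallyFiniteWithinDomain' z hz := by
    obtain ⟨t, ht, hfin⟩ := D.supportLocallyFiniteWithinDomain' z hz
    refine ⟨t, ht, hfin.subset ?_⟩
    rintro w ⟨hwt, hw⟩
    refine ⟨hwt, fun h0 ↦ hw ?_⟩
    have h0' : D w = 0 := h0
    simp [h0']

/-- The reduced counting function `N̄(r, a; f | ≥ i)` of the `a`-points of multiplicity at least
`i`, each counted once. -/
def NbarGE (i : ℕ) (a : WithTop ℂ) (f : ℂ → ℂ) : ℝ → ℝ :=
  Function.locallyFinsuppWithin.logCounting (reducedGE (pointDivisor f a) i)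

/-- The reduced counting function `N̄(r, a; f)`. -/
def Nbar (a : WithTop ℂ) (f : ℂ → ℂ) : ℝ → ℝ := NbarGE 1 a f

/-- `N_p(r, a; f) = N̄(r, a; f) + N̄(r, a; f | ≥ 2) + ⋯ + N̄(r, a; f | ≥ p)`. -/
def Ntrunc (p : ℕ) (a : WithTop ℂ) (f : ℂ → ℂ) (r : ℝ) : ℝ :=
  ∑ i ∈ Finset.Icc 1 p, NbarGE i a f r

/-- `δ_p(a, f) = 1 - limsup N_p(r, a; f) / T(r, f)`. -/
def delta (p : ℕ) (a : WithTop ℂ) (f : ℂ → ℂ) : ℝ :=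
  1 - limsup (fun r ↦ Ntrunc p a f r / T f r) atTop

/-- `Θ(a, f) = 1 - limsup N̄(r, a; f) / T(r, f)`. -/
def Theta (a : WithTop ℂ) (f : ℂ → ℂ) : ℝ :=
  1 - limsup (fun r ↦ Nbar a f r / T f r) atTop

/-- `a` is meromorphic and `T(r, a) = S(r, f)`, i.e. `T(r, a) = o(T(r, f))` as `r → ∞` outside a set
of finite Lebesgue measure. -/
def IsSmall (f a : ℂ → ℂ) : Prop :=
  Meromorphic a ∧ ∃ E : Set ℝ, volume E < ⊤ ∧ T a =o[atTop ⊓ 𝓟 Eᶜ] T f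

/-- The multiplicity of `z` as a zero of the meromorphic function `g`: `0` if `z` is not a zero (in
particular at poles), and `⊤` if `g` vanishes identically near `z`. -/
def zeroMult (g : ℂ → ℂ) (z : ℂ) : ℕ∞ :=
  WithTop.map Int.toNat (meromorphicOrderAt g z)

/-- `F` and `G` share `(0, l)`: they share the value `0` with weight `l`, where zeros of multiplicity
`m` are counted `m` times if `m ≤ l` and `l + 1` times if `m > l`. -/
def ShareZero (l : ℕ∞) (F G : ℂ → ℂ) : Prop :=
  ∀ z, min (zeroMult F z) (l + 1) = min (zeroMult G z) (l + 1)

/-- `μ_p = min {n, p}`. -/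
def mu (n p : ℕ) : ℕ := min n p

/-- `μ_p^* = p + 1 - μ_p`. -/
def muStar (n p : ℕ) : ℕ := p + 1 - mu n p

/-- The degree `∑ n_i` of the differential monomial `∏ (f^{(i)})^{n_i}` with exponents `m i = n_i`. -/
def monDegree (m : ℕ →₀ ℕ) : ℕ := m.sum fun _ e ↦ e

/-- The weight `∑ (i + 1) n_i` of the differential monomial `∏ (f^{(i)})^{n_i}`. -/
def monWeight (m : ℕ →₀ ℕ) : ℕ := m.sum fun i e ↦ (i + 1) * e

/-- The highest order of a derivative that occurs in the differential monomial. -/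
def monOrder (m : ℕ →₀ ℕ) : ℕ := m.support.sup id

/-- The differential monomial `∏ (f^{(i)})^{n_i}`. -/
def monEval (f : ℂ → ℂ) (m : ℕ →₀ ℕ) (z : ℂ) : ℂ := m.prod fun i e ↦ iteratedDeriv i f z ^ e

/-- A differential polynomial `P[f] = ∑ b_j M_j[f]`: a nonempty finite set of (distinct) differential
monomials `M_j`, with coefficients `b_j` that are meromorphic, not identically zero, and satisfy
`T(r, b_j) = S(r, f)`. -/
structure DiffPoly (f : ℂ → ℂ) where
  monomials : Finset (ℕ →₀ ℕ)
  nonempty : monomials.Nonempty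
  coeff : (ℕ →₀ ℕ) → ℂ → ℂ
  coeff_small : ∀ m ∈ monomials, IsSmall f (coeff m)
  coeff_ne_zero : ∀ m ∈ monomials, ¬ coeff m =ᶠ[codiscrete ℂ] 0

namespace DiffPoly

variable {f : ℂ → ℂ} (P : DiffPoly f)

/-- The meromorphic function `P[f]`. -/
def eval (z : ℂ) : ℂ := ∑ m ∈ P.monomials, P.coeff m z * monEval f m z

/-- The (upper) degree of `P[f]`. -/
def upperDegree : ℕ := P.monomials.sup' P.nonempty monDegree

/-- The lower degree of `P[f]`. -/
def lowerDegree : ℕ := P.monomials.inf' P.nonempty monDegree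

/-- The weight `Γ_P`. -/
def weight : ℕ := P.monomials.sup' P.nonempty monWeight

/-- The order of `P[f]`: the highest order of a derivative of `f` in `P[f]`. -/
def order : ℕ := P.monomials.sup' P.nonempty monOrder

/-- `P[f]` is homogeneous: all its monomials have the same degree. -/
def IsHomogeneous : Prop := P.upperDegree = P.lowerDegree

/-- In particular the natural-number difference `Γ_P - d(P)` is never truncated. -/
theorem lowerDegree_le_weight : P.lowerDegree ≤ P.weight := by
  obtain ⟨m, hm⟩ := P.nonempty
  have h1 : P.lowerDegree ≤ monDegree m := Finset.inf'_le _ hm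
  have h2 : monWeight m ≤ P.weight := Finset.le_sup' monWeight hm
  have h3 : monDegree m ≤ monWeight m :=
    Finset.sum_le_sum fun i _ ↦ Nat.le_mul_of_pos_left _ i.succ_pos
  exact h1.trans (h3.trans h2)

end DiffPoly

end Nevanlinna

end

/-! Let F = f^n/a, G = P[f]/a, d = d(P) and A = Γ_P - d. Off the zeros and poles of a and of the
coefficients, F and G share their 1-points with weight l. Unless f^n ≡ P[f], the quantity n T(r,f)
is bounded, up to S(r,f), by a combination of N̄(r,∞;f), N̄(r,0;f) and N_p(r,0;f) whose limsup
against T(r,f) is less than n by the deficiency hypothesis.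

Generic case. Let H be the logarithmic derivative of φ = (F'/(F-1)²)/(G'/(G-1)²). If H ≢ 0, add the
second main theorem for F and for G (`AsympLE.smt`, with the ramification kept) to the bound of the
zeros of H by its simple poles (`AsympLE.zeros_logDeriv`), and subtract N(r,1;G) ≤ T(r,G) + O(1).
This bounds T(r,F) by the counting function of a single divisor, `mainDivisor`, and what remains is
pointwise. The divisor is at most 3 at poles of f, and away from poles and 1-points at most the
zeros of F and G truncated at 2. At a common 1-point of multiplicities p for F and q for G it is at
most 0 if p = q = 1, because H vanishes there, at most 2 - q if p = q ≥ 2, and at most 3 - q if p ≠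
q. For l ≥ 2 this is never positive; for l = 1 and l = 0 the excess is paid by the zeros of F'/F and
G'/G, of orders p - 1 and q - 1, which produces the additional terms.

Zeros of P[f]. By homogeneity w = P[f]/f^d is a polynomial in the quotients f^(i)/f, so m(r,w) =
S(r,f), and Jensen's formula bounds the counting function of the divisor of w. Comparing orders
pointwise (`DiffPoly.trunc_eval_le`) gives N_p(r,0;P[f]) ≤ A N̄(r,∞;f) + d N_{p+A}(r,0;f) + S(r,f).

Degenerate case. If H ≡ 0, then φ is constant and integration gives 1/(F-1) = c/(G-1) + B. Either F
≡ G, or FG ≡ 1, which would make T(r,f) = S(r,f), or some β ≠ 0 is taken by F only at zeros of G or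
only at exceptional points; then the second main theorem for 0, β, ∞ gives a smaller bound. Constant
G is treated separately.

All error terms come from the lemma on the logarithmic derivative (`proximity_logDeriv_le`),
obtained from the Herglotz integral, a canonical factorization and Borel's growth lemma, and valid
off a set of radii of finite logarithmic measure. -/

open Filter Set MeasureTheory

noncomputable section

namespace Nevanlinna

open Topology

/-! ### Exceptional sets of finite logarithmic measure -/

/-- The filter of those sets of radii whose complement in `[1, ∞)` has finite logarithmic measure. -/
def finLog : Filter ℝ :=
  map Real.exp (volume.restrict (Ici (0 : ℝ))).cofinite

lemma eventually_finLog {p : ℝ → Prop} :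
    (∀ᶠ r in finLog, p r) ↔ volume ({s | ¬ p (Real.exp s)} ∩ Ici 0) < ⊤ := by
  rw [finLog, eventually_map, Measure.eventually_cofinite, Measure.restrict_apply' measurableSet_Ici]

lemma finLog_le_atTop : finLog ≤ atTop := by
  intro s hs
  obtain ⟨a, ha⟩ := mem_atTop_sets.1 hs
  refine eventually_finLog.2 (lt_of_le_of_lt (measure_mono (t := Icc 0 (Real.log (max a 1))) ?_) ?_)
  · rintro x ⟨hx, hx0⟩
    refine ⟨hx0, ?_⟩
    by_contra h
    push Not at h
    have hlt := (Real.log_lt_iff_lt_exp (lt_of_lt_of_le one_pos (le_max_right a 1))).1 h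
    exact hx (ha _ ((le_max_left _ _).trans hlt.le))
  · simp

/-- The half-line has infinite measure. This is what lets an estimate off an exceptional set
contradict a limsup over all radii. -/
instance finLog_neBot : NeBot finLog := by
  refine ⟨fun h ↦ ?_⟩
  have h1 : ∀ᶠ r in finLog, False := by rw [h]; simp
  rw [eventually_finLog] at h1
  simp at h1

/-- The logarithm is 1-Lipschitz on [1, ∞), so finite Lebesgue measure implies finite logarithmic
measure. Small functions and Borel's lemma thus share one filter. -/
lemma eventually_finLog_notMem {E : Set ℝ} (hE : volume E < ⊤) : ∀ᶠ r in finLog, r ∉ E := by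
  rw [eventually_finLog]
  refine lt_of_le_of_lt (measure_mono (t := Real.log '' (E ∩ Ici 1)) ?_) ?_
  · rintro x ⟨hx, hx0⟩
    refine ⟨Real.exp x, ⟨not_not.1 hx, ?_⟩, Real.log_exp x⟩
    simpa using hx0
  · have hl : LipschitzOnWith 1 Real.log (Ici 1) := by
      refine LipschitzOnWith.of_le_add fun x hx y hy ↦ ?_
      have hx1 : (1 : ℝ) ≤ x := hx
      have hy1 : (1 : ℝ) ≤ y := hy
      rcases le_total x y with hxy | hxy
      · exact (Real.log_le_log (by linarith) hxy).trans (by simp)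
      · have h2 : Real.log x - Real.log y = Real.log (x / y) := by
          rw [Real.log_div (by linarith) (by linarith)]
        have h3 : Real.log (x / y) ≤ x / y - 1 := Real.log_le_sub_one_of_pos (by positivity)
        have h4 : x / y - 1 ≤ x - y := by
          rw [div_sub_one (by linarith), div_le_iff₀ (by linarith)]
          nlinarith
        have h5 : x - y ≤ dist x y := le_abs_self _
        linarith
    have h6 := (hl.mono (inter_subset_right (s := E))).hausdorffMeasure_image_le (d := 1) zero_le_one
    rw [hausdorffMeasure_real] at h6
    refine lt_of_le_of_lt h6 ?_
    simpa using lt_of_le_of_lt (measure_mono inter_subset_left) hE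

lemma finLog_le_of_volume_lt_top {E : Set ℝ} (hE : volume E < ⊤) : finLog ≤ atTop ⊓ 𝓟 Eᶜ :=
  le_inf finLog_le_atTop (le_principal_iff.2 (eventually_finLog_notMem hE))

/-- The set on which a nondecreasing function `u ≥ 1` doubles within distance `1 / u` has finite
measure. -/
lemma volume_doubling_lt_top {u : ℝ → ℝ} {s₀ : ℝ} (hu : MonotoneOn u (Ici s₀))
    (h1 : ∀ s ≥ s₀, 1 ≤ u s) : volume {s | s₀ ≤ s ∧ 2 * u s ≤ u (s + 1 / u s)} < ⊤ := by
  -- Dyadic level sets. Each lies in an interval of length 2^(-k): a point further to the right of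
  -- some t in the set would have u at least 2 u(t) ≥ 2^(k+1). The lengths are summable.
  set B : ℕ → Set ℝ := fun k ↦
    {s | s₀ ≤ s ∧ 2 * u s ≤ u (s + 1 / u s) ∧ 2 ^ k ≤ u s ∧ u s < 2 ^ (k + 1)} with hB
  have hcov : {s | s₀ ≤ s ∧ 2 * u s ≤ u (s + 1 / u s)} ⊆ ⋃ k, B k := by
    rintro s ⟨hs, hs2⟩
    obtain ⟨k, hk1, hk2⟩ := exists_nat_pow_near (h1 s hs) (one_lt_two)
    exact mem_iUnion.2 ⟨k, hs, hs2, hk1, hk2⟩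
  have hBk : ∀ k, volume (B k) ≤ ENNReal.ofReal ((1 / 2) ^ k) := by
    intro k
    rcases (B k).eq_empty_or_nonempty with he | hne
    · simp [he]
    have hbdd : BddBelow (B k) := ⟨s₀, fun s hs ↦ hs.1⟩
    have hsub : B k ⊆ Icc (sInf (B k)) (sInf (B k) + (1 / 2) ^ k) := by
      intro s hs
      refine ⟨csInf_le hbdd hs, ?_⟩
      by_contra hlt
      push Not at hlt
      obtain ⟨t, ht, hts⟩ := exists_lt_of_csInf_lt hne (show sInf (B k) < s - (1 / 2) ^ k by linarith)
      obtain ⟨ht0, ht2, htk, -⟩ := ht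
      have hpos : 0 < u t := by linarith [h1 t ht0]
      have h3 : 1 / u t ≤ (1 / 2) ^ k := by
        rw [one_div_pow]
        exact one_div_le_one_div_of_le (by positivity) htk
      have h4 : u (t + 1 / u t) ≤ u s :=
        hu (show s₀ ≤ t + 1 / u t by have := one_div_pos.2 hpos; linarith) hs.1 (by linarith)
      have h5 := hs.2.2.2
      rw [pow_succ] at h5
      linarith
    refine (measure_mono hsub).trans ?_
    simp
  refine lt_of_le_of_lt (measure_mono hcov) (lt_of_le_of_lt (measure_iUnion_le B) ?_)
  refine lt_of_le_of_lt (ENNReal.tsum_le_tsum hBk) ?_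
  rw [← ENNReal.ofReal_tsum_of_nonneg (fun k ↦ by positivity) summable_geometric_two]
  exact ENNReal.ofReal_lt_top

/-- Borel's growth lemma. -/
lemma eventually_finLog_lt_two_mul {S : ℝ → ℝ} {r₀ : ℝ} (hr₀ : 1 ≤ r₀)
    (hS : MonotoneOn S (Ici r₀)) (h1 : ∀ r ≥ r₀, 1 ≤ S r) :
    ∀ᶠ r in finLog, S (r * (1 + 1 / S r)) < 2 * S r := by
  have hr0 : 0 < r₀ := by linarith
  have hge : ∀ s, Real.log r₀ ≤ s ↔ r₀ ≤ Real.exp s := fun s ↦ Real.log_le_iff_le_exp hr0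
  -- Additive doubling in s = log r is doubling under r ↦ r exp(1/S), and 1 + 1/S ≤ exp(1/S).
  have key := volume_doubling_lt_top (u := fun s ↦ S (Real.exp s)) (s₀ := Real.log r₀)
    (fun a ha b hb hab ↦ hS ((hge a).1 ha) ((hge b).1 hb) (Real.exp_le_exp.2 hab))
    (fun s hs ↦ h1 _ ((hge s).1 hs))
  have h2 : ∀ᶠ r in finLog, ¬ (r₀ ≤ r ∧ 2 * S r ≤ S (r * Real.exp (1 / S r))) := by
    rw [eventually_finLog]
    refine lt_of_le_of_lt (measure_mono ?_) key
    rintro s ⟨hs, -⟩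
    have hs' := not_not.1 hs
    refine ⟨(hge s).2 hs'.1, ?_⟩
    simpa [Real.exp_add] using hs'.2
  filter_upwards [h2, finLog_le_atTop (eventually_ge_atTop r₀)] with r hr hr1
  have h3 : ¬ 2 * S r ≤ S (r * Real.exp (1 / S r)) := fun h ↦ hr ⟨hr1, h⟩
  have hpos : 0 < S r := by linarith [h1 r hr1]
  have hp2 : 0 < 1 / S r := one_div_pos.2 hpos
  have h4 : r * (1 + 1 / S r) ≤ r * Real.exp (1 / S r) := by
    refine mul_le_mul_of_nonneg_left ?_ (by linarith)
    rw [add_comm]; exact Real.add_one_le_exp _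
  have h5 : r₀ ≤ r * (1 + 1 / S r) := by nlinarith
  have := hS (show r₀ ≤ _ from h5) (show r₀ ≤ _ from h5.trans h4) h4
  linarith

end Nevanlinna
end

open Filter Set MeasureTheory

noncomputable section

namespace Nevanlinna

open Topology Real Metric Complex

/-! ### The lemma on the logarithmic derivative -/

/-- Jordan's inequality sin θ ≥ 2θ/π compares the integrand with θ^(-1/2) on a quarter period;
symmetry and periodicity do the rest. -/
lemma intervalIntegrable_sqrt_inv_abs_sin (a b : ℝ) :
    IntervalIntegrable (fun θ ↦ √(|Real.sin θ|⁻¹)) volume a b := by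
  have hmeas : Measurable fun θ ↦ √(|Real.sin θ|⁻¹) := by fun_prop
  have h1 : IntervalIntegrable (fun θ ↦ √(|Real.sin θ|⁻¹)) volume 0 (π / 2) := by
    have h0 : IntervalIntegrable (fun θ : ℝ ↦ √(π / 2) * θ ^ (-(1 / 2) : ℝ)) volume 0 (π / 2) :=
      (intervalIntegral.intervalIntegrable_rpow' (by norm_num)).const_mul _
    refine h0.mono_fun hmeas.aestronglyMeasurable ?_
    refine (ae_restrict_iff' measurableSet_uIoc).2 (Eventually.of_forall fun θ hθ ↦ ?_)
    rw [uIoc_of_le (by positivity)] at hθ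
    have hs := Real.mul_le_sin hθ.1.le hθ.2
    have hp : 0 < 2 / π * θ := mul_pos (by positivity) hθ.1
    have hθ0 : 0 ≤ θ := hθ.1.le
    beta_reduce
    rw [Real.norm_of_nonneg (Real.sqrt_nonneg _), Real.norm_of_nonneg (by positivity),
      abs_of_nonneg (hp.le.trans hs), Real.rpow_neg hθ.1.le, ← Real.sqrt_eq_rpow,
      ← Real.sqrt_inv, ← Real.sqrt_mul (by positivity)]
    refine Real.sqrt_le_sqrt ((inv_anti₀ hp hs).trans (le_of_eq ?_))
    field_simp
  have h2 : IntervalIntegrable (fun θ ↦ √(|Real.sin θ|⁻¹)) volume 0 π := by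
    refine h1.trans ?_
    have := (h1.comp_sub_left π).symm
    simp only [Real.sin_pi_sub, sub_zero] at this
    convert this using 1
    ring
  have hper : Function.Periodic (fun θ ↦ √(|Real.sin θ|⁻¹)) π := fun θ ↦ by
    simp [Real.sin_add_pi]
  exact hper.intervalIntegrable₀ pi_ne_zero h2 a b

/-- The average of `|sin|^{-1/2}` over a period. -/
def sinAverage : ℝ := (2 * π)⁻¹ * ∫ θ in 0..2 * π, √(|Real.sin θ|⁻¹)

lemma sinAverage_nonneg : 0 ≤ sinAverage :=
  mul_nonneg (by positivity)
    (intervalIntegral.integral_nonneg (by positivity) fun _ _ ↦ Real.sqrt_nonneg _)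

/-- Rotate u to the positive real axis and keep only the imaginary part, which no longer involves
|u|. Hence the later averages are bounded uniformly in u. -/
lemma abs_sin_mul_le_norm_circleMap_sub (r : ℝ) (u : ℂ) (θ : ℝ) :
    |r| * |Real.sin (θ - u.arg)| ≤ ‖circleMap 0 r θ - u‖ := by
  have h1 : ‖circleMap 0 r θ - u‖ = ‖(circleMap 0 r θ - u) * exp (-u.arg * I)‖ := by
    rw [norm_mul, ← ofReal_neg, norm_exp_ofReal_mul_I, mul_one]
  have h2 : (circleMap 0 r θ - u) * exp (-u.arg * I) = r * exp ((θ - u.arg : ℝ) * I) - ‖u‖ := by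
    conv_lhs => rw [← norm_mul_exp_arg_mul_I u]
    rw [circleMap_zero, sub_mul, mul_assoc, mul_assoc, ← Complex.exp_add, ← Complex.exp_add]
    rw [norm_mul_exp_arg_mul_I u]
    congr 3
    · push_cast; ring_nf
    · simp
  rw [h1, h2]
  refine le_trans (le_of_eq ?_) (abs_im_le_norm _)
  rw [exp_mul_I, ← ofReal_cos, ← ofReal_sin]
  simp only [sub_im, add_im, ofReal_im, mul_im, ofReal_re, I_im, I_re,
    mul_one, mul_zero, add_zero, zero_add, sub_zero, zero_mul, abs_mul]

lemma ae_sqrt_div_norm_sub_le {r : ℝ} (hr : 0 < r) (u : ℂ) :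
    ∀ᵐ θ : ℝ, √(r / ‖circleMap 0 r θ - u‖) ≤ √(|Real.sin (θ - u.arg)|⁻¹) := by
  -- At zeros of the sine the inverse is 0 by convention and the bound may fail; these angles form a
  -- null set.
  have hcount : {θ : ℝ | Real.sin (θ - u.arg) = 0}.Countable := by
    refine (countable_range fun n : ℤ ↦ n * π + u.arg).mono fun θ hθ ↦ ?_
    obtain ⟨n, hn⟩ := Real.sin_eq_zero_iff.1 hθ
    exact ⟨n, by simp [hn]⟩
  filter_upwards [measure_eq_zero_iff_ae_notMem.1 (hcount.measure_zero volume)] with θ hθ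
  have hpos : 0 < |Real.sin (θ - u.arg)| := abs_pos.2 hθ
  have h := abs_sin_mul_le_norm_circleMap_sub r u θ
  rw [abs_of_pos hr] at h
  refine Real.sqrt_le_sqrt ?_
  rw [div_le_iff₀ ((mul_pos hr hpos).trans_le h)]
  calc r = |Real.sin (θ - u.arg)|⁻¹ * (r * |Real.sin (θ - u.arg)|) := by field_simp
    _ ≤ _ := by gcongr

lemma circleIntegrable_sqrt_div_norm_sub {r : ℝ} (hr : 0 < r) (u : ℂ) :
    CircleIntegrable (fun z ↦ √(r / ‖z - u‖)) 0 r := by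
  have hint := (intervalIntegrable_sqrt_inv_abs_sin (0 - u.arg) (2 * π - u.arg)).comp_sub_right u.arg
  simp only [sub_add_cancel] at hint
  refine IntervalIntegrable.mono_fun hint ?_ ?_
  · exact Measurable.aestronglyMeasurable (by fun_prop)
  · refine ae_restrict_of_ae ?_
    filter_upwards [ae_sqrt_div_norm_sub_le hr u] with θ hθ
    rwa [Real.norm_of_nonneg (Real.sqrt_nonneg _), Real.norm_of_nonneg (Real.sqrt_nonneg _)]

lemma circleAverage_sqrt_div_norm_sub_le {r : ℝ} (hr : 0 < r) (u : ℂ) :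
    circleAverage (fun z ↦ √(r / ‖z - u‖)) 0 r ≤ sinAverage := by
  rw [circleAverage_def, smul_eq_mul, sinAverage]
  refine mul_le_mul_of_nonneg_left ?_ (by positivity)
  have hint := (intervalIntegrable_sqrt_inv_abs_sin (0 - u.arg) (2 * π - u.arg)).comp_sub_right u.arg
  simp only [sub_add_cancel] at hint
  have h1 := intervalIntegral.integral_mono_ae (by positivity)
    (circleIntegrable_sqrt_div_norm_sub hr u) hint (ae_sqrt_div_norm_sub_le hr u)
  refine h1.trans (le_of_eq ?_)
  rw [intervalIntegral.integral_comp_sub_right (fun θ ↦ √(|Real.sin θ|⁻¹))]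
  have hper : Function.Periodic (fun θ ↦ √(|Real.sin θ|⁻¹)) (2 * π) := fun θ ↦ by simp
  have := hper.intervalIntegral_add_eq (0 - u.arg) 0
  convert this using 2 <;> ring

/-- The logarithmic derivative of a zero-free analytic function, from its modulus on a circle. -/
lemma logDeriv_eq_circleAverage {h : ℂ → ℂ} {R : ℝ} {w : ℂ}
    (hh : AnalyticOnNhd ℂ h (closedBall 0 R)) (h0 : ∀ z ∈ closedBall 0 R, h z ≠ 0)
    (hw : w ∈ ball 0 R) :
    logDeriv h w = circleAverage (fun ζ ↦ (2 * ζ / (ζ - w) ^ 2) • (Real.log ‖h ζ‖ : ℂ)) 0 R := by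
  have hR : 0 < R := pos_of_mem_ball hw
  have hint : CircleIntegrable (fun ζ ↦ Real.log ‖h ζ‖) 0 R := by
    refine MeromorphicOn.circleIntegrable_log_norm_of_nonneg ?_ hR.le
    exact (hh.mono sphere_subset_closedBall).meromorphicOn
  have hintC : CircleIntegrable (fun ζ ↦ (Real.log ‖h ζ‖ : ℂ)) 0 R := by
    simp only [CircleIntegrable, intervalIntegrable_iff] at hint ⊢
    exact Complex.ofRealCLM.integrable_comp hint
  have hharm : InnerProductSpace.HarmonicOnNhd (fun ζ ↦ Real.log ‖h ζ‖) (closedBall 0 R) :=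
    fun x hx ↦ (hh x hx).harmonicAt_log_norm (h0 x hx)
  -- The Herglotz integral W is holomorphic with real part log |h|. So exp W / h has modulus 1, is
  -- locally constant by the maximum principle, and h'/h = W'.
  set W : ℂ → ℂ := fun w ↦
    circleAverage (fun ζ ↦ herglotzRieszKernel 0 w ζ • (Real.log ‖h ζ‖ : ℂ)) 0 R with hW
  have hre : ∀ z ∈ ball 0 R, (W z).re = Real.log ‖h z‖ := fun z hz ↦ by
    rw [hW]
    simp only
    rw [re_circleAverage_herglotzRieszKernel_smul hint hz,
      hharm.circleAverage_re_herglotzRieszKernel_smul hz]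
  have hWd : HasDerivAt W _ w := hasDerivAt_circleAverage_herglotzRieszKernel_smul hintC hw
  have hWan : DifferentiableOn ℂ W (ball 0 R) :=
    differentiableOn_circleAverage_herglotzRieszKernel_smul hintC
  have hball : ball (0 : ℂ) R ∈ 𝓝 w := isOpen_ball.mem_nhds hw
  have hconst : ∀ᶠ z in 𝓝 w, exp (W z) / h z = exp (W w) / h w := by
    refine Complex.eventually_eq_of_isLocalMax_norm (f := fun z ↦ exp (W z) / h z) ?_ ?_
    · filter_upwards [hball] with z hz
      have hz' := ball_subset_closedBall hz
      exact (hWan.differentiableAt (isOpen_ball.mem_nhds hz)).cexp.div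
        (hh z hz').differentiableAt (h0 z hz')
    · have h1 : ∀ z ∈ ball 0 R, ‖exp (W z) / h z‖ = 1 := fun z hz ↦ by
        have hz0 := norm_pos_iff.2 (h0 z (ball_subset_closedBall hz))
        rw [norm_div, Complex.norm_exp, hre z hz, Real.exp_log hz0, div_self hz0.ne']
      filter_upwards [hball] with z hz
      exact ((h1 z hz).trans (h1 w hw).symm).le
  have hw' := ball_subset_closedBall hw
  set c := exp (W w) / h w with hc
  have hc0 : c ≠ 0 := div_ne_zero (exp_ne_zero _) (h0 w hw')
  have heq : h =ᶠ[𝓝 w] fun z ↦ c⁻¹ * exp (W z) := by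
    filter_upwards [hconst, hball] with z hz hzb
    have := h0 z (ball_subset_closedBall hzb)
    rw [← hz]
    field_simp
  have hd : HasDerivAt h (c⁻¹ * (exp (W w) * _)) w := ((hWd.cexp).const_mul c⁻¹).congr_of_eventuallyEq heq
  rw [logDeriv_apply, hd.deriv, heq.eq_of_nhds]
  field_simp

end Nevanlinna
end

open Filter Set MeasureTheory

noncomputable section

namespace Nevanlinna

open Topology Real Metric Complex MeromorphicOn

lemma logDeriv_canonicalFactor {R : ℝ} {u w : ℂ} (hu : u ∈ ball 0 R) (hw : w ∈ ball 0 R)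
    (hwu : w ≠ u) : logDeriv (canonicalFactor R u) w =
      -(starRingEnd ℂ u) / (R ^ 2 - starRingEnd ℂ u * w) - 1 / (w - u) := by
  have hR : (R : ℂ) ≠ 0 := ofReal_ne_zero.2 (pos_of_mem_ball hu).ne'
  have h1 : w - u ≠ 0 := sub_ne_zero.2 hwu
  have h0 := canonicalFactor_ne_zero hu (ball_subset_closedBall hw) hwu
  rw [canonicalFactor_apply] at h0
  have h2 : (R : ℂ) ^ 2 - starRingEnd ℂ u * w ≠ 0 := (div_ne_zero_iff.1 h0).1
  have hn : HasDerivAt (fun z : ℂ ↦ (R : ℂ) ^ 2 - starRingEnd ℂ u * z) (-(starRingEnd ℂ u)) w := by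
    simpa using ((hasDerivAt_id w).const_mul (starRingEnd ℂ u)).const_sub ((R : ℂ) ^ 2)
  have hd : HasDerivAt (fun z : ℂ ↦ (R : ℂ) * (z - u)) R w := by
    simpa using ((hasDerivAt_id w).sub_const u).const_mul (R : ℂ)
  have hdiv := logDeriv_div (f := fun z : ℂ ↦ (R : ℂ) ^ 2 - starRingEnd ℂ u * z)
    (g := fun z : ℂ ↦ (R : ℂ) * (z - u)) w h2 (mul_ne_zero hR h1) hn.differentiableAt
    hd.differentiableAt
  rw [canonicalFactor_def, hdiv, logDeriv_apply, logDeriv_apply, hn.deriv, hd.deriv]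
  congr 1
  field_simp

/-- The first term comes from the reflection of u in the circle, which stays outside the disk of
radius R; the second is the pole at u itself. -/
lemma norm_mul_logDeriv_canonicalFactor_le {R r : ℝ} {u w : ℂ} (hu : u ∈ ball 0 R) (hrR : r < R)
    (hw : ‖w‖ = r) (hwu : w ≠ u) :
    ‖w * logDeriv (canonicalFactor R u) w‖ ≤ r / (R - r) + r / ‖w - u‖ := by
  have hwb : w ∈ ball 0 R := by simpa [hw] using hrR
  have hR := pos_of_mem_ball hu
  have hu' : ‖u‖ < R := by simpa using hu
  have hr : 0 ≤ r := hw ▸ norm_nonneg w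
  rw [logDeriv_canonicalFactor hu hwb hwu, mul_sub]
  refine (norm_sub_le _ _).trans (add_le_add ?_ ?_)
  · have h1 : R * (R - r) ≤ ‖(R : ℂ) ^ 2 - starRingEnd ℂ u * w‖ := by
      have h2 := norm_sub_norm_le ((R : ℂ) ^ 2) (starRingEnd ℂ u * w)
      rw [norm_pow, norm_real, norm_mul, norm_conj, hw, Real.norm_of_nonneg hR.le] at h2
      nlinarith
    rw [norm_mul, norm_div, norm_neg, norm_conj, hw, ← mul_div_assoc, div_le_div_iff₀]
    · nlinarith [mul_nonneg hr (sub_pos.2 hrR).le, mul_le_mul_of_nonneg_left h1 hr,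
        mul_le_mul_of_nonneg_right hu'.le (mul_nonneg hr (sub_pos.2 hrR).le)]
    · nlinarith
    · linarith
  · rw [norm_mul, norm_div, norm_one, hw, mul_one_div]

/-- The logarithmic derivative of a meromorphic function inside a disk whose boundary carries no
zeros and poles. -/
lemma exists_logDeriv_eq {f : ℂ → ℂ} (hf : Meromorphic f) (hf' : ∀ z, meromorphicOrderAt f z ≠ ⊤)
    {R : ℝ} (hs : ∀ z ∈ sphere 0 R, meromorphicOrderAt f z = 0) :
    ∃ h : ℂ → ℂ, AnalyticOnNhd ℂ h (closedBall 0 R) ∧ (∀ z ∈ closedBall 0 R, h z ≠ 0) ∧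
      (∀ᶠ z in codiscreteWithin (sphere 0 R), ‖f z‖ = ‖h z‖) ∧
      ∀ᶠ w in codiscreteWithin (ball 0 R), logDeriv f w = logDeriv h w -
        ∑ u ∈ (hf.meromorphicOn (s := closedBall 0 R)).divisor_ball_support_finite.toFinset,
          (divisor f (ball 0 R) u : ℂ) * logDeriv (canonicalFactor R u) w := by
  obtain ⟨h, D⟩ := (hf.meromorphicOn (s := closedBall 0 R)).exists_ecanonicalDecomp fun u ↦ hf' u
  have hfin := (hf.meromorphicOn (s := closedBall 0 R)).divisor_ball_support_finite
  set t := hfin.toFinset with ht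
  have htb : ∀ u ∈ t, u ∈ ball 0 R := fun u hu ↦
    (divisor f (ball 0 R)).supportWithinDomain (by simpa [ht] using hu)
  set p : ℂ → ℂ := fun z ↦ ∏ u ∈ t, canonicalFactor R u z ^ (-divisor f (ball 0 R) u) with hp
  -- This removes the boundary factor from the canonical decomposition.
  have hS : divisor f (sphere 0 R) = 0 := by
    ext z
    by_cases hz : z ∈ sphere 0 R
    · rw [divisor_apply hf.meromorphicOn hz, hs z hz]; rfl
    · exact Function.locallyFinsuppWithin.apply_eq_zero_of_notMem _ hz
  have heq : f =ᶠ[codiscreteWithin (closedBall 0 R)] fun z ↦ p z * h z := by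
    refine D.eventuallyEq.trans (EventuallyEq.of_eq ?_)
    rw [hS, finprod_eq_prod_of_mulSupport_subset (s := t)]
    · ext z
      simp [hp, Finset.prod_apply]
    · intro u hu
      simp only [Function.mem_mulSupport, ne_eq] at hu
      rw [ht, hfin.coe_toFinset]
      intro h0
      exact hu (by rw [h0]; simp)
  refine ⟨h, D.analyticOnNhd, D.ne_zero, ?_, ?_⟩
  · filter_upwards [heq.filter_mono (codiscreteWithin_mono sphere_subset_closedBall),
      self_mem_codiscreteWithin (sphere 0 R)] with z hz hzs
    rw [hz, norm_mul, hp, norm_prod, Finset.prod_eq_one, one_mul]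
    intro u hu
    rw [norm_zpow, norm_canonicalFactor_eval_circle_eq_one (htb u hu) hzs, one_zpow]
  · have hpm : Meromorphic fun z ↦ p z := by
      intro z
      exact MeromorphicAt.fun_prod fun u _ ↦ (meromorphic_canonicalFactor R u z).zpow _
    have heqb := heq.filter_mono (codiscreteWithin_mono (ball_subset_closedBall (x := (0 : ℂ)) (ε := R)))
    have hphm : MeromorphicOn (fun z ↦ p z * h z) (ball 0 R) := fun z hz ↦
      (hpm z).mul (D.analyticOnNhd z (ball_subset_closedBall hz)).meromorphicAt
    have hderiv := MeromorphicOn.deriv_eventuallyEq_codiscreteWithin hf.meromorphicOn hphm heqb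
    have htc : ∀ᶠ w in codiscreteWithin (ball (0 : ℂ) R), w ∉ t :=
      codiscreteWithin_mono (subset_univ _) (t.finite_toSet.compl_mem_codiscrete)
    filter_upwards [heqb, hderiv, htc, self_mem_codiscreteWithin (ball (0 : ℂ) R)]
      with w hw1 hw2 hwt hwb
    have hwc := ball_subset_closedBall hwb
    have hne : ∀ u ∈ t, w ≠ u := fun u hu huw ↦ hwt (huw ▸ hu)
    have hc0 : ∀ u ∈ t, canonicalFactor R u w ≠ 0 := fun u hu ↦
      canonicalFactor_ne_zero (htb u hu) hwc (hne u hu)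
    have hcd : ∀ u ∈ t, DifferentiableAt ℂ (canonicalFactor R u) w := fun u hu ↦
      (analyticOnNhd_canonicalFactor R u w (hne u hu)).differentiableAt
    have hcd' : ∀ u ∈ t, DifferentiableAt ℂ
        (fun z ↦ canonicalFactor R u z ^ (-divisor f (ball 0 R) u)) w := fun u hu ↦
      (hcd u hu).zpow (Or.inl (hc0 u hu))
    have hp0 : p w ≠ 0 := Finset.prod_ne_zero_iff.2 fun u hu ↦ zpow_ne_zero _ (hc0 u hu)
    have hpd : DifferentiableAt ℂ p w := DifferentiableAt.fun_finsetProd hcd'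
    have h1 : logDeriv f w = logDeriv (fun z ↦ p z * h z) w := by
      rw [logDeriv_apply, logDeriv_apply, hw1, hw2]
    rw [h1, logDeriv_mul w hp0 (D.ne_zero w hwc) hpd
      (D.analyticOnNhd w hwc).differentiableAt, hp,
      logDeriv_prod (f := fun u z ↦ canonicalFactor R u z ^ (-divisor f (ball 0 R) u))
        (fun u hu ↦ zpow_ne_zero _ (hc0 u hu)) hcd', add_comm, sub_eq_add_neg,
      ← Finset.sum_neg_distrib]
    congr 1
    refine Finset.sum_congr rfl fun u hu ↦ ?_
    rw [logDeriv_fun_zpow (hcd u hu)]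
    push_cast
    ring

end Nevanlinna
end

open Filter Set MeasureTheory

noncomputable section

namespace Nevanlinna

open Topology Real Metric Complex MeromorphicOn ValueDistribution

lemma circleAverage_mono_codiscrete {φ ψ : ℂ → ℝ} {r : ℝ} (hr : 0 < r)
    (hφ : CircleIntegrable φ 0 r) (hψ : CircleIntegrable ψ 0 r)
    (h : ∀ᶠ z in codiscreteWithin (sphere 0 r), φ z ≤ ψ z) :
    circleAverage φ 0 r ≤ circleAverage ψ 0 r := by
  -- Replacing φ by the minimum changes it only on a discrete set, and makes the inequality hold
  -- everywhere.
  have h1 : circleAverage φ 0 r = circleAverage (fun z ↦ min (φ z) (ψ z)) 0 r := by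
    refine circleAverage_congr_codiscreteWithin ?_ hr.ne'
    rw [abs_of_pos hr]
    filter_upwards [h] with z hz
    rw [min_eq_left hz]
  rw [h1]
  refine circleAverage_mono ?_ hψ fun z _ ↦ min_le_right _ _
  rw [CircleIntegrable, intervalIntegrable_iff] at hφ hψ ⊢
  exact hφ.inf hψ

lemma norm_circleAverage_le {g : ℂ → ℂ} {R : ℝ} :
    ‖circleAverage g 0 R‖ ≤ circleAverage (fun z ↦ ‖g z‖) 0 R := by
  rw [circleAverage_def, circleAverage_def, norm_smul, smul_eq_mul,
    Real.norm_of_nonneg (by positivity)]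
  exact mul_le_mul_of_nonneg_left
    (intervalIntegral.norm_integral_le_integral_norm (by positivity)) (by positivity)

lemma circleAverage_abs_log_norm {f : ℂ → ℂ} (hf : Meromorphic f) (R : ℝ) :
    circleAverage (fun z ↦ |Real.log ‖f z‖|) 0 R = proximity f ⊤ R + proximity f⁻¹ ⊤ R := by
  rw [proximity_top, proximity_top, ← circleAverage_add
    (hf.meromorphicOn.circleIntegrable_posLog_norm)
    (hf.inv.meromorphicOn.circleIntegrable_posLog_norm)]
  congr 1
  ext z
  simp only [Pi.add_apply, Pi.inv_apply, norm_inv, posLog, Real.log_inv]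
  rcases le_total 0 (Real.log ‖f z‖) with h | h
  · rw [abs_of_nonneg h, max_eq_right h, max_eq_left (by linarith), add_zero]
  · rw [abs_of_nonpos h, max_eq_left h, max_eq_right (by linarith), zero_add]

lemma sqrt_add_le {x y : ℝ} (hx : 0 ≤ x) (hy : 0 ≤ y) : √(x + y) ≤ √x + √y := by
  rw [Real.sqrt_le_left (by positivity)]
  nlinarith [Real.sq_sqrt hx, Real.sq_sqrt hy, Real.sqrt_nonneg x, Real.sqrt_nonneg y,
    mul_nonneg (Real.sqrt_nonneg x) (Real.sqrt_nonneg y)]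

lemma sqrt_sum_le {ι : Type*} (s : Finset ι) (x : ι → ℝ) (hx : ∀ i ∈ s, 0 ≤ x i) :
    √(∑ i ∈ s, x i) ≤ ∑ i ∈ s, √(x i) := by
  classical
  induction s using Finset.induction_on with
  | empty => simp
  | insert a s ha ih =>
    rw [Finset.sum_insert ha, Finset.sum_insert ha]
    have h1 := ih fun i hi ↦ hx i (Finset.mem_insert_of_mem hi)
    have h2 := sqrt_add_le (hx a (Finset.mem_insert_self _ _))
      (Finset.sum_nonneg fun i hi ↦ hx i (Finset.mem_insert_of_mem hi))
    linarith

/-- Concavity of y ↦ log(1 + y), in the form of the tangent at K. Being linear in y, the bound can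
be averaged, and then replaces Jensen's inequality when K bounds the mean of y. The square root
makes the singularities 1/|w - u| integrable. -/
lemma posLog_le_of_sqrt_le {x y K : ℝ} (hK : 0 ≤ K) (hx : 0 ≤ x) (hxy : √x ≤ y) :
    log⁺ x ≤ 2 * (Real.log (1 + K) + (y - K) / (1 + K)) := by
  have hs := Real.sqrt_nonneg x
  have h1 : log⁺ x ≤ 2 * Real.log (1 + √x) := by
    rw [← Real.log_rpow (by positivity) , posLog]
    refine max_le ?_ ?_
    · exact Real.log_nonneg (Real.one_le_rpow (by linarith) (by norm_num))
    · rcases hx.eq_or_lt with h | h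
      · simp [← h]
      · refine Real.log_le_log h ?_
        rw [Real.rpow_two]
        nlinarith [Real.sq_sqrt hx]
  have h2 : Real.log (1 + √x) ≤ Real.log (1 + y) := Real.log_le_log (by linarith) (by linarith)
  have h3 : Real.log (1 + y) - Real.log (1 + K) ≤ (1 + y) / (1 + K) - 1 := by
    rw [← Real.log_div (by linarith) (by linarith)]
    exact Real.log_le_sub_one_of_pos (div_pos (by linarith) (by linarith))
  have h4 : (1 + y) / (1 + K) - 1 = (y - K) / (1 + K) := by
    field_simp
    ring
  linarith

/-- The number of zeros and poles of `f` in the disk of radius `R`, with multiplicities. -/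
def zeroPoleCount (f : ℂ → ℂ) (R : ℝ) : ℝ := ∑ᶠ u, |(divisor f (ball 0 R) u : ℝ)|

lemma proximity_mul_logDeriv_le {f : ℂ → ℂ} (hf : Meromorphic f)
    (hf' : ∀ z, meromorphicOrderAt f z ≠ ⊤) {r R : ℝ} (hr : 0 < r) (hrR : r < R)
    (hs : ∀ z ∈ sphere 0 R, meromorphicOrderAt f z = 0) :
    proximity (fun z ↦ z * logDeriv f z) ⊤ r ≤ 2 * Real.log (1 +
      (√(2 * r * R / (R - r) ^ 2 * (proximity f ⊤ R + proximity f⁻¹ ⊤ R)) +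
        zeroPoleCount f R * (√(r / (R - r)) + sinAverage))) := by
  have hR : 0 < R := hr.trans hrR
  obtain ⟨h, hh, h0, hnorm, hlog⟩ := exists_logDeriv_eq hf hf' hs
  have hfin := (hf.meromorphicOn (s := closedBall 0 R)).divisor_ball_support_finite
  set t := hfin.toFinset with ht
  set D := divisor f (ball 0 R) with hD
  have htb : ∀ u ∈ t, u ∈ ball 0 R := fun u hu ↦ D.supportWithinDomain (by simpa [ht] using hu)
  have hn : zeroPoleCount f R = ∑ u ∈ t, |(D u : ℝ)| := by
    refine finsum_eq_sum_of_support_subset _ fun u hu ↦ ?_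
    rw [ht, hfin.coe_toFinset]
    intro h1
    exact hu (by change |((D u : ℤ) : ℝ)| = 0; simp [h1])
  set M := proximity f ⊤ R + proximity f⁻¹ ⊤ R with hM
  set A := 2 * r * R / (R - r) ^ 2 * M with hA
  -- The zero-free part: the kernel is at most 2R/(R - r)² on the circle, and |log |h|| has the same
  -- mean there as |log |f||, namely m(R,f) + m(R,1/f).
  have hW : ∀ w, ‖w‖ = r → ‖w * logDeriv h w‖ ≤ A := by
    intro w hw
    have hwb : w ∈ ball 0 R := by simpa [hw] using hrR
    rw [logDeriv_eq_circleAverage hh h0 hwb, norm_mul, hw]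
    have hint : CircleIntegrable (fun ζ ↦ |Real.log ‖h ζ‖|) 0 R :=
      (MeromorphicOn.circleIntegrable_log_norm_of_nonneg
        (hh.mono sphere_subset_closedBall).meromorphicOn hR.le).abs
    have h1 : circleAverage (fun ζ ↦ |Real.log ‖h ζ‖|) 0 R = M := by
      rw [hM, ← circleAverage_abs_log_norm hf]
      refine circleAverage_congr_codiscreteWithin ?_ hR.ne'
      rw [abs_of_pos hR]
      filter_upwards [hnorm] with z hz
      rw [hz]
    have h2 : circleAverage (fun ζ ↦ ‖(2 * ζ / (ζ - w) ^ 2) • (Real.log ‖h ζ‖ : ℂ)‖) 0 R ≤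
        circleAverage (fun ζ ↦ (2 * R / (R - r) ^ 2) • |Real.log ‖h ζ‖|) 0 R := by
      refine circleAverage_mono ?_ (hint.const_smul (a := 2 * R / (R - r) ^ 2)) ?_
      · refine (ContinuousOn.circleIntegrable hR.le ?_)
        have hc : ContinuousOn (fun ζ ↦ (Real.log ‖h ζ‖ : ℂ)) (sphere 0 R) := by
          refine continuous_ofReal.comp_continuousOn (ContinuousOn.log ?_ ?_)
          · exact (hh.mono sphere_subset_closedBall).continuousOn.norm
          · intro x hx
            exact norm_ne_zero_iff.2 (h0 x (sphere_subset_closedBall hx))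
        have hc' : ContinuousOn (fun ζ : ℂ ↦ 2 * ζ / (ζ - w) ^ 2) (sphere 0 R) := by
          refine ContinuousOn.div (by fun_prop) (by fun_prop) ?_
          intro x hx
          refine pow_ne_zero _ (sub_ne_zero.2 ?_)
          rintro rfl
          simp only [mem_sphere, dist_zero_right] at hx
          linarith
        exact (ContinuousOn.smul hc' hc).norm
      · intro ζ hζ
        rw [abs_of_pos hR, mem_sphere, dist_zero_right] at hζ
        rw [norm_smul, norm_real, norm_div, norm_mul, hζ, norm_pow, smul_eq_mul, Real.norm_eq_abs]
        have h3 : R - r ≤ ‖ζ - w‖ := by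
          have := norm_sub_norm_le ζ w
          linarith
        have h4 : 0 < R - r := by linarith
        have h5 : ‖(2 : ℂ)‖ = 2 := by simp
        rw [h5]
        gcongr
    rw [circleAverage_fun_smul, h1, smul_eq_mul] at h2
    refine (mul_le_mul_of_nonneg_left (norm_circleAverage_le.trans h2) hr.le).trans (le_of_eq ?_)
    rw [hA]
    ring
  have hM0 : 0 ≤ M := add_nonneg (proximity_nonneg R) (proximity_nonneg R)
  have hA0 : 0 ≤ A := mul_nonneg (by positivity) hM0
  set q := r / (R - r) with hq
  have hq0 : 0 ≤ q := div_nonneg hr.le (by linarith)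
  -- Y majorizes the square root of |w f'/f|; its circle average is at most K wherever the zeros and
  -- poles lie.
  set Y : ℂ → ℝ := fun w ↦ √A + ∑ u ∈ t, |(D u : ℝ)| * (√q + √(r / ‖w - u‖)) with hY
  set K := √A + zeroPoleCount f R * (√q + sinAverage) with hK
  have hn0 : 0 ≤ zeroPoleCount f R := by
    rw [hn]; exact Finset.sum_nonneg fun _ _ ↦ abs_nonneg _
  have hK0 : 0 ≤ K := by
    have := sinAverage_nonneg
    positivity
  have hYi : CircleIntegrable Y 0 r := by
    refine (circleIntegrable_const _ _ _).add ?_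
    refine CircleIntegrable.fun_sum _ fun u _ ↦ ?_
    exact IntervalIntegrable.const_mul
      ((circleIntegrable_const _ _ _).add (circleIntegrable_sqrt_div_norm_sub hr u)) _
  have hYavg : circleAverage Y 0 r ≤ K := by
    rw [hY, circleAverage_fun_add (circleIntegrable_const _ _ _), circleAverage_const,
      circleAverage_fun_sum, hK, hn, Finset.sum_mul]
    · gcongr with u hu
      have : circleAverage (fun z ↦ |(D u : ℝ)| * (√q + √(r / ‖z - u‖))) 0 r =
          |(D u : ℝ)| * (√q + circleAverage (fun z ↦ √(r / ‖z - u‖)) 0 r) := by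
        simp_rw [← smul_eq_mul]
        rw [circleAverage_fun_smul, circleAverage_fun_add (circleIntegrable_const _ _ _)
          (circleIntegrable_sqrt_div_norm_sub hr u), circleAverage_const]
      rw [this]
      gcongr
      exact circleAverage_sqrt_div_norm_sub_le hr u
    · exact fun u _ ↦ IntervalIntegrable.const_mul
        ((circleIntegrable_const _ _ _).add (circleIntegrable_sqrt_div_norm_sub hr u)) _
    · refine CircleIntegrable.fun_sum _ fun u _ ↦ ?_
      exact IntervalIntegrable.const_mul
        ((circleIntegrable_const _ _ _).add (circleIntegrable_sqrt_div_norm_sub hr u)) _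
  have hpt : ∀ᶠ w in codiscreteWithin (sphere 0 r),
      log⁺ ‖w * logDeriv f w‖ ≤ 2 * (Real.log (1 + K) + (Y w - K) / (1 + K)) := by
    have hsub : sphere (0 : ℂ) r ⊆ ball 0 R := fun z hz ↦ by
      simp only [mem_sphere, dist_zero_right] at hz
      simpa [hz] using hrR
    have htc : ∀ᶠ w in codiscreteWithin (sphere (0 : ℂ) r), w ∉ t :=
      codiscreteWithin_mono (subset_univ _) (t.finite_toSet.compl_mem_codiscrete)
    filter_upwards [codiscreteWithin_mono hsub hlog, htc,
      self_mem_codiscreteWithin (sphere (0 : ℂ) r)] with w hw hwt hws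
    have hws' : ‖w‖ = r := by simpa using hws
    have hwlog : logDeriv f w = logDeriv h w -
        ∑ u ∈ t, (D u : ℂ) * logDeriv (canonicalFactor R u) w := hw
    refine posLog_le_of_sqrt_le hK0 (norm_nonneg _) ?_
    have h1 : ‖w * logDeriv f w‖ ≤ A + ∑ u ∈ t, |(D u : ℝ)| * (q + r / ‖w - u‖) := by
      rw [hwlog, mul_sub, Finset.mul_sum]
      refine (norm_sub_le _ _).trans (add_le_add (hW w hws') ((norm_sum_le _ _).trans ?_))
      refine Finset.sum_le_sum fun u hu ↦ ?_
      rw [mul_left_comm, norm_mul]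
      refine mul_le_mul (le_of_eq ?_) ?_ (norm_nonneg _) (abs_nonneg _)
      · simp
      · exact norm_mul_logDeriv_canonicalFactor_le (htb u hu) hrR hws' fun h1 ↦ hwt (h1 ▸ hu)
    refine (Real.sqrt_le_sqrt h1).trans ?_
    have h2 : ∀ u ∈ t, 0 ≤ |(D u : ℝ)| * (q + r / ‖w - u‖) := fun u _ ↦ by positivity
    refine (sqrt_add_le hA0 (Finset.sum_nonneg h2)).trans ?_
    refine add_le_add le_rfl ((sqrt_sum_le _ _ h2).trans (Finset.sum_le_sum fun u _ ↦ ?_))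
    rw [Real.sqrt_mul (abs_nonneg _)]
    refine mul_le_mul ?_ (sqrt_add_le hq0 (by positivity)) (Real.sqrt_nonneg _)
      (abs_nonneg _)
    rw [Real.sqrt_le_left (abs_nonneg _)]
    -- Integrality of the multiplicity lets √|D u| be replaced by |D u|.
    have h3 : |D u| ≤ |D u| ^ 2 := by
      rcases (abs_nonneg (D u)).eq_or_lt with h | h
      · rw [← h]; simp
      · nlinarith
    exact_mod_cast h3
  have hmer : Meromorphic fun z ↦ z * logDeriv f z :=
    fun z ↦ analyticAt_id.meromorphicAt.fun_mul (hf.logDeriv z)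
  have hfinal := circleAverage_mono_codiscrete hr (hmer.meromorphicOn.circleIntegrable_posLog_norm)
    (ψ := fun w ↦ 2 * (Real.log (1 + K) + (Y w - K) / (1 + K))) ?_ hpt
  · rw [proximity_top]
    refine hfinal.trans ?_
    have h1 : circleAverage (fun w ↦ 2 * (Real.log (1 + K) + (Y w - K) / (1 + K))) 0 r =
        circleAverage (fun w ↦ 2 * Real.log (1 + K) - 2 * K / (1 + K) + (2 / (1 + K)) • Y w) 0 r := by
      congr 1
      ext w
      rw [smul_eq_mul]
      ring
    have hYi' : CircleIntegrable (fun w ↦ (2 / (1 + K)) • Y w) 0 r := hYi.const_smul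
    rw [h1, circleAverage_fun_add (circleIntegrable_const _ _ _) hYi',
      circleAverage_const, circleAverage_fun_smul, smul_eq_mul]
    have h2 : 2 / (1 + K) * circleAverage Y 0 r ≤ 2 / (1 + K) * K := by gcongr
    have h3 : 2 / (1 + K) * K = 2 * K / (1 + K) := by ring
    linarith
  · have h1 : CircleIntegrable (fun w ↦ Real.log (1 + K) + (Y w - K) / (1 + K)) 0 r :=
      (circleIntegrable_const _ _ _).add
        (IntervalIntegrable.div_const (IntervalIntegrable.sub hYi (circleIntegrable_const K 0 r)) _)
    exact IntervalIntegrable.const_mul h1 _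

end Nevanlinna
end

/-! ### Choice of radii and the growth form of the logarithmic derivative lemma -/

open Filter Set MeasureTheory

noncomputable section

namespace Nevanlinna

open Topology Real Metric Complex MeromorphicOn ValueDistribution
open Function (locallyFinsupp)
open Function.locallyFinsuppWithin (logCounting_le single logCounting_single_eq_log_sub_const)

/-- A point with 0 < |u| < R contributes log(ρ/|u|) ≥ log(ρ/R) per unit of multiplicity to the
counting functions at ρ. -/
lemma zeroPoleCount_mul_log_le {f : ℂ → ℂ} (hf : Meromorphic f) {R ρ : ℝ} (hR : 1 ≤ R)
    (hRρ : R < ρ) :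
    zeroPoleCount f R * Real.log (ρ / R) ≤
      ValueDistribution.logCounting f 0 ρ + ValueDistribution.logCounting f ⊤ ρ := by
  classical
  have hR0 : 0 < R := by linarith
  have hfin := (hf.meromorphicOn (s := closedBall 0 R)).divisor_ball_support_finite
  have htb : ∀ u ∈ hfin.toFinset, u ∈ ball 0 R := fun u hu ↦
    (divisor f (ball 0 R)).supportWithinDomain (by simpa using hu)
  have hval : ∀ u ∈ hfin.toFinset, divisor f (ball 0 R) u = divisor f univ u := fun u hu ↦ by
    rw [divisor_apply hf.meromorphicOn (htb u hu), divisor_apply hf.meromorphicOn (mem_univ u)]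
  have hn : zeroPoleCount f R = ∑ u ∈ hfin.toFinset, |(divisor f univ u : ℝ)| := by
    rw [zeroPoleCount, finsum_eq_sum_of_support_subset (s := hfin.toFinset)]
    · exact Finset.sum_congr rfl fun u hu ↦ by rw [hval u hu]
    · intro u hu
      rw [hfin.coe_toFinset]
      intro h1
      have h2 : divisor f (ball 0 R) u = 0 := h1
      exact hu (by simp [h2])
  set D : locallyFinsupp ℂ ℤ := ∑ u ∈ hfin.toFinset, single u |divisor f univ u| with hD
  have hle : D ≤ (divisor f univ)⁺ + (divisor f univ)⁻ := by
    rw [Function.locallyFinsuppWithin.le_def]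
    intro z
    have h1 : D z = ∑ u ∈ hfin.toFinset, if z = u then |divisor f univ u| else 0 := by
      rw [hD, Function.locallyFinsuppWithin.coe_sum, Finset.sum_apply]
      exact Finset.sum_congr rfl fun u _ ↦ by simp
    have h2 : ((divisor f univ)⁺ + (divisor f univ)⁻) z = |divisor f univ z| := by
      rw [Function.locallyFinsuppWithin.coe_add, Pi.add_apply, Function.locallyFinsuppWithin.posPart_apply,
        Function.locallyFinsuppWithin.negPart_apply, posPart_add_negPart]
    rw [h1, h2, Finset.sum_ite_eq]
    split_ifs <;> simp
  have hlog := logCounting_le hle (r := ρ) (by linarith)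
  rw [map_add, Pi.add_apply, ← ValueDistribution.logCounting_zero,
    ← ValueDistribution.logCounting_top] at hlog
  refine le_trans ?_ hlog
  rw [hD, map_sum, Finset.sum_apply, hn, Finset.sum_mul]
  refine Finset.sum_le_sum fun u hu ↦ ?_
  have hu' : ‖u‖ < R := by simpa using htb u hu
  rw [logCounting_single_eq_log_sub_const (by linarith), Int.cast_abs]
  refine mul_le_mul_of_nonneg_left ?_ (abs_nonneg _)
  rw [Real.log_div (by linarith) hR0.ne']
  -- The origin contributes log ρ, matching the convention log 0 = 0; comparing it with log(ρ/R)
  -- requires R ≥ 1.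
  rcases (norm_nonneg u).eq_or_lt with h | h
  · rw [← h, Real.log_zero]
    linarith [Real.log_nonneg hR]
  · linarith [Real.log_le_log h hu'.le]

lemma exists_sphere_meromorphicOrderAt_eq_zero {f : ℂ → ℂ} (hf : Meromorphic f)
    (hf' : ∀ z, meromorphicOrderAt f z ≠ ⊤) {a b : ℝ} (hab : a < b) :
    ∃ R ∈ Ioo a b, ∀ z ∈ sphere (0 : ℂ) R, meromorphicOrderAt f z = 0 := by
  have hfin : ((divisor f univ).support ∩ closedBall 0 b).Finite := by
    have := (divisor f (closedBall 0 b)).finiteSupport (isCompact_closedBall 0 b)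
    refine this.subset ?_
    rintro z ⟨h1, h2⟩
    have h3 : divisor f univ z ≠ 0 := h1
    rw [divisor_apply hf.meromorphicOn (mem_univ z)] at h3
    change divisor f (closedBall 0 b) z ≠ 0
    rwa [divisor_apply hf.meromorphicOn h2]
  obtain ⟨R, hR, hR'⟩ := ((Ioo_infinite hab).sdiff (hfin.image norm)).nonempty
  refine ⟨R, hR, fun z hz ↦ ?_⟩
  have hz' : ‖z‖ = R := by simpa using hz
  by_contra h
  refine hR' ⟨z, ⟨?_, ?_⟩, hz'⟩
  · change divisor f univ z ≠ 0
    rw [divisor_apply hf.meromorphicOn (mem_univ z)]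
    intro h0
    rcases WithTop.untop₀_eq_zero.1 h0 with h1 | h1
    · exact h h1
    · exact hf' z h1
  · simpa [hz'] using hR.2.le

lemma proximity_inv_id {r : ℝ} (hr : 1 ≤ r) : proximity (fun z : ℂ ↦ z⁻¹) ⊤ r = 0 := by
  rw [proximity_top]
  have h1 : circleAverage (fun z : ℂ ↦ log⁺ ‖z⁻¹‖) 0 r = circleAverage (fun _ : ℂ ↦ (0 : ℝ)) 0 r := by
    refine circleAverage_congr_sphere fun z hz ↦ ?_
    rw [abs_of_pos (by linarith), mem_sphere, dist_zero_right] at hz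
    rw [norm_inv, hz, posLog_eq_zero_iff, abs_of_pos (by positivity)]
    exact inv_le_one_of_one_le₀ hr
  rw [h1, circleAverage_const]

lemma proximity_logDeriv_le_proximity_mul {f : ℂ → ℂ} (hf : Meromorphic f) {r : ℝ} (hr : 1 ≤ r) :
    proximity (logDeriv f) ⊤ r ≤ proximity (fun z ↦ z * logDeriv f z) ⊤ r := by
  have h1 : proximity (logDeriv f) ⊤ r =
      proximity ((fun z : ℂ ↦ z⁻¹) * fun z ↦ z * logDeriv f z) ⊤ r := by
    refine proximity_congr_codiscrete ?_ (by linarith)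
    filter_upwards [(Set.finite_singleton (0 : ℂ)).compl_mem_codiscrete] with z hz
    have hz' : z ≠ 0 := hz
    simp [hz']
  have hid : Meromorphic fun z : ℂ ↦ z⁻¹ := fun z ↦ analyticAt_id.meromorphicAt.inv
  rw [h1]
  refine (proximity_mul_top_le hid
    (fun z ↦ analyticAt_id.meromorphicAt.fun_mul (hf.logDeriv z)) r).trans ?_
  rw [Pi.add_apply, proximity_inv_id hr, zero_add]

/-- With s = T(r,f) every quantity is polynomially bounded in s. The exponent 3, doubled, is the
source of the factor 6 in front of log T(r,f). -/
lemma one_add_growth_le {s c C K M n q x : ℝ} (hs : 1 ≤ s) (hc : 0 ≤ c) (hC : 0 ≤ C)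
    (hx : x ≤ 36 * s ^ 2) (hM0 : 0 ≤ M) (hM : M ≤ (4 + C) * s)
    (hn : n ≤ 6 * ((4 + C) * s) * s) (hn0 : 0 ≤ n) (hq : q ≤ 3 * s)
    (hK : K = √(x * M) + n * (√q + c)) :
    1 + K ≤ (1 + 36 * (4 + C) + 6 * (4 + C) * (3 + c)) * s ^ 3 := by
  have hs3 : 1 ≤ s ^ 3 := one_le_pow₀ hs
  have h1 : √(x * M) ≤ 36 * (4 + C) * s ^ 3 := by
    have h2 : x * M ≤ 36 * s ^ 2 * ((4 + C) * s) := by gcongr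
    refine (Real.sqrt_le_sqrt h2).trans (Real.sqrt_le_iff.2 ⟨by positivity, ?_⟩)
    have h3 : 1 ≤ 36 * (4 + C) * s ^ 3 := by nlinarith
    nlinarith
  have h2 : √q + c ≤ (3 + c) * s := by
    have : √q ≤ 3 * s := Real.sqrt_le_iff.2 ⟨by positivity, by nlinarith⟩
    nlinarith
  have h3 : n * (√q + c) ≤ 6 * ((4 + C) * s) * s * ((3 + c) * s) := by
    have := Real.sqrt_nonneg q
    gcongr
  nlinarith

/-- The **lemma on the logarithmic derivative**. -/
theorem proximity_logDeriv_le {f : ℂ → ℂ} (hf : Meromorphic f)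
    (hf' : ∀ z, meromorphicOrderAt f z ≠ ⊤) (hT : Tendsto (T f) atTop atTop) :
    ∃ C : ℝ, ∀ᶠ r in finLog, proximity (logDeriv f) ⊤ r ≤ C + 6 * Real.log (T f r) := by
  obtain ⟨r₁, hr₁⟩ := (hT.eventually_ge_atTop 1).exists_forall_of_atTop
  set r₀ := max 1 r₁ with hr₀
  have hborel := eventually_finLog_lt_two_mul (S := T f) (r₀ := r₀) (le_max_left _ _)
    ((characteristic_monotoneOn hf).mono fun x hx ↦
      mem_Ioi.2 (lt_of_lt_of_le one_pos ((le_max_left 1 r₁).trans hx)))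
    fun r hr ↦ hr₁ r ((le_max_right _ _).trans hr)
  set C₀ := |Real.log ‖meromorphicTrailingCoeffAt f 0‖| with hC₀
  have hinv : ∀ R ≠ 0, characteristic f⁻¹ ⊤ R ≤ T f R + C₀ := fun R hR ↦ by
    have h1 := characteristic_sub_characteristic_inv_of_ne_zero hf hR
    have h2 := neg_abs_le (Real.log ‖meromorphicTrailingCoeffAt f 0‖)
    change _ ≤ characteristic f ⊤ R + _
    linarith
  refine ⟨2 * Real.log (1 + 36 * (4 + C₀) + 6 * (4 + C₀) * (3 + sinAverage)), ?_⟩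
  filter_upwards [hborel, finLog_le_atTop (eventually_ge_atTop r₀)] with r hr hrr
  have hr1 : 1 ≤ r := (le_max_left _ _).trans hrr
  have hr0 : 0 < r := by linarith
  have hs : 1 ≤ T f r := hr₁ r ((le_max_right _ _).trans hrr)
  set s := T f r with hsdef
  have hs0 : 0 < s := by linarith
  have hC0 : 0 ≤ C₀ := abs_nonneg _
  -- Borel's lemma gives T(ρ,f) < 2s. R is taken in the middle third of (r, ρ), so R - r and ρ - R
  -- both exceed r/(3s); the constants below follow from this and ρ ≤ 2r.
  set ρ := r * (1 + 1 / s) with hρ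
  have hs1 : 0 < r / s := by positivity
  have hs2 : r / s ≤ r := div_le_self hr0.le hs
  have hρ' : ρ = r + r / s := by rw [hρ]; ring
  obtain ⟨R, ⟨hR1, hR2⟩, hR⟩ := exists_sphere_meromorphicOrderAt_eq_zero hf hf'
    (a := r + r / s / 3) (b := r + 2 * (r / s) / 3) (by linarith)
  have hrR : r < R := by linarith
  have hRρ : R < ρ := by linarith
  have hTR : T f R ≤ T f ρ :=
    characteristic_monotoneOn hf (by simp; linarith) (by simp; linarith) hRρ.le
  have hM : proximity f ⊤ R + proximity f⁻¹ ⊤ R ≤ (4 + C₀) * s := by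
    have h1 : proximity f ⊤ R ≤ T f R :=
      le_add_of_nonneg_right (ValueDistribution.logCounting_nonneg (by linarith))
    have h2 : proximity f⁻¹ ⊤ R ≤ characteristic f⁻¹ ⊤ R :=
      le_add_of_nonneg_right (ValueDistribution.logCounting_nonneg (by linarith))
    have h3 := hinv R (by linarith)
    nlinarith
  have hn : zeroPoleCount f R ≤ 6 * ((4 + C₀) * s) * s := by
    have h1 := zeroPoleCount_mul_log_le hf (R := R) (by linarith) hRρ
    have h2 : ValueDistribution.logCounting f ⊤ ρ ≤ T f ρ :=
      le_add_of_nonneg_left (proximity_nonneg ρ)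
    have h3 : ValueDistribution.logCounting f 0 ρ ≤ T f ρ + C₀ := by
      refine le_trans ?_ (hinv ρ (by linarith))
      rw [← ValueDistribution.logCounting_inv]
      exact le_add_of_nonneg_left (proximity_nonneg ρ)
    have h4 : 1 / (6 * s) ≤ Real.log (ρ / R) := by
      have h5 := Real.one_sub_inv_le_log_of_pos (x := ρ / R) (div_pos (by linarith) (by linarith))
      refine le_trans ?_ h5
      rw [inv_div, le_sub_iff_add_le, ← le_sub_iff_add_le', div_le_iff₀ (by linarith)]
      have h6 : 1 / (6 * s) * ρ ≤ r / s / 3 := by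
        have : 1 / (6 * s) * ρ ≤ 1 / (6 * s) * (2 * r) := by gcongr; linarith
        refine this.trans (le_of_eq ?_)
        field_simp
        norm_num
      linarith
    have hn0 : 0 ≤ zeroPoleCount f R := finsum_nonneg fun _ ↦ abs_nonneg _
    have h7 : zeroPoleCount f R * (1 / (6 * s)) ≤ (4 + C₀) * s := by
      have := mul_le_mul_of_nonneg_left h4 hn0
      nlinarith
    rw [mul_one_div, div_le_iff₀ (by positivity)] at h7
    linarith
  have hq : r / (R - r) ≤ 3 * s := by
    rw [div_le_iff₀ (by linarith)]
    have h1 : 3 * s * (r / s / 3) ≤ 3 * s * (R - r) := by gcongr; linarith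
    have h2 : 3 * s * (r / s / 3) = r := by field_simp
    linarith
  have hx : 2 * r * R / (R - r) ^ 2 ≤ 36 * s ^ 2 := by
    have h1 : 2 * r * R / (R - r) ^ 2 ≤ 4 * (r / (R - r)) ^ 2 := by
      rw [div_pow, ← mul_div_assoc]
      exact div_le_div_of_nonneg_right (by nlinarith) (sq_nonneg _)
    have h2 : (r / (R - r)) ^ 2 ≤ (3 * s) ^ 2 := by
      have : 0 ≤ r / (R - r) := div_nonneg hr0.le (by linarith)
      gcongr
    linarith
  have hprox := (proximity_logDeriv_le_proximity_mul hf hr1).trans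
    (proximity_mul_logDeriv_le hf hf' hr0 hrR hR)
  have hM0 : 0 ≤ proximity f ⊤ R + proximity f⁻¹ ⊤ R :=
    add_nonneg (proximity_nonneg R) (proximity_nonneg R)
  have hn0 : 0 ≤ zeroPoleCount f R := finsum_nonneg fun _ ↦ abs_nonneg _
  have hgrow := one_add_growth_le hs sinAverage_nonneg hC0 hx hM0 hM hn hn0 hq rfl
  refine hprox.trans ?_
  have hsin := sinAverage_nonneg
  have hlog := Real.log_le_log (by positivity) hgrow
  rw [Real.log_mul (by positivity) (by positivity), Real.log_pow] at hlog
  push_cast at hlog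
  linarith

theorem proximity_logDeriv_isLittleO {f g : ℂ → ℂ} (hg : Meromorphic g)
    (hg' : ∀ z, meromorphicOrderAt g z ≠ ⊤) (hT : Tendsto (T g) atTop atTop)
    (hgf : T g =O[finLog] T f) : proximity (logDeriv g) ⊤ =o[finLog] T f := by
  obtain ⟨C, hC⟩ := proximity_logDeriv_le hg hg' hT
  have hT' := hT.mono_left finLog_le_atTop
  have h1 : (fun r ↦ C + 6 * Real.log (T g r)) =o[finLog] T g := by
    refine Asymptotics.IsLittleO.add ?_ ?_
    · exact Asymptotics.isLittleO_const_left.2 (Or.inr (tendsto_norm_atTop_atTop.comp hT'))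
    · exact (Real.isLittleO_log_id_atTop.comp_tendsto hT').const_mul_left 6
  refine Asymptotics.IsLittleO.trans_isBigO ?_ hgf
  refine Asymptotics.IsBigO.trans_isLittleO ?_ h1
  refine Asymptotics.IsBigO.of_bound 1 ?_
  filter_upwards [hC] with r hr
  rw [one_mul, Real.norm_of_nonneg (proximity_nonneg r)]
  exact hr.trans (le_abs_self _)

end Nevanlinna
end

/-! ### Orders and divisors modulo discrete sets; growth of the characteristic -/

open Filter Set MeasureTheory

noncomputable section

namespace Nevanlinna

open Topology Real Metric Complex MeromorphicOn ValueDistribution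
open Function (locallyFinsupp)
open Function.locallyFinsuppWithin (logCounting logCounting_le single
  logCounting_single_eq_log_sub_const)

lemma eventually_codiscrete_iff {p : ℂ → Prop} :
    (∀ᶠ z in codiscrete ℂ, p z) ↔ ∀ z, ∀ᶠ w in 𝓝[≠] z, p w := by
  change {z | p z} ∈ codiscreteWithin univ ↔ _
  rw [mem_codiscreteWithin_iff_forall_mem_nhdsNE]
  simp [Filter.Eventually]

lemma eventuallyEq_zero_iff_order_eq_top {g : ℂ → ℂ} :
    g =ᶠ[codiscrete ℂ] 0 ↔ ∀ z, meromorphicOrderAt g z = ⊤ := by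
  rw [EventuallyEq, eventually_codiscrete_iff]
  simp [meromorphicOrderAt_eq_top_iff]

lemma order_ne_top {g : ℂ → ℂ} (hg : Meromorphic g) (h : ¬ g =ᶠ[codiscrete ℂ] 0) (z : ℂ) :
    meromorphicOrderAt g z ≠ ⊤ := by
  rw [eventuallyEq_zero_iff_order_eq_top] at h
  push Not at h
  exact hg.exists_meromorphicOrderAt_ne_top_iff_forall.1 h z

lemma not_eventuallyEq_zero_of_order_ne_top {g : ℂ → ℂ} {z : ℂ} (h : meromorphicOrderAt g z ≠ ⊤) :
    ¬ g =ᶠ[codiscrete ℂ] 0 :=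
  fun h0 ↦ h (eventuallyEq_zero_iff_order_eq_top.1 h0 z)

lemma eventually_codiscrete_ne_zero {g : ℂ → ℂ} (hg : Meromorphic g)
    (h : ¬ g =ᶠ[codiscrete ℂ] 0) : ∀ᶠ z in codiscrete ℂ, g z ≠ 0 :=
  eventually_codiscrete_iff.2 fun z ↦
    (meromorphicOrderAt_ne_top_iff_eventually_ne_zero (hg z)).1 (order_ne_top hg h z)

lemma eventuallyEq_deriv {g h : ℂ → ℂ} (hgh : g =ᶠ[codiscrete ℂ] h) :
    deriv g =ᶠ[codiscrete ℂ] deriv h :=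
  eventually_codiscrete_iff.2 fun z ↦
    Filter.EventuallyEq.nhdsNE_deriv (eventually_codiscrete_iff.1 hgh z)

lemma NonConstant.not_eventuallyEq_zero {g : ℂ → ℂ} (hg : NonConstant g) :
    ¬ g =ᶠ[codiscrete ℂ] 0 := hg 0

lemma NonConstant.sub_const {g : ℂ → ℂ} (hg : NonConstant g) (c : ℂ) :
    ¬ (fun z ↦ g z - c) =ᶠ[codiscrete ℂ] 0 := by
  intro h
  refine hg c ?_
  filter_upwards [h] with z hz
  simpa [sub_eq_zero] using hz

/-- The divisor of zeros and poles. -/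
abbrev ord (g : ℂ → ℂ) : locallyFinsupp ℂ ℤ := divisor g univ

lemma ord_apply {g : ℂ → ℂ} (hg : Meromorphic g) (z : ℂ) :
    ord g z = (meromorphicOrderAt g z).untop₀ := divisor_apply hg.meromorphicOn (mem_univ z)

lemma order_eq_ord {g : ℂ → ℂ} (hg : Meromorphic g) (h : ¬ g =ᶠ[codiscrete ℂ] 0) (z : ℂ) :
    meromorphicOrderAt g z = (ord g z : ℤ) := by
  rw [ord_apply hg, WithTop.coe_untop₀_of_ne_top (order_ne_top hg h z)]

lemma ord_eq_of_order {g : ℂ → ℂ} (hg : Meromorphic g) {z : ℂ} {n : ℤ}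
    (h : meromorphicOrderAt g z = n) : ord g z = n := by
  rw [ord_apply hg, h, WithTop.untop₀_coe]

lemma ord_congr {g h : ℂ → ℂ} (hgh : g =ᶠ[codiscrete ℂ] h) : ord g = ord h :=
  divisor_congr_codiscreteWithin hgh isOpen_univ

lemma ord_mul {g h : ℂ → ℂ} (hg : Meromorphic g) (hg0 : ¬ g =ᶠ[codiscrete ℂ] 0)
    (hh : Meromorphic h) (hh0 : ¬ h =ᶠ[codiscrete ℂ] 0) : ord (g * h) = ord g + ord h :=
  divisor_mul hg.meromorphicOn hh.meromorphicOn (fun z _ ↦ order_ne_top hg hg0 z)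
    fun z _ ↦ order_ne_top hh hh0 z

lemma ord_inv {g : ℂ → ℂ} : ord g⁻¹ = - ord g := divisor_inv

lemma ord_pow {g : ℂ → ℂ} (hg : Meromorphic g) (n : ℕ) : ord (g ^ n) = n • ord g :=
  divisor_pow hg.meromorphicOn n

lemma not_eventuallyEq_zero_inv {g : ℂ → ℂ} (hg0 : ¬ g =ᶠ[codiscrete ℂ] 0) :
    ¬ g⁻¹ =ᶠ[codiscrete ℂ] 0 := by
  intro h
  refine hg0 ?_
  filter_upwards [h] with z hz
  simpa using hz

lemma ord_div {g h : ℂ → ℂ} (hg : Meromorphic g) (hg0 : ¬ g =ᶠ[codiscrete ℂ] 0)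
    (hh : Meromorphic h) (hh0 : ¬ h =ᶠ[codiscrete ℂ] 0) : ord (g / h) = ord g - ord h := by
  rw [div_eq_mul_inv, ord_mul hg hg0 hh.inv (not_eventuallyEq_zero_inv hh0), ord_inv, sub_eq_add_neg]

lemma not_eventuallyEq_zero_mul {g h : ℂ → ℂ} (hg : Meromorphic g) (hh : Meromorphic h)
    (hg0 : ¬ g =ᶠ[codiscrete ℂ] 0) (hh0 : ¬ h =ᶠ[codiscrete ℂ] 0) :
    ¬ g * h =ᶠ[codiscrete ℂ] 0 := by
  intro h1
  have h2 : ∀ᶠ z in codiscrete ℂ, False := by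
    filter_upwards [h1, eventually_codiscrete_ne_zero hg hg0, eventually_codiscrete_ne_zero hh hh0]
      with z hz h3 h4
    exact mul_ne_zero h3 h4 hz
  exact hg0 (h2.mono fun z hz ↦ hz.elim)

lemma not_eventuallyEq_zero_div {g h : ℂ → ℂ} (hg : Meromorphic g) (hh : Meromorphic h)
    (hg0 : ¬ g =ᶠ[codiscrete ℂ] 0) (hh0 : ¬ h =ᶠ[codiscrete ℂ] 0) :
    ¬ g / h =ᶠ[codiscrete ℂ] 0 := by
  rw [div_eq_mul_inv]
  exact not_eventuallyEq_zero_mul hg hh.inv hg0 (not_eventuallyEq_zero_inv hh0)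

lemma not_eventuallyEq_zero_pow {g : ℂ → ℂ} (hg0 : ¬ g =ᶠ[codiscrete ℂ] 0) (n : ℕ) :
    ¬ g ^ n =ᶠ[codiscrete ℂ] 0 := by
  intro h
  refine hg0 ?_
  filter_upwards [h] with z hz
  by_contra h0
  exact pow_ne_zero n h0 hz

lemma not_eventuallyEq_zero_const {c : ℂ} (hc : c ≠ 0) :
    ¬ (fun _ : ℂ ↦ c) =ᶠ[codiscrete ℂ] 0 := by
  refine not_eventuallyEq_zero_of_order_ne_top (z := 0) ?_
  rw [meromorphicOrderAt_const]
  simp [hc]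

lemma ord_const (c : ℂ) : ord (fun _ : ℂ ↦ c) = 0 := by
  ext z
  rw [ord_apply (fun z ↦ analyticAt_const.meromorphicAt), meromorphicOrderAt_const]
  split_ifs <;> simp

lemma ord_deriv_of_ne {g : ℂ → ℂ} (hg : Meromorphic g) {z : ℂ} (h : ord g z ≠ 0) :
    ord (deriv g) z = ord g z - 1 := by
  have h1 : meromorphicOrderAt g z = (ord g z : ℤ) := by
    rw [ord_apply hg] at h ⊢
    rw [WithTop.coe_untop₀_of_ne_top]
    intro h2
    simp [h2] at h
  refine ord_eq_of_order hg.deriv (meromorphicOrderAt_deriv_eq_sub_one ?_ h1)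
  exact_mod_cast h

lemma order_deriv_nonneg {g : ℂ → ℂ} (hg : MeromorphicAt g z) (h : 0 ≤ meromorphicOrderAt g z) :
    0 ≤ meromorphicOrderAt (deriv g) z := by
  rcases eq_or_ne (meromorphicOrderAt g z) ⊤ with h1 | h1
  · rw [meromorphicOrderAt_eq_top_iff] at h1
    have h2 : deriv g =ᶠ[𝓝[≠] z] fun _ ↦ 0 := by
      have := Filter.EventuallyEq.nhdsNE_deriv (f₁ := g) (f := fun _ ↦ (0 : ℂ)) h1
      simpa using this
    rw [meromorphicOrderAt_eq_top_iff.2 h2]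
    exact le_top
  · obtain ⟨n, hn⟩ := WithTop.ne_top_iff_exists.1 h1
    rw [← hn] at h
    have hn0 : 0 ≤ n := by exact_mod_cast h
    rcases hn0.eq_or_lt with h0 | h0
    · have h3 := meromorphicOrderAt_logDeriv_nonneg hg (by rw [← hn, ← h0]; rfl)
      have h4 : deriv g =ᶠ[𝓝[≠] z] logDeriv g * g := by
        filter_upwards [(meromorphicOrderAt_ne_top_iff_eventually_ne_zero hg).1 h1] with w hw
        rw [Pi.mul_apply, logDeriv_apply, div_mul_cancel₀ _ hw]
      rw [meromorphicOrderAt_congr h4, meromorphicOrderAt_mul hg.logDeriv hg]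
      exact add_nonneg h3 (by rw [← hn]; exact_mod_cast hn0)
    · rw [meromorphicOrderAt_deriv_eq_sub_one (n := n) (by exact_mod_cast h0.ne') hn.symm]
      exact_mod_cast (by omega : 0 ≤ n - 1)

lemma ord_deriv_nonneg {g : ℂ → ℂ} (hg : Meromorphic g) {z : ℂ} (h : 0 ≤ ord g z) :
    0 ≤ ord (deriv g) z := by
  rw [ord_apply hg] at h
  rw [ord_apply hg.deriv]
  have := order_deriv_nonneg (hg z) (WithTop.untop₀_nonneg.1 h)
  exact WithTop.untop₀_nonneg.2 this

lemma exists_analyticAt {g : ℂ → ℂ} (hg : Meromorphic g) : ∃ z, AnalyticAt ℂ g z := by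
  have h : ∀ᶠ z in codiscrete ℂ, AnalyticAt ℂ g z :=
    hg.meromorphicOn.eventually_codiscreteWithin_analyticAt (U := univ)
  exact (eventually_codiscrete_iff.1 h 0).exists

/-- A meromorphic function whose derivative vanishes is constant. -/
lemma not_eventuallyEq_zero_deriv {g : ℂ → ℂ} (hg : Meromorphic g) (hc : NonConstant g) :
    ¬ deriv g =ᶠ[codiscrete ℂ] 0 := by
  obtain ⟨z₀, hz₀⟩ := exists_analyticAt hg
  have hm : Meromorphic fun z ↦ g z - g z₀ := hg.fun_sub (Meromorphic.const _)
  -- At a point of analyticity, g - g(z₀) has a zero of finite positive order, which differentiation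
  -- lowers by exactly one.
  have h1 := order_ne_top hm (hc.sub_const (g z₀)) z₀
  have h2 : 0 < meromorphicOrderAt (fun z ↦ g z - g z₀) z₀ := by
    rw [← tendsto_zero_iff_meromorphicOrderAt_pos (hm z₀)]
    have : ContinuousAt (fun z ↦ g z - g z₀) z₀ := by
      have := hz₀.continuousAt
      fun_prop
    simpa using this.tendsto.mono_left nhdsWithin_le_nhds
  obtain ⟨n, hn⟩ := WithTop.ne_top_iff_exists.1 h1
  rw [← hn] at h2
  have hn0 : 0 < n := by exact_mod_cast h2
  have h3 := meromorphicOrderAt_deriv_eq_sub_one (n := n) (by exact_mod_cast hn0.ne') hn.symm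
  have h4 : deriv (fun z ↦ g z - g z₀) = deriv g := by
    ext z
    simp
  rw [h4] at h3
  refine not_eventuallyEq_zero_of_order_ne_top (z := z₀) ?_
  rw [h3]
  exact WithTop.coe_ne_top

lemma exists_const_of_not_nonConstant {g : ℂ → ℂ} (h : ¬ NonConstant g) :
    ∃ c : ℂ, g =ᶠ[codiscrete ℂ] fun _ ↦ c := by
  simpa [NonConstant] using h

lemma exists_T_inv_le {g : ℂ → ℂ} (hg : Meromorphic g) :
    ∃ C, ∀ r, T g⁻¹ r ≤ T g r + C ∧ T g r ≤ T g⁻¹ r + C :=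
  ⟨max |Real.log ‖g 0‖| |Real.log ‖meromorphicTrailingCoeffAt g 0‖|, fun r ↦ by
    have := abs_le.1 (characteristic_sub_characteristic_inv_le hg (R := r))
    constructor <;> linarith⟩

lemma logCounting_negPart_le_T (g : ℂ → ℂ) (r : ℝ) : logCounting (ord g)⁻ r ≤ T g r := by
  rw [← logCounting_top]
  exact le_add_of_nonneg_left (proximity_nonneg r)

lemma logCounting_posPart_le_T_inv (g : ℂ → ℂ) (r : ℝ) : logCounting (ord g)⁺ r ≤ T g⁻¹ r := by
  rw [← logCounting_zero, ← ValueDistribution.logCounting_inv]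
  exact le_add_of_nonneg_left (proximity_nonneg r)

/-- A single zero of g - g(z₀) already contributes log r + O(1) to its counting function. -/
lemma tendsto_T {g : ℂ → ℂ} (hg : Meromorphic g) (hc : NonConstant g) :
    Tendsto (T g) atTop atTop := by
  classical
  obtain ⟨z₀, hz₀⟩ := exists_analyticAt hg
  have hm : Meromorphic fun z ↦ g z - g z₀ := hg.fun_sub (Meromorphic.const _)
  have h2 : 0 < meromorphicOrderAt (fun z ↦ g z - g z₀) z₀ := by
    rw [← tendsto_zero_iff_meromorphicOrderAt_pos (hm z₀)]
    have : ContinuousAt (fun z ↦ g z - g z₀) z₀ := by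
      have := hz₀.continuousAt
      fun_prop
    simpa using this.tendsto.mono_left nhdsWithin_le_nhds
  rw [order_eq_ord hm (hc.sub_const _)] at h2
  have hn0 : 0 < ord (fun z ↦ g z - g z₀) z₀ := by exact_mod_cast h2
  have hle : single z₀ 1 ≤ (ord fun z ↦ g z - g z₀)⁺ := by
    rw [Function.locallyFinsuppWithin.le_def]
    intro z
    rw [Function.locallyFinsuppWithin.posPart_apply]
    by_cases hz : z = z₀
    · subst hz
      simp only [Function.locallyFinsuppWithin.single_apply, if_true]
      rw [posPart_eq_self.2 hn0.le]
      omega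
    · simp [hz, posPart_nonneg]
  obtain ⟨C, hC⟩ := exists_T_inv_le hm
  have hlow : ∀ᶠ r in atTop, Real.log r - Real.log ‖z₀‖ - C - (log⁺ ‖g z₀‖ + Real.log 2) ≤ T g r := by
    filter_upwards [eventually_ge_atTop 1, eventually_ge_atTop ‖z₀‖] with r hr hr'
    have h3 := logCounting_le hle hr
    rw [logCounting_single_eq_log_sub_const hr'] at h3
    have h4 := logCounting_posPart_le_T_inv (fun z ↦ g z - g z₀) r
    have h5 := (hC r).1
    have h6 := (abs_le.1 (abs_characteristic_sub_characteristic_shift_le (a₀ := g z₀) (r := r) hg)).1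
    push_cast at h3
    simp only [T] at *
    linarith only [h3, h4, h5, h6]
  refine tendsto_atTop_mono' _ hlow ?_
  refine tendsto_atTop_add_const_right _ _ (tendsto_atTop_add_const_right _ _
    (tendsto_atTop_add_const_right _ _ Real.tendsto_log_atTop))

end Nevanlinna
end

/-! ### Calculus of error terms S(r,f) -/

open Filter Set MeasureTheory

noncomputable section

namespace Nevanlinna

open Topology Real Metric Complex MeromorphicOn ValueDistribution Asymptotics
open Function (locallyFinsupp)
open Function.locallyFinsuppWithin (logCounting logCounting_le)

/-- `u ≤ v + S(r, f)`, outside a set of finite logarithmic measure. -/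
def AsympLE (f : ℂ → ℂ) (u v : ℝ → ℝ) : Prop :=
  ∀ ε > 0, ∀ᶠ r in finLog, u r ≤ v r + ε * T f r

lemma eventually_finLog_one_le : ∀ᶠ r in finLog, (1 : ℝ) ≤ r :=
  finLog_le_atTop (eventually_ge_atTop 1)

lemma T_nonneg (f : ℂ → ℂ) {r : ℝ} (hr : 1 ≤ r) : 0 ≤ T f r := characteristic_nonneg hr

namespace AsympLE

variable {f : ℂ → ℂ} {u v w u' v' : ℝ → ℝ}

lemma of_le (h : ∀ r, 1 ≤ r → u r ≤ v r) : AsympLE f u v := by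
  intro ε hε
  filter_upwards [eventually_finLog_one_le] with r hr
  have := T_nonneg f hr
  have := h r hr
  nlinarith

lemma refl : AsympLE f u u := of_le fun _ _ ↦ le_rfl

lemma trans (h1 : AsympLE f u v) (h2 : AsympLE f v w) : AsympLE f u w := by
  intro ε hε
  filter_upwards [h1 (ε / 2) (by positivity), h2 (ε / 2) (by positivity)] with r ha hb
  linarith

lemma trans_le (h1 : AsympLE f u v) (h2 : ∀ r, 1 ≤ r → v r ≤ w r) : AsympLE f u w :=
  h1.trans (of_le h2)

lemma le_trans (h1 : ∀ r, 1 ≤ r → u r ≤ v r) (h2 : AsympLE f v w) : AsympLE f u w :=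
  (of_le h1).trans h2

lemma add (h1 : AsympLE f u v) (h2 : AsympLE f u' v') : AsympLE f (u + u') (v + v') := by
  intro ε hε
  filter_upwards [h1 (ε / 2) (by positivity), h2 (ε / 2) (by positivity)] with r ha hb
  simp only [Pi.add_apply]
  linarith

lemma const_mul (h : AsympLE f u v) {c : ℝ} (hc : 0 ≤ c) :
    AsympLE f (fun r ↦ c * u r) (fun r ↦ c * v r) := by
  intro ε hε
  filter_upwards [h (ε / (c + 1)) (by positivity), eventually_finLog_one_le] with r ha hr
  have h1 : c * u r ≤ c * (v r + ε / (c + 1) * T f r) := mul_le_mul_of_nonneg_left ha hc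
  have h0 := T_nonneg f hr
  have h2 : c * (ε / (c + 1)) ≤ ε := by
    rw [mul_div_assoc', div_le_iff₀ (by linarith)]
    nlinarith
  nlinarith

lemma of_isLittleO (h : (u - v) =o[finLog] T f) : AsympLE f u v := by
  intro ε hε
  filter_upwards [h.def hε, eventually_finLog_one_le] with r hr h1
  rw [Real.norm_of_nonneg (T_nonneg f h1)] at hr
  have := (le_abs_self _).trans hr
  simp only [Pi.sub_apply] at this
  linarith

lemma zero_of_isLittleO (h : u =o[finLog] T f) : AsympLE f u 0 :=
  of_isLittleO (by simpa using h)

lemma add_zero_right (h1 : AsympLE f u v) (h2 : AsympLE f w 0) : AsympLE f (u + w) v := by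
  simpa using h1.add h2

lemma not_of_tendsto (hT : Tendsto (T f) atTop atTop) {c c' : ℝ} (hc : c' < c)
    (hv : ∀ᶠ r in atTop, v r ≤ c' * T f r) : ¬ AsympLE f (fun r ↦ c * T f r) v := by
  intro h
  have h1 := h ((c - c') / 2) (by linarith)
  obtain ⟨r, hr, hr1, hr2⟩ := (h1.and (finLog_le_atTop
    (hv.and (hT.eventually_gt_atTop 0)))).exists
  nlinarith

end AsympLE

lemma isLittleO_const_T {f : ℂ → ℂ} (hT : Tendsto (T f) atTop atTop) (c : ℝ) :
    (fun _ : ℝ ↦ c) =o[finLog] T f :=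
  isLittleO_const_left.2 (Or.inr (tendsto_norm_atTop_atTop.comp (hT.mono_left finLog_le_atTop)))

lemma AsympLE.of_le_add_const {f : ℂ → ℂ} (hT : Tendsto (T f) atTop atTop) {u v : ℝ → ℝ} {c : ℝ}
    (h : ∀ r, 1 ≤ r → u r ≤ v r + c) : AsympLE f u v := by
  refine AsympLE.le_trans h ?_
  have : (fun r ↦ v r + c) = v + fun _ ↦ c := rfl
  rw [this]
  exact AsympLE.refl.add_zero_right (.zero_of_isLittleO (isLittleO_const_T hT c))

/-- `g` is meromorphic and `T(r, g) = O(T(r, f))` outside a set of finite logarithmic measure. -/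
structure Comparable (f g : ℂ → ℂ) : Prop where
  meromorphic : Meromorphic g
  isBigO : T g =O[finLog] T f

/-- `g` is meromorphic and `T(r, g) = o(T(r, f))` outside a set of finite logarithmic measure. -/
structure Negligible (f g : ℂ → ℂ) : Prop where
  meromorphic : Meromorphic g
  isLittleO : T g =o[finLog] T f

lemma IsSmall.negligible {f a : ℂ → ℂ} (h : IsSmall f a) : Negligible f a := by
  obtain ⟨hm, E, hE, ho⟩ := h
  exact ⟨hm, ho.mono (finLog_le_of_volume_lt_top hE)⟩

lemma Negligible.comparable {f a : ℂ → ℂ} (h : Negligible f a) : Comparable f a :=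
  ⟨h.meromorphic, h.isLittleO.isBigO⟩

lemma isBigO_of_nonneg_le {f : ℂ → ℂ} {u v : ℝ → ℝ} (h0 : ∀ r, 1 ≤ r → 0 ≤ u r)
    (h : ∀ r, 1 ≤ r → u r ≤ v r) (hv : v =O[finLog] T f) : u =O[finLog] T f := by
  refine IsBigO.trans (IsBigO.of_bound 1 ?_) hv
  filter_upwards [eventually_finLog_one_le] with r hr
  rw [one_mul, Real.norm_of_nonneg (h0 r hr)]
  exact (h r hr).trans (le_abs_self _)

lemma isLittleO_of_nonneg_le {f : ℂ → ℂ} {u v : ℝ → ℝ} (h0 : ∀ r, 1 ≤ r → 0 ≤ u r)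
    (h : ∀ r, 1 ≤ r → u r ≤ v r) (hv : v =o[finLog] T f) : u =o[finLog] T f := by
  refine IsBigO.trans_isLittleO (IsBigO.of_bound 1 ?_) hv
  filter_upwards [eventually_finLog_one_le] with r hr
  rw [one_mul, Real.norm_of_nonneg (h0 r hr)]
  exact (h r hr).trans (le_abs_self _)

lemma T_congr {g h : ℂ → ℂ} (hgh : g =ᶠ[codiscrete ℂ] h) : T g =ᶠ[finLog] T h := by
  filter_upwards [eventually_finLog_one_le] with r hr
  exact characteristic_congr_codiscrete hgh (by linarith)

lemma T_const (c : ℂ) : T (fun _ ↦ c) = fun _ ↦ log⁺ ‖c‖ := by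
  ext r
  simp [T, characteristic]

/-- A pole of order q becomes one of order q + 1 ≤ 2q. -/
lemma logCounting_negPart_deriv_le {g : ℂ → ℂ} (hg : Meromorphic g) {r : ℝ} (hr : 1 ≤ r) :
    logCounting (ord (deriv g))⁻ r ≤ 2 * logCounting (ord g)⁻ r := by
  have hle : (ord (deriv g))⁻ ≤ 2 • (ord g)⁻ := by
    rw [Function.locallyFinsuppWithin.le_def]
    intro z
    simp only [Function.locallyFinsuppWithin.coe_nsmul, Pi.smul_apply,
      Function.locallyFinsuppWithin.negPart_apply]
    rcases lt_or_ge (ord g z) 0 with h | h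
    · rw [ord_deriv_of_ne hg h.ne, negPart_eq_neg.2 h.le, negPart_eq_neg.2 (by omega)]
      simp only [nsmul_eq_mul]
      push_cast
      omega
    · rw [negPart_eq_zero.2 (ord_deriv_nonneg hg h)]
      simp [negPart_nonneg]
  have := logCounting_le hle hr
  rw [map_nsmul] at this
  simpa using this

lemma logCounting_nonneg' {D : locallyFinsupp ℂ ℤ} (h : 0 ≤ D) {r : ℝ} (hr : 1 ≤ r) :
    0 ≤ logCounting D r := Function.locallyFinsuppWithin.logCounting_nonneg h hr

lemma logDeriv_eventuallyEq_zero {g : ℂ → ℂ} (hc : ¬ NonConstant g) :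
    logDeriv g =ᶠ[codiscrete ℂ] fun _ ↦ 0 := by
  obtain ⟨c, hc⟩ := exists_const_of_not_nonConstant hc
  filter_upwards [eventuallyEq_deriv hc] with z hz
  simp [logDeriv_apply, hz]

/-- The lemma on the logarithmic derivative for functions whose characteristic is comparable to that
of `f`. -/
lemma Comparable.proximity_logDeriv {f g : ℂ → ℂ}
    (hg : Comparable f g) : proximity (logDeriv g) ⊤ =o[finLog] T f := by
  by_cases hc : NonConstant g
  · exact proximity_logDeriv_isLittleO hg.meromorphic
      (order_ne_top hg.meromorphic hc.not_eventuallyEq_zero) (tendsto_T hg.meromorphic hc) hg.isBigO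
  · refine (isLittleO_zero (T f) finLog).congr' ?_ .rfl
    filter_upwards [eventually_finLog_one_le] with r hr
    rw [proximity_congr_codiscrete (logDeriv_eventuallyEq_zero hc) (by linarith)]
    simp

namespace Comparable

variable {f g h : ℂ → ℂ}

lemma congr (hg : Comparable f g) (hh : Meromorphic h) (hgh : g =ᶠ[codiscrete ℂ] h) :
    Comparable f h :=
  ⟨hh, hg.isBigO.congr' (T_congr hgh) .rfl⟩

lemma const (hT : Tendsto (T f) atTop atTop) (c : ℂ) : Comparable f fun _ ↦ c := by
  refine ⟨Meromorphic.const c, ?_⟩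
  rw [T_const]
  exact (isLittleO_const_T hT _).isBigO

lemma self (hf : Meromorphic f) : Comparable f f := ⟨hf, isBigO_refl _ _⟩

lemma add (hT : Tendsto (T f) atTop atTop) (hg : Comparable f g) (hh : Comparable f h) :
    Comparable f (g + h) :=
  ⟨hg.meromorphic.add hh.meromorphic, isBigO_of_nonneg_le (fun _ hr ↦ T_nonneg _ hr)
    (fun _ hr ↦ characteristic_add_top_le hg.meromorphic hh.meromorphic hr)
    ((hg.isBigO.add hh.isBigO).add (isLittleO_const_T hT _).isBigO)⟩

lemma mul (hT : Tendsto (T f) atTop atTop) (hg : Comparable f g) (hh : Comparable f h) :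
    Comparable f (g * h) := by
  by_cases hg0 : g =ᶠ[codiscrete ℂ] 0
  · refine (const hT 0).congr (hg.meromorphic.mul hh.meromorphic) ?_
    filter_upwards [hg0] with z hz
    simp [hz]
  by_cases hh0 : h =ᶠ[codiscrete ℂ] 0
  · refine (const hT 0).congr (hg.meromorphic.mul hh.meromorphic) ?_
    filter_upwards [hh0] with z hz
    simp [hz]
  exact ⟨hg.meromorphic.mul hh.meromorphic, isBigO_of_nonneg_le (fun _ hr ↦ T_nonneg _ hr)
    (fun _ hr ↦ characteristic_mul_top_le hr hg.meromorphic (order_ne_top hg.meromorphic hg0)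
      hh.meromorphic (order_ne_top hh.meromorphic hh0)) (hg.isBigO.add hh.isBigO)⟩

lemma inv (hT : Tendsto (T f) atTop atTop) (hg : Comparable f g) : Comparable f g⁻¹ := by
  obtain ⟨C, hC⟩ := exists_T_inv_le hg.meromorphic
  exact ⟨hg.meromorphic.inv, isBigO_of_nonneg_le (fun _ hr ↦ T_nonneg _ hr) (fun r _ ↦ (hC r).1)
    (hg.isBigO.add (isLittleO_const_T hT _).isBigO)⟩

lemma div (hT : Tendsto (T f) atTop atTop) (hg : Comparable f g) (hh : Comparable f h) :
    Comparable f (g / h) := by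
  rw [div_eq_mul_inv]
  exact hg.mul hT (hh.inv hT)

lemma sub_const (hT : Tendsto (T f) atTop atTop) (hg : Comparable f g) (c : ℂ) :
    Comparable f fun z ↦ g z - c := by
  have := hg.add hT (const hT (-c))
  refine this.congr (hg.meromorphic.fun_sub (Meromorphic.const c)) (.of_eq ?_)
  ext z
  simp [sub_eq_add_neg]

lemma pow (hT : Tendsto (T f) atTop atTop) (hg : Comparable f g) (n : ℕ) :
    Comparable f (g ^ n) := by
  induction n with
  | zero =>
    rw [pow_zero]
    exact const hT 1
  | succ n ih =>
    rw [pow_succ]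
    exact ih.mul hT hg

lemma sum (hT : Tendsto (T f) atTop atTop) {ι : Type*} (s : Finset ι) {F : ι → ℂ → ℂ}
    (hF : ∀ i ∈ s, Comparable f (F i)) : Comparable f (∑ i ∈ s, F i) :=
  Finset.sum_induction F (Comparable f) (fun _ _ ↦ add hT) (const hT 0) hF

lemma prod (hT : Tendsto (T f) atTop atTop) {ι : Type*} (s : Finset ι) {F : ι → ℂ → ℂ}
    (hF : ∀ i ∈ s, Comparable f (F i)) : Comparable f (∏ i ∈ s, F i) :=
  Finset.prod_induction F (Comparable f) (fun _ _ ↦ mul hT) (const hT 1) hF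

lemma deriv_eventuallyEq (hg : Meromorphic g) : logDeriv g * g =ᶠ[codiscrete ℂ] deriv g := by
  by_cases hg0 : g =ᶠ[codiscrete ℂ] 0
  · filter_upwards [hg0, eventuallyEq_deriv hg0] with z h1 h2
    simp [h1, h2]
  · filter_upwards [eventually_codiscrete_ne_zero hg hg0] with z hz
    rw [Pi.mul_apply, logDeriv_apply, div_mul_cancel₀ _ hz]

/-- Write g' = (g'/g) g in the proximity function. Iterated, this brings every derivative of f
within reach of the logarithmic derivative lemma with error S(r,f). -/
lemma deriv (hg : Comparable f g) : Comparable f (deriv g) := by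
  have hm := hg.meromorphic
  refine ⟨hm.deriv, isBigO_of_nonneg_le
    (v := fun r ↦ proximity (logDeriv g) ⊤ r + 2 * T g r) (fun _ hr ↦ T_nonneg _ hr)
    (fun r hr ↦ ?_) ((hg.proximity_logDeriv).isBigO.add (hg.isBigO.const_mul_left 2))⟩
  have h1 : proximity (_root_.deriv g) ⊤ r ≤ proximity (logDeriv g) ⊤ r + proximity g ⊤ r := by
    rw [← proximity_congr_codiscrete (deriv_eventuallyEq hm) (by linarith)]
    exact proximity_mul_top_le hm.logDeriv hm r
  have h2 := logCounting_negPart_deriv_le hm hr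
  rw [← ValueDistribution.logCounting_top, ← ValueDistribution.logCounting_top] at h2
  have h3 : 0 ≤ proximity g ⊤ r := proximity_nonneg r
  simp only [T, characteristic, Pi.add_apply]
  linarith

end Comparable

/-! ### Second main theorem, and zeros of logarithmic derivatives -/

lemma eventually_codiscrete_circle {p : ℂ → Prop} (h : ∀ᶠ z in codiscrete ℂ, p z) (r : ℝ) :
    ∀ᶠ z in codiscreteWithin (sphere (0 : ℂ) r), p z :=
  codiscreteWithin_mono (subset_univ _) h

/-- The pointwise core of the second main theorem, used with x = F and y = F'. For |x| ≤ 1 use the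
partial fractions y/(x-1) - y/x; for |x| ≥ 1 the factor |x| cancels the x in the denominator. -/
lemma posLog_add_log_le {x y : ℂ} (hx : x ≠ 0) (hx1 : x - 1 ≠ 0) (hy : y ≠ 0) :
    log⁺ ‖x‖ + Real.log ‖y / (x * (x - 1))‖ ≤
      log⁺ ‖y / x‖ + log⁺ ‖y / (x - 1)‖ + Real.log 2 := by
  have h2 : 0 ≤ Real.log 2 := Real.log_nonneg (by norm_num)
  rcases le_total ‖x‖ 1 with h | h
  · rw [(posLog_eq_zero_iff _).2 (by simpa using h), zero_add]
    have h3 : y / (x * (x - 1)) = y / (x - 1) - y / x := by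
      field_simp
      ring
    rw [h3]
    have h4 : Real.log ‖y / (x - 1) - y / x‖ ≤ log⁺ ‖y / (x - 1) - y / x‖ := le_max_right 0 (Real.log ‖y / (x - 1) - y / x‖)
    have h5 : log⁺ ‖y / (x - 1) - y / x‖ ≤ log⁺ (‖y / (x - 1)‖ + ‖y / x‖) :=
      posLog_le_posLog (norm_nonneg _) (norm_sub_le _ _)
    have h6 := posLog_add (x := ‖y / (x - 1)‖) (y := ‖y / x‖)
    linarith
  · rw [posLog_eq_log (by simpa using h)]
    have h4 : 0 ≤ log⁺ ‖y / x‖ := posLog_nonneg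
    · rw [← Real.log_mul (norm_ne_zero_iff.2 hx)
        (norm_ne_zero_iff.2 (div_ne_zero hy (mul_ne_zero hx hx1))), ← norm_mul]
      have h5 : x * (y / (x * (x - 1))) = y / (x - 1) := by
        field_simp
      rw [h5]
      have h6 : Real.log ‖y / (x - 1)‖ ≤ log⁺ ‖y / (x - 1)‖ := le_max_right 0 _
      linarith

lemma circleIntegrable_posLog {g : ℂ → ℂ} (hg : Meromorphic g) (r : ℝ) :
    CircleIntegrable (fun z ↦ log⁺ ‖g z‖) 0 r := hg.meromorphicOn.circleIntegrable_posLog_norm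

lemma circleIntegrable_log {g : ℂ → ℂ} (hg : Meromorphic g) (r : ℝ) :
    CircleIntegrable (fun z ↦ Real.log ‖g z‖) 0 r :=
  MeromorphicOn.circleIntegrable_log_norm hg.meromorphicOn

lemma exists_logCounting_ord_eq {g : ℂ → ℂ} (hg : Meromorphic g) :
    ∃ C, ∀ r, 1 ≤ r → logCounting (ord g) r = circleAverage (fun z ↦ Real.log ‖g z‖) 0 r + C :=
  ⟨-Real.log ‖meromorphicTrailingCoeffAt g 0‖, fun r hr ↦ by
    rw [Function.locallyFinsuppWithin.logCounting_divisor_eq_circleAverage_sub_const hg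
      (by linarith), sub_eq_add_neg]⟩

/-- The divisor whose counting function bounds `T(r, F)` in the second main theorem for the values
`0`, `1` and `∞`. -/
def smtDivisor (F : ℂ → ℂ) : locallyFinsupp ℂ ℤ :=
  (ord F)⁻ + ord F + (ord fun z ↦ F z - 1) - ord (deriv F)

/-- The **second main theorem** for the values `0`, `1` and `∞`. -/
theorem AsympLE.smt {f F : ℂ → ℂ} (hT : Tendsto (T f) atTop atTop) (hF : Comparable f F)
    (hc : NonConstant F) : AsympLE f (T F) (logCounting (smtDivisor F)) := by
  have hm := hF.meromorphic
  have hF1 : Comparable f fun z ↦ F z - 1 := hF.sub_const hT 1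
  have hm1 := hF1.meromorphic
  have h0 := hc.not_eventuallyEq_zero
  have h1 := hc.sub_const 1
  have hd := not_eventuallyEq_zero_deriv hm hc
  set ψ : ℂ → ℂ := deriv F / (F * fun z ↦ F z - 1) with hψ
  have hψm : Meromorphic ψ := hm.deriv.div (hm.mul hm1)
  have hordψ : ord ψ = ord (deriv F) - (ord F + ord fun z ↦ F z - 1) := by
    rw [hψ, ord_div hm.deriv hd (hm.mul hm1) (not_eventuallyEq_zero_mul hm hm1 h0 h1),
      ord_mul hm h0 hm1 h1]
  obtain ⟨C, hC⟩ := exists_logCounting_ord_eq hψm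
  -- Jensen's formula for ψ = F'/(F(F-1)) turns the mean of log |ψ| into the counting function of
  -- its divisor, so the ramification term is retained exactly.
  have hdiv : smtDivisor F = (ord F)⁻ - ord ψ := by
    rw [hordψ, smtDivisor]
    abel
  have hmain : ∀ r, 1 ≤ r → T F r ≤ (logCounting (smtDivisor F) r + (proximity (logDeriv F) ⊤ r +
      proximity (logDeriv fun z ↦ F z - 1) ⊤ r)) + (C + Real.log 2) := by
    intro r hr
    have hr0 : 0 < r := by linarith
    have hi1 := circleIntegrable_posLog hm r
    have hi2 := circleIntegrable_log hψm r
    have hi3 := circleIntegrable_posLog hm.logDeriv r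
    have hi4 := circleIntegrable_posLog hm1.logDeriv r
    have hi34 : CircleIntegrable
        (fun z ↦ log⁺ ‖logDeriv F z‖ + log⁺ ‖logDeriv (fun z ↦ F z - 1) z‖) 0 r := hi3.add hi4
    have hav : circleAverage (fun z ↦ log⁺ ‖F z‖ + Real.log ‖ψ z‖) 0 r ≤
        circleAverage (fun z ↦ (log⁺ ‖logDeriv F z‖ + log⁺ ‖logDeriv (fun z ↦ F z - 1) z‖) +
          Real.log 2) 0 r := by
      refine circleAverage_mono_codiscrete hr0 (hi1.add hi2)
        (hi34.add (circleIntegrable_const _ _ _)) ?_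
      refine eventually_codiscrete_circle ?_ r
      filter_upwards [eventually_codiscrete_ne_zero hm h0, eventually_codiscrete_ne_zero hm1 h1,
        eventually_codiscrete_ne_zero hm.deriv hd] with z h2 h3 h4
      have h5 : deriv (fun z ↦ F z - 1) z = deriv F z := by simp
      simp only [logDeriv_apply, h5, hψ, Pi.div_apply, Pi.mul_apply]
      exact posLog_add_log_le h2 h3 h4
    rw [circleAverage_fun_add hi1 hi2, circleAverage_fun_add hi34
      (circleIntegrable_const _ _ _), circleAverage_fun_add hi3 hi4, circleAverage_const] at hav
    have hTF : T F r = circleAverage (fun z ↦ log⁺ ‖F z‖) 0 r + logCounting (ord F)⁻ r := by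
      simp only [T, characteristic, Pi.add_apply, proximity_top, ValueDistribution.logCounting_top]
    rw [hTF, hdiv, map_sub, Pi.sub_apply, hC r hr, proximity_top, proximity_top]
    linarith
  refine (AsympLE.of_le_add_const hT hmain).trans ?_
  exact AsympLE.refl.add_zero_right
    (.zero_of_isLittleO ((hF.proximity_logDeriv).add (hF1.proximity_logDeriv)))

lemma reducedGE_apply (D : locallyFinsupp ℂ ℤ) (i : ℕ) (z : ℂ) :
    reducedGE D i z = if 0 < D z ∧ (i : ℤ) ≤ D z then 1 else 0 := rfl

lemma order_logDeriv_nonneg_iff {g : ℂ → ℂ} (hg : Meromorphic g) (hc : NonConstant g) (z : ℂ) :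
    (ord (logDeriv g))⁻ z = (reducedGE (ord g) 1 + reducedGE (-ord g) 1) z := by
  have h0 := order_ne_top hg hc.not_eventuallyEq_zero z
  have h1 := order_eq_ord hg hc.not_eventuallyEq_zero z
  rw [Function.locallyFinsuppWithin.negPart_apply, Function.locallyFinsuppWithin.coe_add,
    Pi.add_apply, reducedGE_apply, reducedGE_apply, Function.locallyFinsuppWithin.coe_neg,
    Pi.neg_apply]
  by_cases h : ord g z = 0
  · rw [h] at h1 ⊢
    have h2 := meromorphicOrderAt_logDeriv_nonneg (hg z) (by rw [h1]; rfl)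
    rw [negPart_eq_zero.2]
    · simp
    · rw [ord_apply hg.logDeriv]
      exact WithTop.untop₀_nonneg.2 h2
  · have h2 := meromorphicOrderAt_logDeriv_eq_neg_one (hg z)
      (by rw [h1]; exact_mod_cast h) h0
    rw [ord_eq_of_order (n := -1) hg.logDeriv h2]
    split_ifs <;> first | omega | simp

/-- The zeros of the logarithmic derivative are controlled by its (simple) poles. -/
theorem AsympLE.zeros_logDeriv {f g : ℂ → ℂ} (hT : Tendsto (T f) atTop atTop) (hg : Comparable f g)
    (hc : NonConstant g) : AsympLE f (logCounting (ord (logDeriv g))⁺)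
      (logCounting (reducedGE (ord g) 1 + reducedGE (-ord g) 1)) := by
  have hm := hg.meromorphic
  obtain ⟨C, hC⟩ := exists_T_inv_le hm.logDeriv
  have h1 : (ord (logDeriv g))⁻ = reducedGE (ord g) 1 + reducedGE (-ord g) 1 := by
    ext z
    exact order_logDeriv_nonneg_iff hm hc z
  rw [← h1]
  -- For L = g'/g: N(r,0;L) ≤ T(r,1/L) = T(r,L) + O(1), and m(r,L) is negligible.
  refine (AsympLE.of_le_add_const (c := C)
    (v := logCounting (ord (logDeriv g))⁻ + proximity (logDeriv g) ⊤) hT fun r hr ↦ ?_).trans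
    (AsympLE.refl.add_zero_right (.zero_of_isLittleO (hg.proximity_logDeriv)))
  refine (logCounting_posPart_le_T_inv _ r).trans ((hC r).1.trans (le_of_eq ?_))
  simp only [T, characteristic, Pi.add_apply, ValueDistribution.logCounting_top]
  ring

/-! ### Proximity and local orders of differential polynomials -/

/-- `g` is meromorphic and `m(r, g) = o(T(r, f))` outside a set of finite logarithmic measure. -/
structure ProxNegligible (f g : ℂ → ℂ) : Prop where
  meromorphic : Meromorphic g
  isLittleO : proximity g ⊤ =o[finLog] T f

lemma Negligible.proxNegligible {f g : ℂ → ℂ} (h : Negligible f g) : ProxNegligible f g :=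
  ⟨h.meromorphic, isLittleO_of_nonneg_le (fun r _ ↦ proximity_nonneg r)
    (fun _ hr ↦ le_add_of_nonneg_right (ValueDistribution.logCounting_nonneg hr)) h.isLittleO⟩

namespace ProxNegligible

variable {f g h : ℂ → ℂ}

lemma congr (hg : ProxNegligible f g) (hh : Meromorphic h) (hgh : g =ᶠ[codiscrete ℂ] h) :
    ProxNegligible f h := by
  refine ⟨hh, hg.isLittleO.congr' ?_ .rfl⟩
  filter_upwards [eventually_finLog_one_le] with r hr
  exact proximity_congr_codiscrete hgh (by linarith)

lemma one : ProxNegligible f 1 := by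
  refine ⟨Meromorphic.const 1, ?_⟩
  have : proximity (1 : ℂ → ℂ) ⊤ = fun _ ↦ 0 := by
    ext r
    change proximity (fun _ : ℂ ↦ (1 : ℂ)) ⊤ r = 0
    simp
  rw [this]
  exact isLittleO_zero _ _

lemma mul (hg : ProxNegligible f g) (hh : ProxNegligible f h) : ProxNegligible f (g * h) :=
  ⟨hg.meromorphic.mul hh.meromorphic, isLittleO_of_nonneg_le (fun r _ ↦ proximity_nonneg r)
    (fun r _ ↦ proximity_mul_top_le hg.meromorphic hh.meromorphic r)
    (hg.isLittleO.add hh.isLittleO)⟩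

lemma pow (hg : ProxNegligible f g) (n : ℕ) : ProxNegligible f (g ^ n) := by
  induction n with
  | zero => rw [pow_zero]; exact one
  | succ n ih => rw [pow_succ]; exact ih.mul hg

lemma prod {ι : Type*} (s : Finset ι) {F : ι → ℂ → ℂ} (hF : ∀ i ∈ s, ProxNegligible f (F i)) :
    ProxNegligible f (∏ i ∈ s, F i) :=
  Finset.prod_induction F (ProxNegligible f) (fun _ _ ↦ mul) one hF

lemma sum (hT : Tendsto (T f) atTop atTop) {ι : Type*} (s : Finset ι) {F : ι → ℂ → ℂ}
    (hF : ∀ i ∈ s, ProxNegligible f (F i)) : ProxNegligible f (∑ i ∈ s, F i) := by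
  refine ⟨Meromorphic.sum fun i hi ↦ (hF i hi).meromorphic, isLittleO_of_nonneg_le
    (fun r _ ↦ proximity_nonneg r)
    (fun r _ ↦ proximity_sum_top_le s F (fun i hi ↦ (hF i hi).meromorphic) r) ?_⟩
  have h1 : (∑ i ∈ s, proximity (F i) ⊤) =o[finLog] T f := by
    have := IsLittleO.sum (s := s) (A := fun i ↦ proximity (F i) ⊤) fun i hi ↦ (hF i hi).isLittleO
    refine this.congr_left fun r ↦ ?_
    simp
  exact h1.add (isLittleO_const_T hT _)

end ProxNegligible

lemma iteratedDeriv_meromorphic {f : ℂ → ℂ} (hf : Meromorphic f) (i : ℕ) :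
    Meromorphic (iteratedDeriv i f) := by
  induction i with
  | zero => simpa using hf
  | succ i ih => rw [iteratedDeriv_succ]; exact ih.deriv

lemma Comparable.iteratedDeriv {f : ℂ → ℂ} (hf : Meromorphic f)
    (i : ℕ) : Comparable f (iteratedDeriv i f) := by
  induction i with
  | zero => simpa using Comparable.self hf
  | succ i ih => rw [iteratedDeriv_succ]; exact ih.deriv

/-- The quotient telescopes into logarithmic derivatives f^(i+1)/f^(i), each negligible because
f^(i) is comparable to f. -/
lemma ProxNegligible.iteratedDeriv_div {f : ℂ → ℂ} (hf : Meromorphic f)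
    (hfc : NonConstant f) (i : ℕ) : ProxNegligible f (iteratedDeriv i f / f) := by
  induction i with
  | zero =>
    refine ProxNegligible.one.congr ((iteratedDeriv_meromorphic hf 0).div hf) ?_
    filter_upwards [eventually_codiscrete_ne_zero hf hfc.not_eventuallyEq_zero] with z hz
    simp [hz]
  | succ i ih =>
    have hi := Comparable.iteratedDeriv hf i
    refine ProxNegligible.congr (g := logDeriv (iteratedDeriv i f) * (iteratedDeriv i f / f))
      (ProxNegligible.mul ⟨hi.meromorphic.logDeriv, hi.proximity_logDeriv⟩ ih)
      ((iteratedDeriv_meromorphic hf (i + 1)).div hf) ?_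
    filter_upwards [Comparable.deriv_eventuallyEq hi.meromorphic] with z hz
    rw [iteratedDeriv_succ]
    simp only [Pi.mul_apply, Pi.div_apply] at hz ⊢
    rw [← hz]
    ring

lemma le_order_deriv {g : ℂ → ℂ} {z : ℂ} (hg : MeromorphicAt g z) {n : ℤ}
    (h : (n : WithTop ℤ) ≤ meromorphicOrderAt g z) :
    ((n - 1 : ℤ) : WithTop ℤ) ≤ meromorphicOrderAt (deriv g) z := by
  rcases le_or_gt 0 (meromorphicOrderAt g z) with h0 | h0
  · have h1 := order_deriv_nonneg hg h0
    rcases le_or_gt n 0 with hn | hn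
    · exact le_trans (by exact_mod_cast (by omega : n - 1 ≤ 0)) h1
    · rcases eq_or_ne (meromorphicOrderAt g z) ⊤ with h2 | h2
      · rw [meromorphicOrderAt_eq_top_iff] at h2
        have h3 : deriv g =ᶠ[𝓝[≠] z] fun _ ↦ 0 := by
          have := Filter.EventuallyEq.nhdsNE_deriv (f₁ := g) (f := fun _ ↦ (0 : ℂ)) h2
          simpa using this
        rw [meromorphicOrderAt_eq_top_iff.2 h3]
        exact le_top
      · obtain ⟨m, hm⟩ := WithTop.ne_top_iff_exists.1 h2
        rw [← hm] at h
        have h' : n ≤ m := by exact_mod_cast h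
        rw [meromorphicOrderAt_deriv_eq_sub_one (n := m) (by exact_mod_cast (by omega : m ≠ 0))
          hm.symm]
        exact_mod_cast (by omega : n - 1 ≤ m - 1)
  · obtain ⟨m, hm⟩ := WithTop.ne_top_iff_exists.1 (h0.trans_le le_top).ne
    rw [← hm] at h h0
    have h' : n ≤ m := by exact_mod_cast h
    have h0' : m < 0 := by exact_mod_cast h0
    rw [meromorphicOrderAt_deriv_eq_sub_one (n := m) (by exact_mod_cast h0'.ne) hm.symm]
    exact_mod_cast (by omega : n - 1 ≤ m - 1)

lemma le_order_iteratedDeriv {f : ℂ → ℂ} (hf : Meromorphic f) {z : ℂ} {n : ℤ}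
    (h : (n : WithTop ℤ) ≤ meromorphicOrderAt f z) (i : ℕ) :
    ((n - i : ℤ) : WithTop ℤ) ≤ meromorphicOrderAt (iteratedDeriv i f) z := by
  induction i with
  | zero => simpa using h
  | succ i ih =>
    rw [iteratedDeriv_succ]
    have := le_order_deriv (iteratedDeriv_meromorphic hf i z) ih
    convert this using 2
    push_cast
    ring

lemma order_iteratedDeriv_nonneg {f : ℂ → ℂ} (hf : Meromorphic f) {z : ℂ}
    (h : 0 ≤ meromorphicOrderAt f z) (i : ℕ) :
    0 ≤ meromorphicOrderAt (iteratedDeriv i f) z := by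
  induction i with
  | zero => simpa using h
  | succ i ih =>
    rw [iteratedDeriv_succ]
    exact order_deriv_nonneg (iteratedDeriv_meromorphic hf i z) ih

lemma le_order_sum {ι : Type*} (s : Finset ι) {F : ι → ℂ → ℂ} {z : ℂ} {c : WithTop ℤ}
    (hF : ∀ i ∈ s, MeromorphicAt (F i) z) (h : ∀ i ∈ s, c ≤ meromorphicOrderAt (F i) z) :
    c ≤ meromorphicOrderAt (∑ i ∈ s, F i) z := by
  refine (Finset.sum_induction F (fun g ↦ MeromorphicAt g z ∧ c ≤ meromorphicOrderAt g z) ?_ ?_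
    fun i hi ↦ ⟨hF i hi, h i hi⟩).2
  · rintro g g' ⟨h1, h2⟩ ⟨h3, h4⟩
    exact ⟨h1.add h3, (le_min h2 h4).trans (meromorphicOrderAt_add h1 h3)⟩
  · refine ⟨MeromorphicAt.const 0 z, ?_⟩
    have : meromorphicOrderAt (0 : ℂ → ℂ) z = ⊤ := by
      rw [meromorphicOrderAt_eq_top_iff]
      simp
    rw [this]
    exact le_top

lemma monEval_eq (f : ℂ → ℂ) (m : ℕ →₀ ℕ) :
    monEval f m = ∏ i ∈ m.support, iteratedDeriv i f ^ m i := by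
  ext z
  simp [monEval, Finsupp.prod]

lemma monEval_meromorphic {f : ℂ → ℂ} (hf : Meromorphic f) (m : ℕ →₀ ℕ) :
    Meromorphic (monEval f m) := by
  rw [monEval_eq]
  exact Meromorphic.prod fun i _ z ↦ (iteratedDeriv_meromorphic hf i z).pow _

lemma le_order_prod {ι : Type*} (s : Finset ι) {F : ι → ℂ → ℂ} {z : ℂ} {c : ι → ℤ}
    (hF : ∀ i ∈ s, MeromorphicAt (F i) z) (h : ∀ i ∈ s, (c i : WithTop ℤ) ≤ meromorphicOrderAt (F i) z) :
    ((∑ i ∈ s, c i : ℤ) : WithTop ℤ) ≤ meromorphicOrderAt (∏ i ∈ s, F i) z := by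
  rw [meromorphicOrderAt_prod hF, WithTop.coe_sum]
  exact Finset.sum_le_sum h

lemma le_order_pow {g : ℂ → ℂ} {z : ℂ} (hg : MeromorphicAt g z) {n : ℤ}
    (h : (n : WithTop ℤ) ≤ meromorphicOrderAt g z) (k : ℕ) :
    ((k * n : ℤ) : WithTop ℤ) ≤ meromorphicOrderAt (g ^ k) z := by
  have := le_order_prod (Finset.range k) (F := fun _ ↦ g) (c := fun _ ↦ n) (fun _ _ ↦ hg)
    fun _ _ ↦ h
  simpa using this

lemma sum_mul_sub_eq (m : ℕ →₀ ℕ) (q : ℤ) :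
    ∑ i ∈ m.support, (m i : ℤ) * (q - i) = monDegree m * q - (monWeight m - monDegree m) := by
  simp only [monDegree, monWeight, Finsupp.sum, Nat.cast_sum, Nat.cast_mul, Finset.sum_mul,
    ← Finset.sum_sub_distrib]
  refine Finset.sum_congr rfl fun i _ ↦ ?_
  push_cast
  ring

/-- Each differentiation lowers the order by at most one, at zeros and poles alike, and weight minus
degree is Σ i n_i, the total number of differentiations. -/
lemma le_order_monEval {f : ℂ → ℂ} (hf : Meromorphic f) (m : ℕ →₀ ℕ) {z : ℂ} {q : ℤ}
    (h : meromorphicOrderAt f z = q) :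
    ((monDegree m * q - (monWeight m - monDegree m) : ℤ) : WithTop ℤ) ≤
      meromorphicOrderAt (monEval f m) z := by
  rw [monEval_eq, ← sum_mul_sub_eq]
  refine le_order_prod _ (fun i _ ↦ (iteratedDeriv_meromorphic hf i z).pow _) fun i _ ↦ ?_
  exact le_order_pow (iteratedDeriv_meromorphic hf i z) (le_order_iteratedDeriv hf h.ge i) _

lemma order_monEval_nonneg {f : ℂ → ℂ} (hf : Meromorphic f) (m : ℕ →₀ ℕ) {z : ℂ}
    (h : 0 ≤ meromorphicOrderAt f z) : 0 ≤ meromorphicOrderAt (monEval f m) z := by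
  have := le_order_prod m.support (F := fun i ↦ iteratedDeriv i f ^ m i) (c := fun _ ↦ 0) (z := z)
    (fun i _ ↦ (iteratedDeriv_meromorphic hf i z).pow _) fun i _ ↦ by
      have := le_order_pow (iteratedDeriv_meromorphic hf i z) (n := 0)
        (order_iteratedDeriv_nonneg hf h i) (m i)
      simpa using this
  rw [monEval_eq]
  simpa using this

/-- The sum of the zeros and poles, all counted positively. -/
def absDiv (D : locallyFinsupp ℂ ℤ) : locallyFinsupp ℂ ℤ := D⁺ + D⁻

lemma absDiv_apply (D : locallyFinsupp ℂ ℤ) (z : ℂ) : absDiv D z = |D z| := by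
  rw [absDiv, Function.locallyFinsuppWithin.coe_add, Pi.add_apply,
    Function.locallyFinsuppWithin.posPart_apply, Function.locallyFinsuppWithin.negPart_apply,
    posPart_add_negPart]

lemma absDiv_nonneg (D : locallyFinsupp ℂ ℤ) : 0 ≤ absDiv D := by
  rw [Function.locallyFinsuppWithin.le_def]
  intro z
  rw [absDiv_apply]
  exact abs_nonneg _

lemma Negligible.absDiv {f g : ℂ → ℂ} (hT : Tendsto (T f) atTop atTop) (hg : Negligible f g) :
    logCounting (absDiv (ord g)) =o[finLog] T f := by
  obtain ⟨C, hC⟩ := exists_T_inv_le hg.meromorphic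
  refine isLittleO_of_nonneg_le (v := fun r ↦ 2 * T g r + C)
    (fun r hr ↦ logCounting_nonneg' (absDiv_nonneg _) hr) (fun r hr ↦ ?_)
    ((hg.isLittleO.const_mul_left 2).add (isLittleO_const_T hT C))
  rw [Nevanlinna.absDiv, map_add, Pi.add_apply]
  have h1 := logCounting_negPart_le_T g r
  have h2 := logCounting_posPart_le_T_inv g r
  have h3 := (hC r).1
  linarith

namespace DiffPoly

variable {f : ℂ → ℂ} (P : DiffPoly f)

/-- The zeros and poles of the coefficients. -/
def coeffDiv : locallyFinsupp ℂ ℤ := ∑ m ∈ P.monomials, absDiv (ord (P.coeff m))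

lemma coeffDiv_apply (z : ℂ) : P.coeffDiv z = ∑ m ∈ P.monomials, |ord (P.coeff m) z| := by
  rw [coeffDiv, Function.locallyFinsuppWithin.coe_sum, Finset.sum_apply]
  exact Finset.sum_congr rfl fun m _ ↦ absDiv_apply _ z

lemma abs_ord_coeff_le {m : ℕ →₀ ℕ} (hm : m ∈ P.monomials) (z : ℂ) :
    |ord (P.coeff m) z| ≤ P.coeffDiv z := by
  rw [coeffDiv_apply]
  exact Finset.single_le_sum (f := fun m ↦ |ord (P.coeff m) z|) (fun _ _ ↦ abs_nonneg _) hm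

lemma coeffDiv_nonneg (z : ℂ) : 0 ≤ P.coeffDiv z := by
  rw [coeffDiv_apply]
  exact Finset.sum_nonneg fun _ _ ↦ abs_nonneg _

lemma isLittleO_coeffDiv (hT : Tendsto (T f) atTop atTop) :
    logCounting P.coeffDiv =o[finLog] T f := by
  rw [coeffDiv, map_sum]
  have := IsLittleO.sum (s := P.monomials) (A := fun m ↦ logCounting (absDiv (ord (P.coeff m))))
    fun m hm ↦ (P.coeff_small m hm).negligible.absDiv hT
  refine this.congr_left fun r ↦ ?_
  simp

lemma eval_eq : P.eval = ∑ m ∈ P.monomials, P.coeff m * monEval f m := by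
  ext z
  simp [eval]

lemma coeff_meromorphic {m : ℕ →₀ ℕ} (hm : m ∈ P.monomials) : Meromorphic (P.coeff m) :=
  (P.coeff_small m hm).1

lemma term_meromorphic (hf : Meromorphic f) {m : ℕ →₀ ℕ} (hm : m ∈ P.monomials) :
    Meromorphic (P.coeff m * monEval f m) :=
  (P.coeff_meromorphic hm).mul (monEval_meromorphic hf m)

lemma eval_meromorphic (hf : Meromorphic f) : Meromorphic P.eval := by
  rw [eval_eq]
  exact Meromorphic.sum fun m hm ↦ P.term_meromorphic hf hm

lemma comparable_eval (hT : Tendsto (T f) atTop atTop) (hf : Meromorphic f) :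
    Comparable f P.eval := by
  rw [eval_eq]
  refine Comparable.sum hT _ fun m hm ↦ (P.coeff_small m hm).negligible.comparable.mul hT ?_
  rw [monEval_eq]
  exact Comparable.prod hT _ fun i _ ↦ (Comparable.iteratedDeriv hf i).pow hT _

lemma monDegree_eq (hP : P.IsHomogeneous) {m : ℕ →₀ ℕ} (hm : m ∈ P.monomials) :
    monDegree m = P.lowerDegree :=
  le_antisymm (hP ▸ Finset.le_sup' monDegree hm) (Finset.inf'_le _ hm)

lemma monWeight_le {m : ℕ →₀ ℕ} (hm : m ∈ P.monomials) : monWeight m ≤ P.weight :=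
  Finset.le_sup' monWeight hm

lemma order_coeff {m : ℕ →₀ ℕ} (hm : m ∈ P.monomials) (z : ℂ) :
    meromorphicOrderAt (P.coeff m) z = (ord (P.coeff m) z : ℤ) :=
  order_eq_ord (P.coeff_meromorphic hm) (P.coeff_ne_zero m hm) z

lemma neg_coeffDiv_le {m : ℕ →₀ ℕ} (hm : m ∈ P.monomials) (z : ℂ) :
    ((-P.coeffDiv z : ℤ) : WithTop ℤ) ≤ meromorphicOrderAt (P.coeff m) z := by
  rw [P.order_coeff hm]
  have := neg_abs_le (ord (P.coeff m) z)
  have := P.abs_ord_coeff_le hm z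
  exact_mod_cast (by omega)

lemma le_order_eval (hf : Meromorphic f) (hP : P.IsHomogeneous) {z : ℂ} {q : ℤ}
    (h : meromorphicOrderAt f z = q) :
    ((P.lowerDegree * q - (P.weight - P.lowerDegree) - P.coeffDiv z : ℤ) : WithTop ℤ) ≤
      meromorphicOrderAt P.eval z := by
  rw [eval_eq]
  refine le_order_sum _ (fun m hm ↦ P.term_meromorphic hf hm z) fun m hm ↦ ?_
  rw [meromorphicOrderAt_mul (P.coeff_meromorphic hm z) (monEval_meromorphic hf m z)]
  refine le_trans ?_ (add_le_add (P.neg_coeffDiv_le hm z) (le_order_monEval hf m h))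
  have h1 := P.monWeight_le hm
  rw [P.monDegree_eq hP hm, ← WithTop.coe_add, WithTop.coe_le_coe]
  have h2 : (monWeight m : ℤ) ≤ P.weight := by exact_mod_cast h1
  linarith

lemma neg_coeffDiv_le_order_eval (hf : Meromorphic f) {z : ℂ}
    (h : 0 ≤ meromorphicOrderAt f z) :
    ((- P.coeffDiv z : ℤ) : WithTop ℤ) ≤ meromorphicOrderAt P.eval z := by
  rw [eval_eq]
  refine le_order_sum _ (fun m hm ↦ P.term_meromorphic hf hm z) fun m hm ↦ ?_
  rw [meromorphicOrderAt_mul (P.coeff_meromorphic hm z) (monEval_meromorphic hf m z)]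
  refine le_trans ?_ (add_le_add (P.neg_coeffDiv_le hm z) (order_monEval_nonneg hf m h))
  rw [add_zero]

/-- Homogeneity is decisive: dividing by the single power f^d turns every monomial into a product of
quotients f^(i)/f. -/
lemma proxNegligible_eval_div (hf : Meromorphic f) (hfc : NonConstant f)
    (hP : P.IsHomogeneous) : ProxNegligible f (P.eval / f ^ P.lowerDegree) := by
  have hT := tendsto_T hf hfc
  refine ProxNegligible.congr (g := ∑ m ∈ P.monomials,
    P.coeff m * ∏ i ∈ m.support, (iteratedDeriv i f / f) ^ m i) ?_
    ((P.eval_meromorphic hf).div fun z ↦ (hf z).pow _) ?_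
  · exact ProxNegligible.sum hT _ fun m hm ↦ (P.coeff_small m hm).negligible.proxNegligible.mul
      (ProxNegligible.prod _ fun i _ ↦ (ProxNegligible.iteratedDeriv_div hf hfc i).pow _)
  · filter_upwards [eventually_codiscrete_ne_zero hf hfc.not_eventuallyEq_zero] with z hz
    simp only [Finset.sum_apply, Pi.mul_apply, Finset.prod_apply, Pi.pow_apply, Pi.div_apply,
      eval, Finset.sum_div]
    refine Finset.sum_congr rfl fun m hm ↦ ?_
    have h1 : f z ^ P.lowerDegree = ∏ i ∈ m.support, f z ^ m i := by
      rw [Finset.prod_pow_eq_pow_sum, ← P.monDegree_eq hP hm]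
      rfl
    rw [h1, mul_div_assoc, monEval, Finsupp.prod, ← Finset.prod_div_distrib]
    simp [div_pow]

/-- By Jensen's formula the counting function of the divisor of w = P[f]/f^d is the mean of log |w|
up to a constant, hence at most m(r,w) + O(1). -/
lemma ord_eval_sub_asympLE (hf : Meromorphic f) (hfc : NonConstant f)
    (hP : P.IsHomogeneous) (h0 : ¬ P.eval =ᶠ[codiscrete ℂ] 0) :
    AsympLE f (logCounting (ord P.eval - P.lowerDegree • ord f)) 0 := by
  have hT := tendsto_T hf hfc
  have hw := P.proxNegligible_eval_div hf hfc hP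
  have hpm : Meromorphic (f ^ P.lowerDegree) := fun z ↦ (hf z).pow _
  obtain ⟨C, hC⟩ := exists_logCounting_ord_eq hw.meromorphic
  rw [← ord_pow hf, ← ord_div (P.eval_meromorphic hf) h0 hpm
    (not_eventuallyEq_zero_pow hfc.not_eventuallyEq_zero _)]
  refine (AsympLE.of_le_add_const hT (c := C) fun r hr ↦ ?_).trans
    (.zero_of_isLittleO hw.isLittleO)
  rw [hC r hr, proximity_top]
  refine add_le_add (circleAverage_mono (circleIntegrable_log hw.meromorphic r)
    (circleIntegrable_posLog hw.meromorphic r) fun z _ ↦ le_max_right _ _) le_rfl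

end DiffPoly

/-! ### Truncated divisors and the zeros of P[f] -/

lemma divisor_le_iff {D D' : locallyFinsupp ℂ ℤ} : D ≤ D' ↔ ∀ z, D z ≤ D' z := Iff.rfl

lemma add_apply (D D' : locallyFinsupp ℂ ℤ) (z : ℂ) : (D + D') z = D z + D' z := rfl

lemma sub_apply (D D' : locallyFinsupp ℂ ℤ) (z : ℂ) : (D - D') z = D z - D' z := by
  rw [Function.locallyFinsuppWithin.coe_sub, Pi.sub_apply]

lemma neg_apply (D : locallyFinsupp ℂ ℤ) (z : ℂ) : (-D) z = -D z := rfl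

lemma nsmul_apply (n : ℕ) (D : locallyFinsupp ℂ ℤ) (z : ℂ) : (n • D) z = n * D z := by
  rw [Function.locallyFinsuppWithin.coe_nsmul, Pi.smul_apply, nsmul_eq_mul]

lemma posPart_apply (D : locallyFinsupp ℂ ℤ) (z : ℂ) : D⁺ z = max (D z) 0 := by
  rw [Function.locallyFinsuppWithin.posPart_apply, posPart_def]

lemma negPart_apply (D : locallyFinsupp ℂ ℤ) (z : ℂ) : D⁻ z = max (-D z) 0 := by
  rw [Function.locallyFinsuppWithin.negPart_apply, negPart_def]

lemma logCounting_add_apply (D D' : locallyFinsupp ℂ ℤ) (r : ℝ) :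
    logCounting (D + D') r = logCounting D r + logCounting D' r := by rw [map_add, Pi.add_apply]

lemma logCounting_sub_apply (D D' : locallyFinsupp ℂ ℤ) (r : ℝ) :
    logCounting (D - D') r = logCounting D r - logCounting D' r := by rw [map_sub, Pi.sub_apply]

lemma logCounting_nsmul_apply (n : ℕ) (D : locallyFinsupp ℂ ℤ) (r : ℝ) :
    logCounting (n • D) r = n * logCounting D r := by
  rw [map_nsmul, Pi.smul_apply, nsmul_eq_mul]

/-- The zeros of `D`, with multiplicities truncated at `p`. -/
def trunc (p : ℕ) (D : locallyFinsupp ℂ ℤ) : locallyFinsupp ℂ ℤ :=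
  ∑ i ∈ Finset.Icc 1 p, reducedGE D i

lemma trunc_apply (p : ℕ) (D : locallyFinsupp ℂ ℤ) (z : ℂ) :
    trunc p D z = max 0 (min (D z) p) := by
  rw [trunc, Function.locallyFinsuppWithin.coe_sum, Finset.sum_apply]
  simp only [reducedGE_apply]
  induction p with
  | zero => simp
  | succ p ih =>
    rw [Finset.sum_Icc_succ_top (by omega), ih]
    push_cast
    split_ifs <;> omega

lemma trunc_one (D : locallyFinsupp ℂ ℤ) : trunc 1 D = reducedGE D 1 := by
  simp [trunc]

lemma reducedGE_nonneg (D : locallyFinsupp ℂ ℤ) (i : ℕ) : 0 ≤ reducedGE D i := by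
  rw [divisor_le_iff]
  intro z
  rw [reducedGE_apply]
  split_ifs <;> simp

lemma trunc_nonneg (p : ℕ) (D : locallyFinsupp ℂ ℤ) : 0 ≤ trunc p D :=
  Finset.sum_nonneg fun _ _ ↦ reducedGE_nonneg _ _

lemma trunc_mono {p p' : ℕ} (h : p ≤ p') (D : locallyFinsupp ℂ ℤ) : trunc p D ≤ trunc p' D := by
  rw [divisor_le_iff]
  intro z
  rw [trunc_apply, trunc_apply]
  omega

lemma pointDivisor_top (f : ℂ → ℂ) : pointDivisor f ⊤ = (ord f)⁻ := if_pos rfl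

lemma pointDivisor_zero (f : ℂ → ℂ) : pointDivisor f 0 = (ord f)⁺ := by
  rw [pointDivisor, if_neg WithTop.zero_ne_top]
  simp [ord]

lemma reducedGE_negPart (D : locallyFinsupp ℂ ℤ) (i : ℕ) : reducedGE D⁻ i = reducedGE (-D) i := by
  ext z
  rw [reducedGE_apply, reducedGE_apply, negPart_apply, neg_apply]
  split_ifs <;> omega

lemma reducedGE_posPart (D : locallyFinsupp ℂ ℤ) (i : ℕ) : reducedGE D⁺ i = reducedGE D i := by
  ext z
  rw [reducedGE_apply, reducedGE_apply, posPart_apply]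
  split_ifs <;> omega

lemma Nbar_top_eq (f : ℂ → ℂ) : Nbar ⊤ f = logCounting (reducedGE (-ord f) 1) := by
  rw [Nbar, NbarGE, pointDivisor_top, reducedGE_negPart]

lemma Ntrunc_zero_eq (p : ℕ) (f : ℂ → ℂ) : Ntrunc p 0 f = logCounting (trunc p (ord f)) := by
  ext r
  rw [Ntrunc, trunc, map_sum, Finset.sum_apply]
  refine Finset.sum_congr rfl fun i _ ↦ ?_
  rw [NbarGE, pointDivisor_zero, reducedGE_posPart]

lemma Nbar_zero_eq (f : ℂ → ℂ) : Nbar 0 f = logCounting (reducedGE (ord f) 1) := by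
  rw [Nbar, NbarGE, pointDivisor_zero, reducedGE_posPart]

lemma Nbar_zero_eq_Ntrunc (f : ℂ → ℂ) : Nbar 0 f = Ntrunc 1 0 f := by
  rw [Nbar_zero_eq, Ntrunc_zero_eq, trunc_one]

lemma Nbar_top_le_T (f : ℂ → ℂ) {r : ℝ} (hr : 1 ≤ r) : Nbar ⊤ f r ≤ T f r := by
  rw [Nbar_top_eq]
  refine le_trans (logCounting_le ?_ hr) (logCounting_negPart_le_T f r)
  rw [divisor_le_iff]
  intro z
  rw [reducedGE_apply, negPart_apply, neg_apply]
  split_ifs <;> omega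

lemma exists_Ntrunc_zero_le {f : ℂ → ℂ} (hf : Meromorphic f) (p : ℕ) :
    ∃ C, ∀ r, 1 ≤ r → Ntrunc p 0 f r ≤ T f r + C := by
  obtain ⟨C, hC⟩ := exists_T_inv_le hf
  refine ⟨C, fun r hr ↦ ?_⟩
  rw [Ntrunc_zero_eq]
  refine le_trans (logCounting_le ?_ hr) ((logCounting_posPart_le_T_inv f r).trans (hC r).1)
  rw [divisor_le_iff]
  intro z
  rw [trunc_apply, posPart_apply]
  omega

namespace DiffPoly

variable {f : ℂ → ℂ} (P : DiffPoly f)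

lemma one_le_lowerDegree (hP : P.IsHomogeneous) (hk : 1 ≤ P.order) : 1 ≤ P.lowerDegree := by
  by_contra h
  have h0 : P.lowerDegree = 0 := by omega
  have h1 : P.order = 0 := by
    refine Nat.le_zero.1 (Finset.sup'_le _ _ fun m hm ↦ ?_)
    have h2 : monDegree m = 0 := (P.monDegree_eq hP hm).trans h0
    have h3 : ∀ i ∈ m.support, m i = 0 := Finset.sum_eq_zero_iff.1 h2
    have h4 : m.support = ∅ := Finset.eq_empty_of_forall_notMem fun i hi ↦
      Finsupp.mem_support_iff.1 hi (h3 i hi)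
    simp [monOrder, h4]
  omega

/-- The truncated zeros of `P[f]` in terms of the poles and truncated zeros of `f`. -/
lemma trunc_eval_le (hf : Meromorphic f) (hfc : NonConstant f) (hP : P.IsHomogeneous)
    (h0 : ¬ P.eval =ᶠ[codiscrete ℂ] 0) (hd : 1 ≤ P.lowerDegree) {p : ℕ} :
    trunc p (ord P.eval) ≤ (ord P.eval - P.lowerDegree • ord f) +
      ((P.weight - P.lowerDegree) • reducedGE (-ord f) 1 +
        P.lowerDegree • trunc (p + (P.weight - P.lowerDegree)) (ord f)) + P.coeffDiv := by
  rw [divisor_le_iff]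
  intro z
  simp only [add_apply, sub_apply, nsmul_apply, trunc_apply, reducedGE_apply, neg_apply]
  have hq := order_eq_ord hf hfc.not_eventuallyEq_zero z
  have hp := order_eq_ord (P.eval_meromorphic hf) h0 z
  have h1 := P.le_order_eval hf hP hq
  rw [hp, WithTop.coe_le_coe] at h1
  have h2 : 0 ≤ ord f z → - P.coeffDiv z ≤ ord P.eval z := fun h ↦ by
    have := P.neg_coeffDiv_le_order_eval hf (z := z) (by rw [hq]; exact_mod_cast h)
    rw [hp, WithTop.coe_le_coe] at this
    exact this
  have hE := P.coeffDiv_nonneg z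
  obtain ⟨A, hA⟩ := Nat.exists_eq_add_of_le P.lowerDegree_le_weight
  rw [hA] at h1 ⊢
  simp only [Nat.add_sub_cancel_left]
  push_cast at h1 ⊢
  generalize ord f z = q at *
  generalize ord P.eval z = o at *
  generalize P.coeffDiv z = E at *
  generalize P.lowerDegree = d at *
  have hd' : (1 : ℤ) ≤ d := by exact_mod_cast hd
  -- At poles of f the bound `h1` on the order of P[f] is compensated by the A at the pole. At zeros
  -- of order at most p + A the truncation is inactive and d q cancels.
  rcases lt_or_ge q 0 with hq0 | hq0
  · rw [if_pos (by omega), max_eq_left (a := (0 : ℤ)) (b := min q _) (by omega)]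
    have h3 : (d : ℤ) * q ≤ -d := by nlinarith
    rw [max_le_iff]
    constructor
    · linarith
    · refine (min_le_left _ _).trans ?_
      nlinarith
  · rw [if_neg (by omega)]
    rcases le_or_gt q (p + A) with h3 | h3
    · rw [min_eq_left h3, max_eq_right hq0]
      have := h2 hq0
      rw [max_le_iff]
      constructor
      · linarith
      · refine (min_le_left _ _).trans ?_
        linarith
    -- Here `h1` leaves at least d(p + A) - A, which is at least p since d ≥ 1.
    · rw [min_eq_right h3.le, max_eq_right (a := (0 : ℤ)) (b := (p : ℤ) + A) (by positivity)]
      have h4 : 0 ≤ ((d : ℤ) - 1) * A := by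
        have : (0 : ℤ) ≤ d - 1 := by omega
        positivity
      have h5 : 0 ≤ ((d : ℤ) - 1) * p := by
        have : (0 : ℤ) ≤ d - 1 := by omega
        positivity
      refine (max_le (c := (p : ℤ)) (by positivity) (min_le_right _ _)).trans ?_
      nlinarith

lemma trunc_eval_asympLE (hf : Meromorphic f) (hfc : NonConstant f) (hP : P.IsHomogeneous)
    (h0 : ¬ P.eval =ᶠ[codiscrete ℂ] 0) (hd : 1 ≤ P.lowerDegree) (p : ℕ) :
    AsympLE f (logCounting (trunc p (ord P.eval))) (fun r ↦
      ((P.weight : ℝ) - P.lowerDegree) * Nbar ⊤ f r +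
        P.lowerDegree * Ntrunc (p + (P.weight - P.lowerDegree)) 0 f r) := by
  have hT := tendsto_T hf hfc
  have h1 := (P.ord_eval_sub_asympLE hf hfc hP h0).add
    (AsympLE.zero_of_isLittleO (P.isLittleO_coeffDiv hT))
  refine AsympLE.trans (AsympLE.of_le fun r hr ↦
    logCounting_le (P.trunc_eval_le hf hfc hP h0 hd) hr) ?_
  have h2 := AsympLE.add_zero_right (AsympLE.refl (f := f) (u := fun r ↦
      ((P.weight : ℝ) - P.lowerDegree) * Nbar ⊤ f r +
        P.lowerDegree * Ntrunc (p + (P.weight - P.lowerDegree)) 0 f r)) (by rwa [add_zero] at h1)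
  refine AsympLE.le_trans (fun r hr ↦ le_of_eq ?_) h2
  simp only [Pi.add_apply, logCounting_add_apply, logCounting_nsmul_apply, Nbar_top_eq,
    Ntrunc_zero_eq, Nat.cast_sub P.lowerDegree_le_weight]
  ring

end DiffPoly

/-! ### Local behaviour at c-points, and the auxiliary function -/

section SubConst

variable {g : ℂ → ℂ} {c z : ℂ}

lemma ord_sub_const_of_neg (hg : Meromorphic g) (hc : NonConstant g) (h : ord g z < 0) :
    ord (fun w ↦ g w - c) z = ord g z := by
  have hm : Meromorphic fun w ↦ g w - c := hg.fun_sub (Meromorphic.const c)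
  have h1 := order_eq_ord hg hc.not_eventuallyEq_zero z
  refine ord_eq_of_order hm ?_
  have h2 : (fun w ↦ g w - c) = g + fun _ ↦ -c := by
    ext w
    simp [sub_eq_add_neg]
  rw [h2, meromorphicOrderAt_add_eq_left_of_lt (MeromorphicAt.const _ _), h1]
  rw [h1, meromorphicOrderAt_const]
  split_ifs
  · exact WithTop.coe_lt_top _
  · exact_mod_cast h

lemma ord_sub_const_of_pos (hg : Meromorphic g) (hc : NonConstant g) (hc0 : c ≠ 0)
    (h : 0 < ord g z) : ord (fun w ↦ g w - c) z = 0 := by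
  have hm : Meromorphic fun w ↦ g w - c := hg.fun_sub (Meromorphic.const c)
  have h1 := order_eq_ord hg hc.not_eventuallyEq_zero z
  refine ord_eq_of_order hm ?_
  have h2 : (fun w ↦ g w - c) = g + fun _ ↦ -c := by
    ext w
    simp [sub_eq_add_neg]
  rw [h2, meromorphicOrderAt_add_eq_right_of_lt (hg z), meromorphicOrderAt_const]
  · simp [hc0]
  · rw [h1, meromorphicOrderAt_const, if_neg (neg_ne_zero.2 hc0)]
    exact_mod_cast h

lemma ord_sub_const_nonneg (hg : Meromorphic g) (hc : NonConstant g) (h : 0 ≤ ord g z) :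
    0 ≤ ord (fun w ↦ g w - c) z := by
  have hm : Meromorphic fun w ↦ g w - c := hg.fun_sub (Meromorphic.const c)
  have h1 := order_eq_ord hg hc.not_eventuallyEq_zero z
  have h2 : (fun w ↦ g w - c) = g + fun _ ↦ -c := by
    ext w
    simp [sub_eq_add_neg]
  have h3 := meromorphicOrderAt_add (hg z) (MeromorphicAt.const (-c) z)
  rw [ord_apply hm]
  refine WithTop.untop₀_nonneg.2 ?_
  rw [h2]
  refine le_trans (le_min ?_ ?_) h3
  · rw [h1]
    exact_mod_cast h
  · rw [meromorphicOrderAt_const]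
    split_ifs <;> simp

lemma ord_deriv_of_sub_const_ne (hg : Meromorphic g) (h : ord (fun w ↦ g w - c) z ≠ 0) :
    ord (deriv g) z = ord (fun w ↦ g w - c) z - 1 := by
  have hm : Meromorphic fun w ↦ g w - c := hg.fun_sub (Meromorphic.const c)
  rw [← ord_deriv_of_ne hm h]
  congr 2
  ext w
  simp

end SubConst

/-- Near a simple zero `z₀` of `A` the function `(z - z₀)² A' / A²` is analytic, and its derivative
vanishes at `z₀`. -/
lemma exists_analyticAt_of_order_eq_one {A : ℂ → ℂ} {z₀ : ℂ} (hA : MeromorphicAt A z₀)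
    (h : meromorphicOrderAt A z₀ = 1) :
    ∃ k : ℂ → ℂ, AnalyticAt ℂ k z₀ ∧ k z₀ ≠ 0 ∧ deriv k z₀ = 0 ∧
      ∀ᶠ z in 𝓝[≠] z₀, deriv A z / A z ^ 2 = k z / (z - z₀) ^ 2 := by
  obtain ⟨u, hu, hu0, hAu⟩ := (meromorphicOrderAt_eq_int_iff (n := 1) hA).1 (by exact_mod_cast h)
  have hid : AnalyticAt ℂ (fun z : ℂ ↦ z - z₀) z₀ := by fun_prop
  -- The formula results from A = (z - z₀) u. Its derivative vanishes at z₀ because A'/A² is the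
  -- derivative of -1/A and so has no residue.
  refine ⟨fun z ↦ (u z)⁻¹ + (z - z₀) * (deriv u z / u z ^ 2), ?_, ?_, ?_, ?_⟩
  · exact (hu.inv hu0).add (hid.mul (hu.deriv.div (hu.pow 2) (pow_ne_zero _ hu0)))
  · simpa using hu0
  · have h1 : HasDerivAt (fun z ↦ (u z)⁻¹) (-deriv u z₀ / u z₀ ^ 2) z₀ :=
      hu.differentiableAt.hasDerivAt.fun_inv hu0
    have h2 : HasDerivAt (fun z ↦ deriv u z / u z ^ 2) (deriv (fun z ↦ deriv u z / u z ^ 2) z₀) z₀ :=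
      (hu.deriv.div (hu.pow 2) (pow_ne_zero _ hu0)).differentiableAt.hasDerivAt
    have h3 : HasDerivAt (fun z : ℂ ↦ z - z₀) 1 z₀ := (hasDerivAt_id z₀).sub_const z₀
    have h4 := h1.fun_add (h3.fun_mul h2)
    rw [h4.deriv]
    simp only [sub_self]
    ring
  · have hAu' : A =ᶠ[𝓝[≠] z₀] fun z ↦ (z - z₀) * u z := by
      filter_upwards [hAu] with z hz
      rw [hz, zpow_one, smul_eq_mul]
    filter_upwards [hAu', hAu'.nhdsNE_deriv, hu.eventually_analyticAt.filter_mono nhdsWithin_le_nhds,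
      (hu.continuousAt.eventually_ne hu0).filter_mono nhdsWithin_le_nhds,
      self_mem_nhdsWithin] with z h1 h2 h3 h4 h5
    have h6 : z - z₀ ≠ 0 := sub_ne_zero.2 h5
    have h7 : HasDerivAt (fun z ↦ (z - z₀) * u z) (1 * u z + (z - z₀) * deriv u z) z :=
      ((hasDerivAt_id z).sub_const z₀).fun_mul h3.differentiableAt.hasDerivAt
    rw [h1, h2, h7.deriv]
    field_simp

/-- The auxiliary function of the uniqueness argument, whose logarithmic derivative is
`(F''/F' - 2F'/(F-1)) - (G''/G' - 2G'/(G-1))`. -/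
def auxFun (F G : ℂ → ℂ) : ℂ → ℂ :=
  (deriv F / (fun z ↦ F z - 1) ^ 2) / (deriv G / (fun z ↦ G z - 1) ^ 2)

section AuxFun

variable {F G : ℂ → ℂ}

lemma sub_const_meromorphic (hF : Meromorphic F) (c : ℂ) : Meromorphic fun z ↦ F z - c :=
  hF.fun_sub (Meromorphic.const c)

lemma pow_meromorphic (hF : Meromorphic F) (n : ℕ) : Meromorphic (F ^ n) := fun z ↦ (hF z).pow n

lemma auxFun_meromorphic (hF : Meromorphic F) (hG : Meromorphic G) : Meromorphic (auxFun F G) :=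
  (hF.deriv.div (pow_meromorphic (sub_const_meromorphic hF 1) 2)).div
    (hG.deriv.div (pow_meromorphic (sub_const_meromorphic hG 1) 2))

lemma auxFactor_ne_zero (hF : Meromorphic F) (hFc : NonConstant F) :
    ¬ deriv F / (fun z ↦ F z - 1) ^ 2 =ᶠ[codiscrete ℂ] 0 :=
  not_eventuallyEq_zero_div hF.deriv (pow_meromorphic (sub_const_meromorphic hF 1) 2)
    (not_eventuallyEq_zero_deriv hF hFc) (not_eventuallyEq_zero_pow (hFc.sub_const 1) 2)

lemma ord_auxFactor (hF : Meromorphic F) (hFc : NonConstant F) :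
    ord (deriv F / (fun z ↦ F z - 1) ^ 2) = ord (deriv F) - 2 • ord fun z ↦ F z - 1 := by
  rw [ord_div hF.deriv (not_eventuallyEq_zero_deriv hF hFc)
    (pow_meromorphic (sub_const_meromorphic hF 1) 2) (not_eventuallyEq_zero_pow (hFc.sub_const 1) 2),
    ord_pow (sub_const_meromorphic hF 1)]

lemma auxFun_ne_zero (hF : Meromorphic F) (hFc : NonConstant F) (hG : Meromorphic G)
    (hGc : NonConstant G) : ¬ auxFun F G =ᶠ[codiscrete ℂ] 0 :=
  not_eventuallyEq_zero_div (hF.deriv.div (pow_meromorphic (sub_const_meromorphic hF 1) 2))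
    (hG.deriv.div (pow_meromorphic (sub_const_meromorphic hG 1) 2))
    (auxFactor_ne_zero hF hFc) (auxFactor_ne_zero hG hGc)

lemma ord_auxFun (hF : Meromorphic F) (hFc : NonConstant F) (hG : Meromorphic G)
    (hGc : NonConstant G) : ord (auxFun F G) =
      (ord (deriv F) - 2 • ord fun z ↦ F z - 1) - (ord (deriv G) - 2 • ord fun z ↦ G z - 1) := by
  rw [auxFun, ord_div (hF.deriv.div (pow_meromorphic (sub_const_meromorphic hF 1) 2))
    (auxFactor_ne_zero hF hFc) (hG.deriv.div (pow_meromorphic (sub_const_meromorphic hG 1) 2))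
    (auxFactor_ne_zero hG hGc), ord_auxFactor hF hFc, ord_auxFactor hG hGc]

lemma Comparable.auxFun {f : ℂ → ℂ} (hT : Tendsto (T f) atTop atTop) (hF : Comparable f F)
    (hG : Comparable f G) : Comparable f (auxFun F G) :=
  (hF.deriv.div hT ((hF.sub_const hT 1).pow hT 2)).div hT
    (hG.deriv.div hT ((hG.sub_const hT 1).pow hT 2))

/-- Common simple `1`-points are zeros of the logarithmic derivative of the auxiliary function. -/
lemma ord_logDeriv_auxFun_pos (hF : Meromorphic F) (hG : Meromorphic G)
    (hc : ¬ logDeriv (auxFun F G) =ᶠ[codiscrete ℂ] 0) {z₀ : ℂ}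
    (h1 : meromorphicOrderAt (fun z ↦ F z - 1) z₀ = 1)
    (h2 : meromorphicOrderAt (fun z ↦ G z - 1) z₀ = 1) : 0 < ord (logDeriv (auxFun F G)) z₀ := by
  obtain ⟨k, hk, hk0, hk', hkF⟩ :=
    exists_analyticAt_of_order_eq_one (sub_const_meromorphic hF 1 z₀) h1
  obtain ⟨j, hj, hj0, hj', hjG⟩ :=
    exists_analyticAt_of_order_eq_one (sub_const_meromorphic hG 1 z₀) h2
  -- The double poles cancel, and k/j is nonzero with vanishing derivative at z₀.
  have heq : auxFun F G =ᶠ[𝓝[≠] z₀] fun z ↦ k z / j z := by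
    filter_upwards [hkF, hjG, self_mem_nhdsWithin] with z h3 h4 h5
    have h6 : (z - z₀) ^ 2 ≠ 0 := pow_ne_zero _ (sub_ne_zero.2 h5)
    have h7 : deriv (fun z ↦ F z - 1) z = deriv F z := by simp
    have h8 : deriv (fun z ↦ G z - 1) z = deriv G z := by simp
    rw [h7] at h3
    rw [h8] at h4
    simp only [auxFun, Pi.div_apply, Pi.pow_apply]
    rw [h3, h4, div_div_div_cancel_right₀ h6]
  have han : AnalyticAt ℂ (fun z ↦ k z / j z) z₀ := hk.div hj hj0
  have hne : k z₀ / j z₀ ≠ 0 := div_ne_zero hk0 hj0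
  have hlog : AnalyticAt ℂ (logDeriv fun z ↦ k z / j z) z₀ := han.deriv.div han hne
  have hzero : logDeriv (fun z ↦ k z / j z) z₀ = 0 := by
    rw [logDeriv_apply, deriv_fun_div hk.differentiableAt hj.differentiableAt hj0, hk', hj']
    simp
  have hm : Meromorphic (logDeriv (auxFun F G)) := (auxFun_meromorphic hF hG).logDeriv
  have hord : 0 < meromorphicOrderAt (logDeriv (auxFun F G)) z₀ := by
    rw [← tendsto_zero_iff_meromorphicOrderAt_pos (hm z₀)]
    have h3 : Tendsto (logDeriv fun z ↦ k z / j z) (𝓝[≠] z₀) (𝓝 0) := by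
      have := hlog.continuousAt.tendsto.mono_left (nhdsWithin_le_nhds (s := {z₀}ᶜ))
      rwa [hzero] at this
    exact h3.congr' (logDeriv_congr_nhdsNE heq).symm
  rw [order_eq_ord hm hc] at hord
  exact_mod_cast hord

end AuxFun

lemma AsympLE.sub_right {f : ℂ → ℂ} {u v w : ℝ → ℝ} (h : AsympLE f u v) :
    AsympLE f (u - w) (v - w) := by
  simpa [sub_eq_add_neg] using h.add (AsympLE.refl (u := -w))

lemma smtDivisor_apply (F : ℂ → ℂ) (z : ℂ) : smtDivisor F z =
    max (-ord F z) 0 + ord F z + ord (fun z ↦ F z - 1) z - ord (deriv F) z := by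
  rw [smtDivisor, sub_apply, add_apply, add_apply, negPart_apply]

/-! ### Pointwise analysis of the main divisor -/

section Local

variable {g : ℂ → ℂ} {z : ℂ}

lemma local_of_neg (hg : Meromorphic g) (hc : NonConstant g) (h : ord g z < 0) :
    ord (fun z ↦ g z - 1) z = ord g z ∧ ord (deriv g) z = ord g z - 1 :=
  ⟨ord_sub_const_of_neg hg hc h, ord_deriv_of_ne hg h.ne⟩

lemma local_of_pos (hg : Meromorphic g) (hc : NonConstant g) (h : 0 < ord g z) :
    ord (fun z ↦ g z - 1) z = 0 ∧ ord (deriv g) z = ord g z - 1 :=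
  ⟨ord_sub_const_of_pos hg hc one_ne_zero h, ord_deriv_of_ne hg h.ne'⟩

lemma local_of_eq_zero (hg : Meromorphic g) (hc : NonConstant g) (h : ord g z = 0) :
    0 ≤ ord (fun z ↦ g z - 1) z ∧ 0 ≤ ord (deriv g) z ∧
      (0 < ord (fun z ↦ g z - 1) z → ord (deriv g) z = ord (fun z ↦ g z - 1) z - 1) :=
  ⟨ord_sub_const_nonneg hg hc h.ge, ord_deriv_nonneg hg h.ge,
    fun h1 ↦ ord_deriv_of_sub_const_ne hg h1.ne'⟩

lemma smtDivisor_le (hg : Meromorphic g) (hc : NonConstant g) (z : ℂ) : smtDivisor g z ≤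
    (reducedGE (ord g) 1 + reducedGE (-ord g) 1 + reducedGE (ord fun z ↦ g z - 1) 1) z := by
  rw [smtDivisor_apply, add_apply, add_apply, reducedGE_apply, reducedGE_apply, reducedGE_apply,
    neg_apply]
  rcases lt_trichotomy (ord g z) 0 with h | h | h
  · have := local_of_neg hg hc h
    split_ifs <;> omega
  · have := local_of_eq_zero hg hc h
    split_ifs <;> omega
  · have := local_of_pos hg hc h
    split_ifs <;> omega

end Local

/-- The divisor that bounds `T(r, F)` in the uniqueness argument when the auxiliary function is not
constant. -/
def mainDivisor (F G : ℂ → ℂ) : locallyFinsupp ℂ ℤ :=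
  smtDivisor F + smtDivisor G +
    (reducedGE (ord (auxFun F G)) 1 + reducedGE (-ord (auxFun F G)) 1) -
    ((ord (logDeriv (auxFun F G)))⁺ + (ord fun z ↦ G z - 1)⁺)

section MainDivisor

variable {f F G : ℂ → ℂ}

/-- The sum of the two second main theorems has T(r,F) + T(r,G) on the left. The term T(r,G) is
traded for the 1-points of G by the first main theorem, and the zeros of H are moved to the right
with a minus sign. -/
theorem AsympLE.mainDivisor (hT : Tendsto (T f) atTop atTop) (hF : Comparable f F)
    (hFc : NonConstant F) (hG : Comparable f G) (hGc : NonConstant G)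
    (hH : ¬ logDeriv (auxFun F G) =ᶠ[codiscrete ℂ] 0) :
    AsympLE f (T F) (logCounting (mainDivisor F G)) := by
  have hφ : NonConstant (auxFun F G) := by
    by_contra h
    exact hH (logDeriv_eventuallyEq_zero h)
  have h1 := ((AsympLE.smt hT hF hFc).add (AsympLE.smt hT hG hGc)).add
    (AsympLE.zeros_logDeriv hT (hF.auxFun hT hG) hφ)
  have hG1 := sub_const_meromorphic hG.meromorphic 1
  obtain ⟨C, hC⟩ := exists_T_inv_le hG1
  have h2 := h1.sub_right
    (w := T G + logCounting (ord (logDeriv (auxFun F G)))⁺)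
  refine AsympLE.trans ?_ (h2.trans (AsympLE.of_le_add_const hT
    (c := C + (log⁺ ‖(1 : ℂ)‖ + Real.log 2)) fun r hr ↦ ?_))
  · refine AsympLE.of_le fun r hr ↦ le_of_eq ?_
    simp only [Pi.add_apply, Pi.sub_apply]
    ring
  · have h3 := logCounting_posPart_le_T_inv (fun z ↦ G z - 1) r
    have h4 := (hC r).1
    have h5 := (abs_le.1 (abs_characteristic_sub_characteristic_shift_le (a₀ := 1) (r := r)
      hG.meromorphic)).1
    simp only [Nevanlinna.mainDivisor, logCounting_sub_apply, logCounting_add_apply, Pi.add_apply,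
      Pi.sub_apply]
    simp only [T] at *
    linarith

/-- Here s is the order of φ, and H has its simple pole exactly where s ≠ 0. -/
lemma mainDivisor_apply (hF : Meromorphic F) (hFc : NonConstant F) (hG : Meromorphic G)
    (hGc : NonConstant G) (z : ℂ) : ∃ s, s = (ord (deriv F) z - 2 * ord (fun z ↦ F z - 1) z) -
      (ord (deriv G) z - 2 * ord (fun z ↦ G z - 1) z) ∧
    mainDivisor F G z = smtDivisor F z + smtDivisor G z + (if s = 0 then 0 else 1) -
      (max (ord (logDeriv (auxFun F G)) z) 0 + max (ord (fun z ↦ G z - 1) z) 0) := by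
  refine ⟨_, rfl, ?_⟩
  simp only [mainDivisor, sub_apply, add_apply, posPart_apply, reducedGE_apply, neg_apply,
    ord_auxFun hF hFc hG hGc, nsmul_apply]
  push_cast
  congr 2
  split_ifs <;> omega

lemma mainDivisor_le_three (hF : Meromorphic F) (hFc : NonConstant F) (hG : Meromorphic G)
    (hGc : NonConstant G) (z : ℂ) : mainDivisor F G z ≤ 3 := by
  obtain ⟨s, -, hs⟩ := mainDivisor_apply hF hFc hG hGc z
  have h1 : ∀ {g : ℂ → ℂ}, Meromorphic g → NonConstant g → smtDivisor g z ≤ 1 := by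
    intro g hg hc
    refine (smtDivisor_le hg hc z).trans ?_
    rw [add_apply, add_apply, reducedGE_apply, reducedGE_apply, reducedGE_apply, neg_apply]
    rcases lt_trichotomy (ord g z) 0 with h | h | h
    · have := local_of_neg hg hc h
      split_ifs <;> omega
    · have := local_of_eq_zero hg hc h
      split_ifs <;> omega
    · have := local_of_pos hg hc h
      split_ifs <;> omega
  have hF1 := h1 hF hFc
  have hG1 := h1 hG hGc
  rw [hs]
  split_ifs <;> omega

/-- The main divisor away from poles and `1`-points. -/
lemma mainDivisor_le_of_ne_one (hF : Meromorphic F) (hFc : NonConstant F) (hG : Meromorphic G)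
    (hGc : NonConstant G) {z : ℂ} (hF0 : 0 ≤ ord F z) (hG0 : 0 ≤ ord G z)
    (hF1 : ¬ 0 < ord (fun z ↦ F z - 1) z) (hG1 : ¬ 0 < ord (fun z ↦ G z - 1) z) :
    mainDivisor F G z ≤ trunc 2 (ord F) z + trunc 2 (ord G) z := by
  -- A zero of F or G contributes 1 after ramification. The possible extra unit for s ≠ 0 is paid by
  -- a multiple zero, where the truncation allows 2, or by a zero of a derivative off the zeros of
  -- its function, which enters negatively.
  obtain ⟨s, hs', hs⟩ := mainDivisor_apply hF hFc hG hGc z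
  rw [hs, smtDivisor_apply, smtDivisor_apply, trunc_apply, trunc_apply]
  push_cast
  rcases hF0.eq_or_lt with h | h <;> rcases hG0.eq_or_lt with h' | h'
  · have h1 := local_of_eq_zero hF hFc h.symm
    have h2 := local_of_eq_zero hG hGc h'.symm
    split_ifs <;> omega
  · have h1 := local_of_eq_zero hF hFc h.symm
    have h2 := local_of_pos hG hGc h'
    split_ifs <;> omega
  · have h1 := local_of_pos hF hFc h
    have h2 := local_of_eq_zero hG hGc h'.symm
    split_ifs <;> omega
  · have h1 := local_of_pos hF hFc h
    have h2 := local_of_pos hG hGc h'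
    split_ifs <;> omega

/-- The main divisor at common `1`-points. -/
lemma mainDivisor_le_of_one (hF : Meromorphic F) (hFc : NonConstant F) (hG : Meromorphic G)
    (hGc : NonConstant G) (hH : ¬ logDeriv (auxFun F G) =ᶠ[codiscrete ℂ] 0) {z : ℂ}
    (hF1 : 0 < ord (fun z ↦ F z - 1) z) (hG1 : 0 < ord (fun z ↦ G z - 1) z) :
    mainDivisor F G z ≤ if ord (fun z ↦ F z - 1) z = ord (fun z ↦ G z - 1) z then
        (if ord (fun z ↦ F z - 1) z = 1 then 0 else 2 - ord (fun z ↦ F z - 1) z)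
      else 3 - ord (fun z ↦ G z - 1) z := by
  obtain ⟨s, hs', hs⟩ := mainDivisor_apply hF hFc hG hGc z
  have h0 : ∀ {g : ℂ → ℂ}, Meromorphic g → NonConstant g → 0 < ord (fun z ↦ g z - 1) z →
      ord g z = 0 := by
    intro g hg hc h
    rcases lt_trichotomy (ord g z) 0 with h' | h' | h'
    · have := local_of_neg hg hc h'
      omega
    · exact h'
    · have := local_of_pos hg hc h'
      omega
  have hF0 := h0 hF hFc hF1
  have hG0 := h0 hG hGc hG1
  have h1 := local_of_eq_zero hF hFc hF0
  have h2 := local_of_eq_zero hG hGc hG0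
  have h3 : ord (fun z ↦ F z - 1) z = 1 → ord (fun z ↦ G z - 1) z = 1 →
      0 < ord (logDeriv (auxFun F G)) z := fun h4 h5 ↦ by
    refine ord_logDeriv_auxFun_pos hF hG hH ?_ ?_
    · rw [order_eq_ord (sub_const_meromorphic hF 1) (hFc.sub_const 1), h4]
      rfl
    · rw [order_eq_ord (sub_const_meromorphic hG 1) (hGc.sub_const 1), h5]
      rfl
  -- With multiplicities p and q, each second-main-theorem term is 1, the order of φ is q - p, and
  -- the 1-points of G subtract q. If p = q = 1, the zero of H subtracts one more.
  rw [hs, smtDivisor_apply, smtDivisor_apply]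
  split_ifs <;> omega

lemma ord_logDeriv_of_one (hF : Meromorphic F) (hFc : NonConstant F) {z : ℂ}
    (hF1 : 0 < ord (fun z ↦ F z - 1) z) :
    ord (logDeriv F) z = ord (fun z ↦ F z - 1) z - 1 := by
  have h : ord (logDeriv F) = ord (deriv F) - ord F :=
    ord_div hF.deriv (not_eventuallyEq_zero_deriv hF hFc) hF hFc.not_eventuallyEq_zero
  rw [h, sub_apply]
  rcases lt_trichotomy (ord F z) 0 with h' | h' | h'
  · have := local_of_neg hF hFc h'
    omega
  · have := local_of_eq_zero hF hFc h'
    omega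
  · have := local_of_pos hF hFc h'
    omega

end MainDivisor

/-! ### Consequences of sharing, modulo exceptional points -/

/-- The standing assumptions: `f ^ n - a` and `P[f] - a` share `(0, l)`. -/
structure Sharing (f : ℂ → ℂ) (n : ℕ) (P : DiffPoly f) (a : ℂ → ℂ) (l : ℕ∞) : Prop where
  mero : Meromorphic f
  nonConstant : NonConstant f
  one_le : 1 ≤ n
  homogeneous : P.IsHomogeneous
  one_le_order : 1 ≤ P.order
  negligible : Negligible f a
  ne_zero : ¬ a =ᶠ[codiscrete ℂ] 0
  share : ShareZero l (f ^ n - a) (P.eval - a)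

/-- Sharing with weight l is used only through the thresholds j ≤ l + 1, namely j = 1, 2, 3. -/
lemma le_iff_le_of_min_eq {x y : ℕ} {l : ℕ∞} (h : min (x : ℕ∞) (l + 1) = min (y : ℕ∞) (l + 1))
    {j : ℕ} (hj : (j : ℕ∞) ≤ l + 1) : j ≤ x ↔ j ≤ y := by
  have h1 : ∀ w : ℕ, j ≤ w ↔ (j : ℕ∞) ≤ min (w : ℕ∞) (l + 1) := fun w ↦ by
    rw [le_min_iff, Nat.cast_le]
    exact ⟨fun h ↦ ⟨h, hj⟩, fun h ↦ h.1⟩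
  rw [h1, h1, h]

lemma zeroMult_eq {g : ℂ → ℂ} {z : ℂ} {m : ℤ} (h : meromorphicOrderAt g z = m) :
    zeroMult g z = (m.toNat : ℕ∞) := by
  rw [zeroMult, h]
  rfl

namespace Sharing

variable {f : ℂ → ℂ} {n : ℕ} {P : DiffPoly f} {a : ℂ → ℂ} {l : ℕ∞} (S : Sharing f n P a l)

/-- The zeros and poles of `a` and of the coefficients of `P[f]`. -/
def excDiv (P : DiffPoly f) (a : ℂ → ℂ) : locallyFinsupp ℂ ℤ := P.coeffDiv + absDiv (ord a)

lemma excDiv_apply (z : ℂ) : excDiv P a z = P.coeffDiv z + |ord a z| := by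
  rw [excDiv, add_apply, absDiv_apply]

lemma excDiv_nonneg (z : ℂ) : 0 ≤ excDiv P a z := by
  rw [excDiv_apply]
  exact add_nonneg (P.coeffDiv_nonneg z) (abs_nonneg _)

lemma eq_zero_of_excDiv {z : ℂ} (h : excDiv P a z = 0) : P.coeffDiv z = 0 ∧ ord a z = 0 := by
  rw [excDiv_apply] at h
  have h1 := P.coeffDiv_nonneg z
  have h2 := abs_nonneg (ord a z)
  exact ⟨by omega, abs_eq_zero.1 (by omega)⟩

lemma eval_ne_zero (hG : NonConstant (P.eval / a)) : ¬ P.eval =ᶠ[codiscrete ℂ] 0 := by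
  intro h
  refine hG 0 ?_
  filter_upwards [h] with z hz
  simp [hz]

include S

lemma one_le_lowerDegree : 1 ≤ P.lowerDegree := P.one_le_lowerDegree S.homogeneous S.one_le_order

lemma tendsto_T : Tendsto (T f) atTop atTop := Nevanlinna.tendsto_T S.mero S.nonConstant

lemma excDiv_asympLE : AsympLE f (logCounting (excDiv P a)) 0 := by
  rw [excDiv, map_add]
  exact .zero_of_isLittleO
    ((P.isLittleO_coeffDiv S.tendsto_T).add (S.negligible.absDiv S.tendsto_T))

/-- Inequalities between divisors up to the exceptional divisor. -/
lemma asympLE_of_le {D D' : locallyFinsupp ℂ ℤ} (c : ℕ)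
    (h : ∀ z, D z ≤ D' z + c * excDiv P a z) : AsympLE f (logCounting D) (logCounting D') := by
  have h1 := S.excDiv_asympLE.const_mul (c := c) (by positivity)
  refine AsympLE.trans (v := logCounting D' + fun r ↦ c * logCounting (excDiv P a) r)
    (AsympLE.of_le fun r hr ↦ ?_) (AsympLE.refl.add_zero_right ?_)
  · have h2 : D ≤ D' + c • excDiv P a := divisor_le_iff.2 fun z ↦ by
      rw [add_apply, nsmul_apply]
      exact h z
    have := logCounting_le h2 hr
    rwa [logCounting_add_apply, logCounting_nsmul_apply] at this
  · refine h1.trans_le fun r _ ↦ ?_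
    simp

lemma comparable_left : Comparable f (f ^ n / a) :=
  ((Comparable.self S.mero).pow S.tendsto_T n).div S.tendsto_T S.negligible.comparable

lemma comparable_right : Comparable f (P.eval / a) :=
  (P.comparable_eval S.tendsto_T S.mero).div S.tendsto_T S.negligible.comparable

lemma T_asympLE : AsympLE f (fun r ↦ n * T f r) (T (f ^ n / a)) := by
  have ha := S.negligible
  have hF := S.comparable_left.meromorphic
  have hF0 : ¬ f ^ n / a =ᶠ[codiscrete ℂ] 0 := not_eventuallyEq_zero_div (pow_meromorphic S.mero n)
    ha.meromorphic (not_eventuallyEq_zero_pow S.nonConstant.not_eventuallyEq_zero n) S.ne_zero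
  refine AsympLE.le_trans (v := T (f ^ n / a) + T a) (fun r hr ↦ ?_)
    (AsympLE.refl.add_zero_right (.zero_of_isLittleO ha.isLittleO))
  have h1 : n * T f r = T (f ^ n) r := by
    simp only [T, characteristic_pow_top S.mero, Pi.smul_apply, nsmul_eq_mul]
  have h2 : f ^ n =ᶠ[codiscrete ℂ] f ^ n / a * a := by
    filter_upwards [eventually_codiscrete_ne_zero ha.meromorphic S.ne_zero] with z hz
    simp [hz]
  rw [h1]
  simp only [T]
  rw [characteristic_congr_codiscrete h2 (by linarith)]
  exact characteristic_mul_top_le hr hF (order_ne_top hF hF0) ha.meromorphic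
    (order_ne_top ha.meromorphic S.ne_zero)

lemma nonConstant_left : NonConstant (f ^ n / a) := by
  intro c hc
  have h1 := S.T_asympLE
  refine AsympLE.not_of_tendsto S.tendsto_T (c := n) (c' := 1 / 2) ?_ ?_ h1
  · have : (1 : ℝ) ≤ n := by exact_mod_cast S.one_le
    linarith
  · filter_upwards [S.tendsto_T.eventually_ge_atTop (2 * log⁺ ‖c‖), eventually_ge_atTop 1]
      with r hr hr1
    have h2 : T (f ^ n / a) r = log⁺ ‖c‖ := by
      simp only [T]
      rw [characteristic_congr_codiscrete hc (by linarith)]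
      exact congrFun (T_const c) r
    linarith

lemma ord_left (z : ℂ) : ord (f ^ n / a) z = n * ord f z - ord a z := by
  rw [ord_div (pow_meromorphic S.mero n)
    (not_eventuallyEq_zero_pow S.nonConstant.not_eventuallyEq_zero n) S.negligible.meromorphic
    S.ne_zero, ord_pow S.mero, sub_apply, nsmul_apply]

lemma ord_right (h0 : ¬ P.eval =ᶠ[codiscrete ℂ] 0) (z : ℂ) :
    ord (P.eval / a) z = ord P.eval z - ord a z := by
  rw [ord_div (P.eval_meromorphic S.mero) h0 S.negligible.meromorphic S.ne_zero, sub_apply]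

lemma neg_of_left_neg {z : ℂ} (hz : excDiv P a z = 0) (h : ord (f ^ n / a) z < 0) :
    ord f z < 0 := by
  rw [S.ord_left, (eq_zero_of_excDiv hz).2, sub_zero] at h
  by_contra h1
  have : 0 ≤ n * ord f z := mul_nonneg (by positivity) (by omega)
  omega

lemma pos_of_left_pos {z : ℂ} (hz : excDiv P a z = 0) (h : 0 < ord (f ^ n / a) z) :
    0 < ord f z := by
  rw [S.ord_left, (eq_zero_of_excDiv hz).2, sub_zero] at h
  exact pos_of_mul_pos_right h (by positivity)

lemma neg_of_right_neg (hG : NonConstant (P.eval / a)) {z : ℂ} (hz : excDiv P a z = 0)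
    (h : ord (P.eval / a) z < 0) : ord f z < 0 := by
  have h0 := eval_ne_zero hG
  obtain ⟨h1, h2⟩ := eq_zero_of_excDiv hz
  rw [S.ord_right h0, h2, sub_zero] at h
  by_contra h3
  have h4 := P.neg_coeffDiv_le_order_eval S.mero (z := z) (by
    rw [order_eq_ord S.mero S.nonConstant.not_eventuallyEq_zero]
    exact_mod_cast not_lt.1 h3)
  rw [order_eq_ord (P.eval_meromorphic S.mero) h0, WithTop.coe_le_coe] at h4
  omega

/-- Since g - a = (g/a - 1) a and a has order 0 at z, zeros of the shared functions become 1-points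
with the same multiplicity. -/
lemma order_sub_mul {g : ℂ → ℂ} (hg : Meromorphic g) {z : ℂ} (hz : excDiv P a z = 0) :
    meromorphicOrderAt (g - a) z = meromorphicOrderAt (fun w ↦ (g / a) w - 1) z := by
  have ham := S.negligible.meromorphic
  have h1 : g - a =ᶠ[𝓝[≠] z] (fun w ↦ (g / a) w - 1) * a := by
    filter_upwards [eventually_codiscrete_iff.1 (eventually_codiscrete_ne_zero ham S.ne_zero) z]
      with w hw
    simp only [Pi.sub_apply, Pi.div_apply, Pi.mul_apply]
    field_simp
  rw [meromorphicOrderAt_congr h1, meromorphicOrderAt_mul (sub_const_meromorphic (hg.div ham) 1 z)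
    (ham z), order_eq_ord ham S.ne_zero z, (eq_zero_of_excDiv hz).2]
  simp

lemma zeroMult_left {z : ℂ} (hz : excDiv P a z = 0) : zeroMult (f ^ n - a) z =
    ((ord (fun w ↦ (f ^ n / a) w - 1) z).toNat : ℕ∞) := by
  refine zeroMult_eq ?_
  rw [S.order_sub_mul (pow_meromorphic S.mero n) hz, order_eq_ord
    (sub_const_meromorphic S.comparable_left.meromorphic 1) (S.nonConstant_left.sub_const 1)]

lemma zeroMult_right (hG : NonConstant (P.eval / a)) {z : ℂ} (hz : excDiv P a z = 0) :
    zeroMult (P.eval - a) z = ((ord (fun w ↦ (P.eval / a) w - 1) z).toNat : ℕ∞) := by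
  refine zeroMult_eq ?_
  rw [S.order_sub_mul (P.eval_meromorphic S.mero) hz, order_eq_ord
    (sub_const_meromorphic S.comparable_right.meromorphic 1) (hG.sub_const 1)]

lemma le_iff_le (hG : NonConstant (P.eval / a)) {z : ℂ} (hz : excDiv P a z = 0) {j : ℕ}
    (hj1 : 1 ≤ j) (hj : (j : ℕ∞) ≤ l + 1) :
    (j : ℤ) ≤ ord (fun w ↦ (f ^ n / a) w - 1) z ↔ (j : ℤ) ≤ ord (fun w ↦ (P.eval / a) w - 1) z := by
  have h := S.share z
  rw [S.zeroMult_left hz, S.zeroMult_right hG hz] at h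
  have := le_iff_le_of_min_eq h hj
  omega

lemma pos_iff_pos (hG : NonConstant (P.eval / a)) {z : ℂ} (hz : excDiv P a z = 0) :
    0 < ord (fun w ↦ (f ^ n / a) w - 1) z ↔ 0 < ord (fun w ↦ (P.eval / a) w - 1) z := by
  have := S.le_iff_le hG hz le_rfl (by simp)
  push_cast at this
  omega

/-- A pointwise bound for the main divisor away from the `1`-points. -/
lemma mainDivisor_le {Y : ℤ} (hG : NonConstant (P.eval / a)) {z : ℂ} (hY0 : 0 ≤ Y)
    (hY : excDiv P a z = 0 → 0 < ord (fun w ↦ (f ^ n / a) w - 1) z →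
      0 < ord (fun w ↦ (P.eval / a) w - 1) z → mainDivisor (f ^ n / a) (P.eval / a) z ≤ Y) :
    mainDivisor (f ^ n / a) (P.eval / a) z ≤ 3 * reducedGE (-ord f) 1 z +
      trunc 2 (ord (f ^ n / a)) z + trunc 2 (ord (P.eval / a)) z + Y + 3 * excDiv P a z := by
  have hF := S.comparable_left.meromorphic
  have hFc := S.nonConstant_left
  have hGm := S.comparable_right.meromorphic
  -- The crude bound suffices at poles of f and at exceptional points, where the right side carries
  -- a coefficient 3.
  have h3 := mainDivisor_le_three hF hFc hGm hG z
  have hE := excDiv_nonneg (P := P) (a := a) z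
  have hp := divisor_le_iff.1 (reducedGE_nonneg (-ord f) 1) z
  have ht1 := divisor_le_iff.1 (trunc_nonneg 2 (ord (f ^ n / a))) z
  have ht2 := divisor_le_iff.1 (trunc_nonneg 2 (ord (P.eval / a))) z
  have hz0 : (0 : locallyFinsupp ℂ ℤ) z = 0 := rfl
  rw [hz0] at hp ht1 ht2
  rcases hE.eq_or_lt with hz | hz
  · by_cases hf : ord f z < 0
    · have : reducedGE (-ord f) 1 z = 1 := by
        rw [reducedGE_apply, neg_apply, if_pos (by omega)]
      omega
    · have hF0 : 0 ≤ ord (f ^ n / a) z := not_lt.1 fun h ↦ hf (S.neg_of_left_neg hz.symm h)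
      have hG0 : 0 ≤ ord (P.eval / a) z := not_lt.1 fun h ↦ hf (S.neg_of_right_neg hG hz.symm h)
      by_cases h1 : 0 < ord (fun w ↦ (f ^ n / a) w - 1) z
      · have := hY hz.symm h1 ((S.pos_iff_pos hG hz.symm).1 h1)
        omega
      · have := mainDivisor_le_of_ne_one hF hFc hGm hG hF0 hG0 h1
          fun h ↦ h1 ((S.pos_iff_pos hG hz.symm).2 h)
        omega
  · omega

/-- The common part of the bounds. -/
lemma trunc_left_asympLE : AsympLE f (logCounting (trunc 2 (ord (f ^ n / a))))
    (fun r ↦ mu n 2 * Ntrunc (muStar n 2) 0 f r) := by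
  have h : AsympLE f (logCounting (trunc 2 (ord (f ^ n / a))))
      (logCounting (mu n 2 • trunc (muStar n 2) (ord f))) := by
    refine S.asympLE_of_le 2 fun z ↦ ?_
    rw [nsmul_apply, trunc_apply, trunc_apply, S.ord_left]
    have hE := excDiv_nonneg (P := P) (a := a) z
    rcases hE.eq_or_lt with hz | hz
    · rw [(eq_zero_of_excDiv hz.symm).2, sub_zero, ← hz]
      -- For n = 1 this is N_2 itself; for n ≥ 2 each zero of f^n is multiple and counts twice N̄.
      rcases Nat.lt_or_ge n 2 with hn | hn
      · have h1 : n = 1 := by have := S.one_le; omega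
        subst h1
        simp [mu, muStar]
      · have h1 : mu n 2 = 2 := by simp [mu, hn]
        rw [muStar, h1]
        push_cast
        rcases le_or_gt (ord f z) 0 with h2 | h2
        · have : n * ord f z ≤ 0 := mul_nonpos_of_nonneg_of_nonpos (by positivity) h2
          omega
        · omega
    · have : 0 ≤ (mu n 2 : ℤ) * max 0 (min (ord f z) (muStar n 2 : ℕ)) := by positivity
      push_cast
      omega
  refine h.trans_le fun r _ ↦ le_of_eq ?_
  rw [logCounting_nsmul_apply, Ntrunc_zero_eq]

lemma trunc_right_asympLE (hG : NonConstant (P.eval / a)) (p : ℕ) :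
    AsympLE f (logCounting (trunc p (ord (P.eval / a)))) (fun r ↦
      ((P.weight : ℝ) - P.lowerDegree) * Nbar ⊤ f r +
        P.lowerDegree * Ntrunc (p + (P.weight - P.lowerDegree)) 0 f r) := by
  have h0 := eval_ne_zero hG
  refine AsympLE.trans (S.asympLE_of_le p fun z ↦ ?_)
    (P.trunc_eval_asympLE S.mero S.nonConstant S.homogeneous h0 S.one_le_lowerDegree p)
  rw [trunc_apply, trunc_apply, S.ord_right h0]
  have hE := excDiv_nonneg (P := P) (a := a) z
  rcases hE.eq_or_lt with hz | hz
  · rw [(eq_zero_of_excDiv hz.symm).2, ← hz]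
    simp
  · have : (p : ℤ) ≤ p * excDiv P a z := le_mul_of_one_le_right (by positivity) (by omega)
    omega

lemma poles_left_asympLE : AsympLE f (logCounting (reducedGE (-ord (f ^ n / a)) 1)) (Nbar ⊤ f) := by
  rw [Nbar_top_eq]
  refine S.asympLE_of_le 1 fun z ↦ ?_
  have hE := excDiv_nonneg (P := P) (a := a) z
  rw [reducedGE_apply, reducedGE_apply, neg_apply, neg_apply]
  rcases hE.eq_or_lt with hz | hz
  · have := S.neg_of_left_neg hz.symm
    split_ifs <;> omega
  · split_ifs <;> omega

lemma poles_right_asympLE (hG : NonConstant (P.eval / a)) :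
    AsympLE f (logCounting (reducedGE (-ord (P.eval / a)) 1)) (Nbar ⊤ f) := by
  rw [Nbar_top_eq]
  refine S.asympLE_of_le 1 fun z ↦ ?_
  have hE := excDiv_nonneg (P := P) (a := a) z
  rw [reducedGE_apply, reducedGE_apply, neg_apply, neg_apply]
  rcases hE.eq_or_lt with hz | hz
  · have := S.neg_of_right_neg hG hz.symm
    split_ifs <;> omega
  · split_ifs <;> omega

lemma zeros_left_asympLE : AsympLE f (logCounting (reducedGE (ord (f ^ n / a)) 1)) (Nbar 0 f) := by
  rw [Nbar_zero_eq]
  refine S.asympLE_of_le 1 fun z ↦ ?_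
  have hE := excDiv_nonneg (P := P) (a := a) z
  rw [reducedGE_apply, reducedGE_apply]
  rcases hE.eq_or_lt with hz | hz
  · have := S.pos_of_left_pos hz.symm
    split_ifs <;> omega
  · split_ifs <;> omega

end Sharing

/-! ### The three weights in the generic case -/

/-- The bound for `n T(r, f)` that results for sharing with weight at least two. -/
def weightTwoBound (f : ℂ → ℂ) (n : ℕ) (P : DiffPoly f) (r : ℝ) : ℝ :=
  ((P.weight : ℝ) - P.lowerDegree + 3) * Nbar ⊤ f r + mu n 2 * Ntrunc (muStar n 2) 0 f r +
    P.lowerDegree * Ntrunc (2 + (P.weight - P.lowerDegree)) 0 f r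

namespace Sharing

variable {f : ℂ → ℂ} {n : ℕ} {P : DiffPoly f} {a : ℂ → ℂ} {l : ℕ∞} (S : Sharing f n P a l)
include S

lemma common_asympLE (hG : NonConstant (P.eval / a)) :
    AsympLE f (logCounting (3 • reducedGE (-ord f) 1 + trunc 2 (ord (f ^ n / a)) +
      trunc 2 (ord (P.eval / a)))) (weightTwoBound f n P) := by
  have h := ((AsympLE.refl (f := f) (u := logCounting (3 • reducedGE (-ord f) 1))).add
    S.trunc_left_asympLE).add (S.trunc_right_asympLE hG 2)
  refine (AsympLE.le_trans (fun r _ ↦ le_of_eq ?_) h).trans_le fun r _ ↦ le_of_eq ?_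
  · simp only [logCounting_add_apply, Pi.add_apply]
  · simp only [weightTwoBound, logCounting_nsmul_apply, Pi.add_apply, Nbar_top_eq]
    push_cast
    ring

/-- This pays for common 1-points of unequal multiplicity: F'/F vanishes to order p - 1 at a 1-point
of F of multiplicity p. -/
lemma zeros_logDeriv_left_asympLE :
    AsympLE f (logCounting (ord (logDeriv (f ^ n / a)))⁺) (Nbar ⊤ f + Nbar 0 f) := by
  refine (AsympLE.zeros_logDeriv S.tendsto_T S.comparable_left S.nonConstant_left).trans
    (AsympLE.le_trans (fun r _ ↦ le_of_eq ?_) (S.poles_left_asympLE.add S.zeros_left_asympLE))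
  rw [logCounting_add_apply, Pi.add_apply, add_comm]

lemma zeros_logDeriv_right_asympLE (hG : NonConstant (P.eval / a)) :
    AsympLE f (logCounting (ord (logDeriv (P.eval / a)))⁺) (fun r ↦
      ((P.weight : ℝ) - P.lowerDegree + 1) * Nbar ⊤ f r +
        P.lowerDegree * Ntrunc (1 + (P.weight - P.lowerDegree)) 0 f r) := by
  refine (AsympLE.zeros_logDeriv S.tendsto_T S.comparable_right hG).trans
    ((AsympLE.le_trans (fun r _ ↦ le_of_eq ?_)
      ((S.poles_right_asympLE hG).add (S.trunc_right_asympLE hG 1))).trans_le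
        fun r _ ↦ le_of_eq ?_)
  · rw [logCounting_add_apply, Pi.add_apply, add_comm, trunc_one]
  · rw [Pi.add_apply]
    ring

lemma mainDivisor_asympLE (hG : NonConstant (P.eval / a))
    (hH : ¬ logDeriv (auxFun (f ^ n / a) (P.eval / a)) =ᶠ[codiscrete ℂ] 0) :
    AsympLE f (fun r ↦ n * T f r) (logCounting (mainDivisor (f ^ n / a) (P.eval / a))) :=
  S.T_asympLE.trans (AsympLE.mainDivisor S.tendsto_T S.comparable_left S.nonConstant_left
    S.comparable_right hG hH)

/-- The thresholds 2 and 3 are shared, so unequal multiplicities are both at least 3 and 3 - q ≤ 0: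
the 1-points cost nothing. -/
lemma asympLE_weight_two (hG : NonConstant (P.eval / a))
    (hH : ¬ logDeriv (auxFun (f ^ n / a) (P.eval / a)) =ᶠ[codiscrete ℂ] 0) (hl : 2 ≤ l) :
    AsympLE f (fun r ↦ n * T f r) (weightTwoBound f n P) := by
  refine (S.mainDivisor_asympLE hG hH).trans ((S.asympLE_of_le 3 fun z ↦ ?_).trans
    (S.common_asympLE hG))
  rw [add_apply, add_apply, nsmul_apply]
  refine (S.mainDivisor_le (Y := 0) hG le_rfl fun hz h1 h2 ↦ ?_).trans (by push_cast; omega)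
  have h := mainDivisor_le_of_one S.comparable_left.meromorphic S.nonConstant_left
    S.comparable_right.meromorphic hG hH h1 h2
  have hl1 : (1 : ℕ∞) + 1 ≤ l + 1 := add_le_add (le_trans (by norm_num) hl) le_rfl
  have hl2 : (2 : ℕ∞) + 1 ≤ l + 1 := add_le_add hl le_rfl
  have e2 := S.le_iff_le hG hz (j := 2) (by norm_num) (le_trans (by norm_num) hl1)
  have e3 := S.le_iff_le hG hz (j := 3) (by norm_num) (le_trans (by norm_num) hl2)
  push_cast at e2 e3
  split_ifs at h <;> omega

/-- Unequal multiplicities are now both at least 2, so a positive cost occurs only for q = 2, p ≥ 3.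
It equals 1, at most half the order p - 1 of F'/F; the divisor is doubled to stay with integers. -/
lemma asympLE_weight_one (hG : NonConstant (P.eval / a))
    (hH : ¬ logDeriv (auxFun (f ^ n / a) (P.eval / a)) =ᶠ[codiscrete ℂ] 0) (hl : 1 ≤ l) :
    AsympLE f (fun r ↦ n * T f r)
      (fun r ↦ weightTwoBound f n P r + 1 / 2 * (Nbar ⊤ f r + Nbar 0 f r)) := by
  set D := 3 • reducedGE (-ord f) 1 + trunc 2 (ord (f ^ n / a)) + trunc 2 (ord (P.eval / a))
  have hle : AsympLE f (logCounting (2 • mainDivisor (f ^ n / a) (P.eval / a)))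
      (logCounting (2 • D + (ord (logDeriv (f ^ n / a)))⁺)) := by
    refine S.asympLE_of_le 6 fun z ↦ ?_
    rw [nsmul_apply, add_apply, nsmul_apply, add_apply, add_apply, nsmul_apply, posPart_apply]
    have hY : mainDivisor (f ^ n / a) (P.eval / a) z ≤ 3 * reducedGE (-ord f) 1 z +
        trunc 2 (ord (f ^ n / a)) z + trunc 2 (ord (P.eval / a)) z +
          max (ord (logDeriv (f ^ n / a)) z) 0 / 2 + 3 * excDiv P a z := by
      refine S.mainDivisor_le hG (by omega) fun hz h1 h2 ↦ ?_
      have h := mainDivisor_le_of_one S.comparable_left.meromorphic S.nonConstant_left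
        S.comparable_right.meromorphic hG hH h1 h2
      have hl1 : (1 : ℕ∞) + 1 ≤ l + 1 := add_le_add hl le_rfl
      have e2 := S.le_iff_le hG hz (j := 2) (by norm_num) (le_trans (by norm_num) hl1)
      have e1 := ord_logDeriv_of_one S.comparable_left.meromorphic S.nonConstant_left h1
      push_cast at e2
      split_ifs at h <;> omega
    push_cast
    omega
  have h1 := hle.trans (AsympLE.le_trans (fun r _ ↦ le_of_eq ?_)
    (((S.common_asympLE hG).const_mul (c := 2) (by norm_num)).add S.zeros_logDeriv_left_asympLE))
  · refine (S.mainDivisor_asympLE hG hH).trans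
      ((AsympLE.le_trans (fun r _ ↦ le_of_eq ?_) (h1.const_mul (c := 1 / 2) (by norm_num))).trans_le
        fun r _ ↦ le_of_eq ?_)
    · rw [logCounting_nsmul_apply]
      push_cast
      ring
    · simp only [Pi.add_apply]
      ring
  · rw [logCounting_add_apply, logCounting_nsmul_apply, Pi.add_apply]
    push_cast
    rfl

/-- For p ≠ q the cost 3 - q is 2 when q = 1, and then p ≥ 2 gives 2 ≤ 2(p - 1). It is 1 = q - 1
when q = 2, paid by G'/G. -/
lemma asympLE_weight_zero (hG : NonConstant (P.eval / a))
    (hH : ¬ logDeriv (auxFun (f ^ n / a) (P.eval / a)) =ᶠ[codiscrete ℂ] 0) :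
    AsympLE f (fun r ↦ n * T f r)
      (fun r ↦ weightTwoBound f n P r + 2 * (Nbar ⊤ f r + Nbar 0 f r) +
        (((P.weight : ℝ) - P.lowerDegree + 1) * Nbar ⊤ f r +
        P.lowerDegree * Ntrunc (1 + (P.weight - P.lowerDegree)) 0 f r)) := by
  set D := 3 • reducedGE (-ord f) 1 + trunc 2 (ord (f ^ n / a)) + trunc 2 (ord (P.eval / a))
  have hle : AsympLE f (logCounting (mainDivisor (f ^ n / a) (P.eval / a)))
      (logCounting (D + 2 • (ord (logDeriv (f ^ n / a)))⁺ + (ord (logDeriv (P.eval / a)))⁺)) := by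
    refine S.asympLE_of_le 3 fun z ↦ ?_
    rw [add_apply, add_apply, add_apply, add_apply, nsmul_apply, nsmul_apply, posPart_apply,
      posPart_apply]
    refine (S.mainDivisor_le (Y := 2 * max (ord (logDeriv (f ^ n / a)) z) 0 +
      max (ord (logDeriv (P.eval / a)) z) 0) hG (by omega) fun hz h1 h2 ↦ ?_).trans
      (by push_cast; omega)
    have h := mainDivisor_le_of_one S.comparable_left.meromorphic S.nonConstant_left
      S.comparable_right.meromorphic hG hH h1 h2
    have e1 := ord_logDeriv_of_one S.comparable_left.meromorphic S.nonConstant_left h1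
    have e2 := ord_logDeriv_of_one S.comparable_right.meromorphic hG h2
    split_ifs at h <;> omega
  refine (S.mainDivisor_asympLE hG hH).trans (hle.trans (AsympLE.le_trans (fun r _ ↦ le_of_eq ?_)
    (((S.common_asympLE hG).add (S.zeros_logDeriv_left_asympLE.const_mul (c := 2)
      (by norm_num))).add (S.zeros_logDeriv_right_asympLE hG))))
  rw [logCounting_add_apply, logCounting_add_apply, logCounting_nsmul_apply, Pi.add_apply,
    Pi.add_apply]
  push_cast
  rfl

end Sharing

/-! ### The degenerate cases -/

/-- The second main theorem for the values `0`, `β` and `∞`, with reduced counting functions. -/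
theorem AsympLE.smt_reduced {f F : ℂ → ℂ} (hT : Tendsto (T f) atTop atTop) (hF : Comparable f F)
    (hc : NonConstant F) {β : ℂ} (hβ : β ≠ 0) : AsympLE f (T F) (logCounting
      (reducedGE (ord F) 1 + reducedGE (-ord F) 1 + reducedGE (ord fun z ↦ F z - β) 1)) := by
  have hconst : ∀ c : ℂ, Meromorphic fun _ : ℂ ↦ c := fun c ↦ Meromorphic.const c
  have hβ' := inv_ne_zero hβ
  set g : ℂ → ℂ := (fun _ ↦ β⁻¹) * F with hg
  have hgC : Comparable f g := (Comparable.const hT β⁻¹).mul hT hF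
  have hgm := hgC.meromorphic
  have hgF : (fun _ ↦ β) * g = F := by
    ext z
    simp [hg, hβ]
  have hgc : NonConstant g := by
    intro c h
    refine hc (β * c) ?_
    filter_upwards [h] with z hz
    rw [← hgF, Pi.mul_apply, hz]
  have hord : ord g = ord F := by
    rw [hg, ord_mul (hconst _) (not_eventuallyEq_zero_const hβ') hF.meromorphic
      hc.not_eventuallyEq_zero, ord_const, zero_add]
  have hord1 : (ord fun z ↦ g z - 1) = ord fun z ↦ F z - β := by
    have h : (fun z ↦ g z - 1) = (fun _ ↦ β⁻¹) * fun z ↦ F z - β := by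
      ext z
      simp [hg, mul_sub, hβ]
    rw [h, ord_mul (hconst _) (not_eventuallyEq_zero_const hβ')
      (sub_const_meromorphic hF.meromorphic β) (hc.sub_const β), ord_const, zero_add]
  have h1 : AsympLE f (T F) (T g) := by
    refine AsympLE.of_le_add_const hT (c := log⁺ ‖β‖) fun r hr ↦ ?_
    have := characteristic_mul_top_le hr (hconst β)
      (order_ne_top (hconst β) (not_eventuallyEq_zero_const hβ)) hgm
      (order_ne_top hgm hgc.not_eventuallyEq_zero)
    rw [hgF, Pi.add_apply] at this
    have h2 := congrFun (T_const β) r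
    simp only [T] at *
    linarith
  rw [← hord, ← hord1]
  exact h1.trans ((AsympLE.smt hT hgC hgc).trans_le fun r hr ↦
    logCounting_le (divisor_le_iff.2 fun z ↦ smtDivisor_le hgm hgc z) hr)

/-- The auxiliary function is the quotient of the derivatives of 1/(F-1) and 1/(G-1). If it is a
constant c, then 1/(F-1) - c/(G-1) has zero derivative. -/
lemma exists_of_logDeriv_auxFun_eq_zero {F G : ℂ → ℂ} (hF : Meromorphic F) (hFc : NonConstant F)
    (hG : Meromorphic G) (hGc : NonConstant G)
    (hH : logDeriv (auxFun F G) =ᶠ[codiscrete ℂ] 0) :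
    ∃ c B : ℂ, c ≠ 0 ∧ ∀ᶠ z in codiscrete ℂ, F z - 1 ≠ 0 ∧ G z - 1 ≠ 0 ∧
      (F z - 1)⁻¹ = c * (G z - 1)⁻¹ + B := by
  have hφ := auxFun_meromorphic hF hG
  have hφ0 := auxFun_ne_zero hF hFc hG hGc
  have hφc : ¬ NonConstant (auxFun F G) := by
    intro h
    refine not_eventuallyEq_zero_deriv hφ h ?_
    filter_upwards [hH, eventually_codiscrete_ne_zero hφ hφ0] with z h1 h2
    rw [logDeriv_apply, Pi.zero_apply, div_eq_zero_iff] at h1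
    exact h1.resolve_right h2
  obtain ⟨c, hc⟩ := exists_const_of_not_nonConstant hφc
  have hc0 : c ≠ 0 := by
    rintro rfl
    exact hφ0 hc
  have hF1 := sub_const_meromorphic hF 1
  have hG1 := sub_const_meromorphic hG 1
  have hF0 := eventually_codiscrete_ne_zero hF1 (hFc.sub_const 1)
  have hG0 := eventually_codiscrete_ne_zero hG1 (hGc.sub_const 1)
  have hG' := eventually_codiscrete_ne_zero hG.deriv (not_eventuallyEq_zero_deriv hG hGc)
  have han : ∀ {g : ℂ → ℂ}, Meromorphic g → ∀ᶠ z in codiscrete ℂ, AnalyticAt ℂ g z := fun hg ↦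
    hg.meromorphicOn.eventually_codiscreteWithin_analyticAt (U := univ)
  set u : ℂ → ℂ := fun z ↦ (F z - 1)⁻¹ - c * (G z - 1)⁻¹ with hu
  have hum : Meromorphic u := fun z ↦ ((hF1 z).fun_inv).fun_sub
    ((MeromorphicAt.const c z).fun_mul (hG1 z).fun_inv)
  have hder : deriv u =ᶠ[codiscrete ℂ] 0 := by
    filter_upwards [hc, hF0, hG0, hG', han hF, han hG] with z h1 h2 h3 h4 h5 h6
    have h7 : HasDerivAt u (-deriv F z / (F z - 1) ^ 2 - c * (-deriv G z / (G z - 1) ^ 2)) z :=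
      ((h5.differentiableAt.hasDerivAt.sub_const 1).fun_inv h2).fun_sub
        (((h6.differentiableAt.hasDerivAt.sub_const 1).fun_inv h3).const_mul c)
    rw [h7.deriv, Pi.zero_apply]
    simp only [auxFun, Pi.div_apply, Pi.pow_apply] at h1
    rw [div_eq_iff (div_ne_zero h4 (pow_ne_zero _ h3))] at h1
    rw [neg_div, h1]
    ring
  have huc : ¬ NonConstant u := fun h ↦ not_eventuallyEq_zero_deriv hum h hder
  obtain ⟨B, hB⟩ := exists_const_of_not_nonConstant huc
  refine ⟨c, B, hc0, ?_⟩
  filter_upwards [hB, hF0, hG0] with z h1 h2 h3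
  refine ⟨h2, h3, ?_⟩
  rw [← h1, hu]
  ring

namespace Sharing

variable {f : ℂ → ℂ} {n : ℕ} {P : DiffPoly f} {a : ℂ → ℂ} {l : ℕ∞} (S : Sharing f n P a l)

/-- The bound for `n T(r, f)` in the degenerate cases. -/
def degenerateBound (f : ℂ → ℂ) (P : DiffPoly f) (r : ℝ) : ℝ :=
  Nbar 0 f r + Nbar ⊤ f r + (((P.weight : ℝ) - P.lowerDegree) * Nbar ⊤ f r +
    P.lowerDegree * Ntrunc (1 + (P.weight - P.lowerDegree)) 0 f r)

lemma Nbar_top_nonneg {r : ℝ} (hr : 1 ≤ r) : 0 ≤ Nbar ⊤ f r := by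
  rw [Nbar_top_eq]
  exact logCounting_nonneg' (reducedGE_nonneg _ _) hr

lemma Ntrunc_zero_nonneg {r : ℝ} (hr : 1 ≤ r) (p : ℕ) : 0 ≤ Ntrunc p 0 f r := by
  rw [Ntrunc_zero_eq]
  exact logCounting_nonneg' (trunc_nonneg _ _) hr

lemma Ntrunc_zero_mono {r : ℝ} (hr : 1 ≤ r) {p p' : ℕ} (h : p ≤ p') :
    Ntrunc p 0 f r ≤ Ntrunc p' 0 f r := by
  rw [Ntrunc_zero_eq, Ntrunc_zero_eq]
  exact logCounting_le (trunc_mono h _) hr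

lemma Nbar_zero_nonneg {r : ℝ} (hr : 1 ≤ r) : 0 ≤ Nbar 0 f r := by
  rw [Nbar_zero_eq_Ntrunc]
  exact Ntrunc_zero_nonneg hr 1

lemma weight_sub_nonneg : 0 ≤ (P.weight : ℝ) - P.lowerDegree :=
  sub_nonneg.2 (by exact_mod_cast P.lowerDegree_le_weight)

include S

lemma degenerateBound_le {r : ℝ} (hr : 1 ≤ r) : degenerateBound f P r ≤ weightTwoBound f n P r := by
  have h1 := Nbar_top_nonneg (f := f) hr
  have h2 : Nbar 0 f r ≤ mu n 2 * Ntrunc (muStar n 2) 0 f r := by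
    rw [Nbar_zero_eq_Ntrunc]
    have h3 : 1 ≤ muStar n 2 := by
      rw [muStar, mu]
      omega
    have h4 : (1 : ℝ) ≤ mu n 2 := by
      have : 1 ≤ mu n 2 := le_min S.one_le (by norm_num)
      exact_mod_cast this
    have h5 := Ntrunc_zero_mono (f := f) hr h3
    have h6 := Ntrunc_zero_nonneg (f := f) hr (muStar n 2)
    nlinarith
  have h3 : (P.lowerDegree : ℝ) * Ntrunc (1 + (P.weight - P.lowerDegree)) 0 f r ≤
      P.lowerDegree * Ntrunc (2 + (P.weight - P.lowerDegree)) 0 f r :=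
    mul_le_mul_of_nonneg_left (Ntrunc_zero_mono hr (by omega)) (by positivity)
  rw [degenerateBound, weightTwoBound]
  nlinarith

lemma smt_left {β : ℂ} (hβ : β ≠ 0) : AsympLE f (fun r ↦ n * T f r)
    (Nbar 0 f + Nbar ⊤ f + logCounting (reducedGE (ord fun z ↦ (f ^ n / a) z - β) 1)) := by
  refine S.T_asympLE.trans ((AsympLE.smt_reduced S.tendsto_T S.comparable_left S.nonConstant_left
    hβ).trans (AsympLE.le_trans (fun r _ ↦ le_of_eq ?_)
      ((S.zeros_left_asympLE.add S.poles_left_asympLE).add AsympLE.refl)))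
  rw [logCounting_add_apply, logCounting_add_apply, Pi.add_apply, Pi.add_apply]

lemma asympLE_of_small {β : ℂ} (hβ : β ≠ 0)
    (h : ∀ z, excDiv P a z = 0 → ¬ 0 < ord (fun z ↦ (f ^ n / a) z - β) z) :
    AsympLE f (fun r ↦ n * T f r) (degenerateBound f P) := by
  have h1 : AsympLE f (logCounting (reducedGE (ord fun z ↦ (f ^ n / a) z - β) 1))
      (logCounting (0 : locallyFinsupp ℂ ℤ)) := by
    refine S.asympLE_of_le 1 fun z ↦ ?_
    have hE := excDiv_nonneg (P := P) (a := a) z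
    have h0 : (0 : locallyFinsupp ℂ ℤ) z = 0 := rfl
    have hz := h z
    rw [reducedGE_apply, h0]
    split_ifs <;> omega
  rw [map_zero] at h1
  refine (S.smt_left hβ).trans ((AsympLE.refl.add_zero_right h1).trans_le fun r hr ↦ ?_)
  rw [degenerateBound, Pi.add_apply, le_add_iff_nonneg_right]
  have h2 := Nbar_top_nonneg (f := f) hr
  have h3 := Ntrunc_zero_nonneg (f := f) hr (1 + (P.weight - P.lowerDegree))
  have h4 := weight_sub_nonneg (P := P)
  positivity

lemma asympLE_of_zeros {β : ℂ} (hβ : β ≠ 0) (hG : NonConstant (P.eval / a))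
    (h : ∀ z, 0 < ord (fun z ↦ (f ^ n / a) z - β) z → 0 < ord (P.eval / a) z) :
    AsympLE f (fun r ↦ n * T f r) (degenerateBound f P) := by
  have h1 : AsympLE f (logCounting (reducedGE (ord fun z ↦ (f ^ n / a) z - β) 1))
      (logCounting (trunc 1 (ord (P.eval / a)))) := by
    refine AsympLE.of_le fun r hr ↦ logCounting_le (divisor_le_iff.2 fun z ↦ ?_) hr
    have hz := h z
    rw [reducedGE_apply, trunc_one, reducedGE_apply]
    split_ifs <;> omega
  exact (S.smt_left hβ).trans (AsympLE.refl.add (h1.trans (S.trunc_right_asympLE hG 1)))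

/-- P[f] - a then has infinite multiplicity at every point, so sharing makes every point a zero of
f^n - a. -/
lemma eventuallyEq_of_right_eq_one (h : P.eval =ᶠ[codiscrete ℂ] a) :
    f ^ n =ᶠ[codiscrete ℂ] P.eval := by
  have hm : Meromorphic (f ^ n - a) := (pow_meromorphic S.mero n).sub S.negligible.meromorphic
  suffices h0 : f ^ n - a =ᶠ[codiscrete ℂ] 0 by
    filter_upwards [h, h0] with z h1 h2
    rw [h1]
    exact sub_eq_zero.1 h2
  by_contra hne
  have h1 : ∀ᶠ z in codiscrete ℂ, AnalyticAt ℂ (f ^ n - a) z :=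
    hm.meromorphicOn.eventually_codiscreteWithin_analyticAt (U := univ)
  obtain ⟨z, hz1, hz2⟩ := (eventually_codiscrete_iff.1
    (h1.and (eventually_codiscrete_ne_zero hm hne)) 0).exists
  have h2 : meromorphicOrderAt (P.eval - a) z = ⊤ := by
    rw [meromorphicOrderAt_eq_top_iff]
    filter_upwards [eventually_codiscrete_iff.1 h z] with w hw
    simp [hw]
  have h3 : meromorphicOrderAt (f ^ n - a) z = (0 : ℤ) := by
    rw [hz1.meromorphicOrderAt_eq, hz1.analyticOrderAt_eq_zero.2 hz2]
    rfl
  have h4 := S.share z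
  have h5 : zeroMult (P.eval - a) z = (⊤ : ℕ∞) := by
    rw [zeroMult, h2]
    rfl
  rw [zeroMult_eq h3, h5, min_eq_right le_top] at h4
  exact absurd h4.symm (by simp)

/-- P[f] - a = (c - 1) a has no zeros off the exceptional points, hence F has no 1-points there. -/
lemma asympLE_of_right_const {c : ℂ} (hc : P.eval / a =ᶠ[codiscrete ℂ] fun _ ↦ c) (hc1 : c ≠ 1) :
    AsympLE f (fun r ↦ n * T f r) (degenerateBound f P) := by
  refine S.asympLE_of_small one_ne_zero fun z hz ↦ ?_
  have h1 : meromorphicOrderAt (P.eval - a) z = (0 : ℤ) := by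
    rw [S.order_sub_mul (P.eval_meromorphic S.mero) hz]
    have h2 : (fun w ↦ (P.eval / a) w - 1) =ᶠ[𝓝[≠] z] fun _ ↦ c - 1 := by
      filter_upwards [eventually_codiscrete_iff.1 hc z] with w hw
      rw [hw]
    rw [meromorphicOrderAt_congr h2, meromorphicOrderAt_const, if_neg (sub_ne_zero.2 hc1)]
    rfl
  have h2 := S.share z
  rw [zeroMult_eq h1, S.zeroMult_left hz] at h2
  have h3 := le_iff_le_of_min_eq h2 (j := 1) (by simp)
  omega

/-- The case in which the product of the two functions is constant. -/
lemma false_of_mul_eq_one (hG : NonConstant (P.eval / a))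
    (h : (f ^ n / a) * (P.eval / a) =ᶠ[codiscrete ℂ] fun _ ↦ 1) : False := by
  have hT := S.tendsto_T
  have ham := S.negligible.meromorphic
  have hPm := P.eval_meromorphic S.mero
  have hF := S.comparable_left.meromorphic
  have h0 := eval_ne_zero hG
  set m := n + P.lowerDegree with hm
  have hainv : ProxNegligible f a⁻¹ := by
    obtain ⟨C, hC⟩ := exists_T_inv_le ham
    exact Negligible.proxNegligible ⟨ham.inv, isLittleO_of_nonneg_le (fun _ hr ↦ T_nonneg _ hr)
      (fun r _ ↦ (hC r).1) (S.negligible.isLittleO.add (isLittleO_const_T hT C))⟩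
  -- FG = 1 reads f^(-(n+d)) = (P[f]/f^d)/a², whose proximity function is negligible.
  have hprox : ProxNegligible f (f ^ m)⁻¹ := by
    refine ((P.proxNegligible_eval_div S.mero S.nonConstant S.homogeneous).mul
      (hainv.mul hainv)).congr (pow_meromorphic S.mero m).inv ?_
    filter_upwards [h, eventually_codiscrete_ne_zero S.mero S.nonConstant.not_eventuallyEq_zero,
      eventually_codiscrete_ne_zero ham S.ne_zero] with z h1 h2 h3
    simp only [Pi.mul_apply, Pi.div_apply, Pi.pow_apply, Pi.inv_apply] at h1 ⊢
    rw [hm, pow_add]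
    field_simp at h1 ⊢
    linear_combination h1
  -- At a zero of f, n ord f + ord P[f] = 2 ord a, while ord P[f] is bounded below by the
  -- coefficients alone. So zeros of f occur only at exceptional points, and m(r,1/f^m) and
  -- N(r,0;f^m) are both S(r,f).
  have hzeros : AsympLE f (logCounting (ord (f ^ m))⁺)
      (logCounting (0 : locallyFinsupp ℂ ℤ)) := by
    refine S.asympLE_of_le (m * 2) fun z ↦ ?_
    have h1 : ord (f ^ n / a) z + ord (P.eval / a) z = 0 := by
      have h2 : ord (f ^ n / a * (P.eval / a)) = 0 := (ord_congr h).trans (ord_const 1)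
      rw [ord_mul hF S.nonConstant_left.not_eventuallyEq_zero S.comparable_right.meromorphic
        hG.not_eventuallyEq_zero] at h2
      rw [← add_apply, h2]
      rfl
    rw [S.ord_left, S.ord_right h0] at h1
    have h3 : (0 : locallyFinsupp ℂ ℤ) z = 0 := rfl
    rw [posPart_apply, ord_pow S.mero, nsmul_apply, h3, zero_add]
    have hE := excDiv_nonneg (P := P) (a := a) z
    rcases le_or_gt (ord f z) 0 with h4 | h4
    · rw [max_eq_right (mul_nonpos_of_nonneg_of_nonpos (by positivity) h4)]
      positivity
    · have h5 := P.neg_coeffDiv_le_order_eval S.mero (z := z) (by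
        rw [order_eq_ord S.mero S.nonConstant.not_eventuallyEq_zero]
        exact_mod_cast h4.le)
      rw [order_eq_ord hPm h0, WithTop.coe_le_coe] at h5
      have h6 : ord f z ≤ n * ord f z :=
        le_mul_of_one_le_left h4.le (by exact_mod_cast S.one_le)
      have h7 : ord f z ≤ 2 * excDiv P a z := by
        rw [excDiv_apply]
        have h8 := le_abs_self (ord a z)
        have h9 := P.coeffDiv_nonneg z
        omega
      refine max_le ?_ (by positivity)
      push_cast
      rw [mul_assoc]
      exact mul_le_mul_of_nonneg_left h7 (by positivity)
  rw [map_zero] at hzeros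
  obtain ⟨C, hC⟩ := exists_T_inv_le (pow_meromorphic S.mero m)
  have hfin : AsympLE f (fun r ↦ m * T f r) 0 := by
    refine AsympLE.trans (AsympLE.of_le_add_const hT
      (v := proximity (f ^ m)⁻¹ ⊤ + logCounting (ord (f ^ m))⁺) (c := C) fun r hr ↦ ?_)
      ((AsympLE.zero_of_isLittleO hprox.isLittleO).add_zero_right hzeros)
    have h1 : m * T f r = T (f ^ m) r := by
      simp only [T, characteristic_pow_top S.mero, Pi.smul_apply, nsmul_eq_mul]
    rw [h1]
    refine (hC r).2.trans (le_of_eq ?_)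
    simp only [T, characteristic, Pi.add_apply, ValueDistribution.logCounting_inv,
      ValueDistribution.logCounting_zero]
  refine AsympLE.not_of_tendsto hT (c := m) (c' := 1 / 2) ?_ ?_ hfin
  · have : (1 : ℝ) ≤ m := by exact_mod_cast S.one_le.trans (Nat.le_add_right _ _)
    linarith
  · filter_upwards [eventually_ge_atTop 1] with r hr
    have := T_nonneg f hr
    simp only [Pi.zero_apply]
    positivity

lemma eventuallyEq_or_asympLE_of_auxFun_const (hG : NonConstant (P.eval / a))
    (hH : logDeriv (auxFun (f ^ n / a) (P.eval / a)) =ᶠ[codiscrete ℂ] 0) :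
    f ^ n =ᶠ[codiscrete ℂ] P.eval ∨ AsympLE f (fun r ↦ n * T f r) (degenerateBound f P) := by
  have hF := S.comparable_left.meromorphic
  have hFc := S.nonConstant_left
  have hGm := S.comparable_right.meromorphic
  have ham := S.negligible.meromorphic
  have hconst : ∀ c : ℂ, Meromorphic fun _ : ℂ ↦ c := fun c ↦ Meromorphic.const c
  obtain ⟨c, B, hc, hev⟩ := exists_of_logDeriv_auxFun_eq_zero hF hFc hGm hG hH
  by_cases hB : B = 0
  · by_cases hc1 : c = 1
    · left
      filter_upwards [hev, eventually_codiscrete_ne_zero ham S.ne_zero] with z h1 h2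
      obtain ⟨h3, h4, h5⟩ := h1
      rw [hB, hc1, one_mul, add_zero, inv_inj, sub_left_inj] at h5
      simp only [Pi.div_apply] at h5
      field_simp at h5
      exact h5
    · right
      -- Here F - (1 - 1/c) = G/c, so the β-points of F are the zeros of G.
      have hβ : 1 - c⁻¹ ≠ 0 := by
        intro h
        exact hc1 (inv_eq_one.1 (sub_eq_zero.1 h).symm)
      refine S.asympLE_of_zeros hβ hG fun z hz ↦ ?_
      have h1 : (fun z ↦ (f ^ n / a) z - (1 - c⁻¹)) =ᶠ[codiscrete ℂ]
          (fun _ ↦ c⁻¹) * (P.eval / a) := by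
        filter_upwards [hev] with w hw
        obtain ⟨h3, h4, h5⟩ := hw
        rw [hB, add_zero] at h5
        rw [Pi.mul_apply]
        have h6 : (f ^ n / a) w - 1 = c⁻¹ * ((P.eval / a) w - 1) := by
          rw [← inv_inv ((f ^ n / a) w - 1), h5, mul_inv, inv_inv]
        linear_combination h6
      rwa [ord_congr h1, ord_mul (hconst _) (not_eventuallyEq_zero_const (inv_ne_zero hc)) hGm
        hG.not_eventuallyEq_zero, ord_const, zero_add] at hz
  -- The Möbius relation with denominators cleared. For B = -1 it relates F and FG linearly;
  -- otherwise 1 + 1/B is a nonzero value that F can take only at poles of G.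
  · have hkey : ∀ᶠ z in codiscrete ℂ, ((f ^ n / a) z - (1 + B⁻¹)) * ((P.eval / a) z - 1) =
        -c * B⁻¹ * ((f ^ n / a) z - 1) := by
      filter_upwards [hev] with z hz
      obtain ⟨h3, h4, h5⟩ := hz
      generalize (f ^ n / a) z = x at *
      generalize (P.eval / a) z = y at *
      field_simp at h5 ⊢
      linear_combination -h5
    have hordkey : (ord fun z ↦ (f ^ n / a) z - (1 + B⁻¹)) + (ord fun z ↦ (P.eval / a) z - 1) =
        ord fun z ↦ (f ^ n / a) z - 1 := by
      have h1 : (fun z ↦ (f ^ n / a) z - (1 + B⁻¹)) * (fun z ↦ (P.eval / a) z - 1) =ᶠ[codiscrete ℂ]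
          (fun _ ↦ -c * B⁻¹) * fun z ↦ (f ^ n / a) z - 1 := hkey
      have h2 := ord_congr h1
      rwa [ord_mul (sub_const_meromorphic hF _) (hFc.sub_const _) (sub_const_meromorphic hGm _)
        (hG.sub_const _), ord_mul (hconst _) (not_eventuallyEq_zero_const
          (mul_ne_zero (neg_ne_zero.2 hc) (inv_ne_zero hB))) (sub_const_meromorphic hF _)
        (hFc.sub_const _), ord_const, zero_add] at h2
    by_cases hB1 : B = -1
    · by_cases hc1 : c = -1
      · refine (S.false_of_mul_eq_one hG ?_).elim
        filter_upwards [hkey] with z hz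
        rw [hB1, hc1] at hz
        rw [Pi.mul_apply]
        generalize (f ^ n / a) z = x at *
        generalize (P.eval / a) z = y at *
        norm_num at hz
        linear_combination hz
      · right
        have hc2 : c + 1 ≠ 0 := fun h ↦ hc1 (eq_neg_of_add_eq_zero_left h)
        -- Now F - c/(c+1) = FG/(c+1). At a β-point F is neither zero nor infinite, so G vanishes.
        have hβ : c / (c + 1) ≠ 0 := div_ne_zero hc hc2
        refine S.asympLE_of_zeros hβ hG fun z hz ↦ ?_
        have h1 : (fun z ↦ (f ^ n / a) z - c / (c + 1)) =ᶠ[codiscrete ℂ]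
            (fun _ ↦ (c + 1)⁻¹) * ((f ^ n / a) * (P.eval / a)) := by
          filter_upwards [hkey] with w hw
          rw [hB1] at hw
          simp only [Pi.mul_apply]
          generalize (f ^ n / a) w = x at *
          generalize (P.eval / a) w = y at *
          norm_num at hw
          field_simp
          linear_combination -hw
        have h2 := hz
        rw [ord_congr h1, ord_mul (hconst _) (not_eventuallyEq_zero_const (inv_ne_zero hc2))
          (hF.mul hGm) (not_eventuallyEq_zero_mul hF hGm hFc.not_eventuallyEq_zero
            hG.not_eventuallyEq_zero), ord_const, zero_add, ord_mul hF hFc.not_eventuallyEq_zero hGm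
          hG.not_eventuallyEq_zero, add_apply] at h2
        rcases lt_trichotomy (ord (f ^ n / a) z) 0 with h3 | h3 | h3
        · rw [ord_sub_const_of_neg hF hFc h3] at hz
          omega
        · omega
        · rw [ord_sub_const_of_pos hF hFc hβ h3] at hz
          omega
    · right
      have hβ : 1 + B⁻¹ ≠ 0 := by
        intro h
        have h1 : B⁻¹ = -1 := by linear_combination h
        exact hB1 (by rw [← inv_inv B, h1]; norm_num)
      -- At such a point F ≠ 1, so G must have a pole. Off the exceptional points f then has a pole,
      -- and so does F, a contradiction.
      refine S.asympLE_of_small hβ fun z hz hpos ↦ ?_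
      have h1 : ord (fun z ↦ (f ^ n / a) z - 1) z = 0 := by
        have h2 : NonConstant fun z ↦ (f ^ n / a) z - (1 + B⁻¹) := by
          intro b hb
          refine hFc (b + (1 + B⁻¹)) ?_
          filter_upwards [hb] with w hw
          linear_combination hw
        have h3 := ord_sub_const_of_pos (c := -B⁻¹) (sub_const_meromorphic hF (1 + B⁻¹)) h2
          (neg_ne_zero.2 (inv_ne_zero hB)) hpos
        have h4 : (fun z ↦ (f ^ n / a) z - (1 + B⁻¹) - -B⁻¹) = fun z ↦ (f ^ n / a) z - 1 := by
          ext w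
          ring
        rwa [h4] at h3
      have h2 := congrArg (fun D : locallyFinsupp ℂ ℤ ↦ D z) hordkey
      simp only [add_apply] at h2
      have h3 : ord (P.eval / a) z < 0 := by
        by_contra h4
        have := ord_sub_const_nonneg (c := 1) hGm hG (not_lt.1 h4)
        omega
      have h4 := S.neg_of_right_neg hG hz h3
      have h5 : ord (f ^ n / a) z < 0 := by
        rw [S.ord_left, (eq_zero_of_excDiv hz).2, sub_zero]
        exact mul_neg_of_pos_of_neg (by exact_mod_cast S.one_le) h4
      rw [ord_sub_const_of_neg hF hFc h5] at hpos
      omega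

end Sharing

/-! ### From deficiencies to bounds, and conclusion -/

/-- `limsup u(r) / T(r, f) ≤ κ`. -/
def LimsupLE (f : ℂ → ℂ) (u : ℝ → ℝ) (κ : ℝ) : Prop :=
  ∀ δ > 0, ∀ᶠ r in atTop, u r ≤ (κ + δ) * T f r

namespace LimsupLE

variable {f : ℂ → ℂ} {u v : ℝ → ℝ} {κ κ' : ℝ}

lemma add (hu : LimsupLE f u κ) (hv : LimsupLE f v κ') :
    LimsupLE f (fun r ↦ u r + v r) (κ + κ') := by
  intro δ hδ
  filter_upwards [hu (δ / 2) (by positivity), hv (δ / 2) (by positivity)] with r h1 h2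
  linarith

lemma const_mul (hu : LimsupLE f u κ) {c : ℝ} (hc : 0 ≤ c) :
    LimsupLE f (fun r ↦ c * u r) (c * κ) := by
  intro δ hδ
  filter_upwards [hu (δ / (c + 1)) (by positivity), eventually_ge_atTop 1] with r h1 h2
  have h3 : c * (δ / (c + 1)) ≤ δ := by
    rw [mul_div_assoc', div_le_iff₀ (by positivity)]
    nlinarith
  have h4 := T_nonneg f h2
  nlinarith [mul_le_mul_of_nonneg_left h1 hc, mul_le_mul_of_nonneg_right h3 h4]

/-- The hypothesis keeps the quotient bounded above, without which a real limsup may be a default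
value. The form 1 - (1 - limsup) matches the definitions of δ_p and Θ. -/
lemma of_le_T_add (hT : Tendsto (T f) atTop atTop) {C : ℝ} (h : ∀ r, 1 ≤ r → u r ≤ T f r + C) :
    LimsupLE f u (1 - (1 - limsup (fun r ↦ u r / T f r) atTop)) := by
  intro δ hδ
  have hb : IsBoundedUnder (· ≤ ·) atTop fun r ↦ u r / T f r := by
    refine isBoundedUnder_of_eventually_le (a := 2) ?_
    filter_upwards [hT.eventually_ge_atTop C, hT.eventually_gt_atTop 0,
      eventually_ge_atTop 1] with r h1 h2 h3
    rw [div_le_iff₀ h2]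
    linarith [h r h3]
  have hlt := eventually_lt_of_limsup_lt (f := atTop) (u := fun r ↦ u r / T f r)
    (lt_add_of_pos_right _ hδ) hb
  filter_upwards [hlt, hT.eventually_gt_atTop 0] with r h1 h2
  rw [div_lt_iff₀ h2] at h1
  rw [sub_sub_cancel]
  exact h1.le

lemma not_asympLE (hu : LimsupLE f u κ) (hT : Tendsto (T f) atTop atTop) {c : ℝ} (hκ : κ < c) :
    ¬ AsympLE f (fun r ↦ c * T f r) u :=
  AsympLE.not_of_tendsto hT (c' := κ + (c - κ) / 2) (by linarith) (hu _ (by linarith))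

end LimsupLE

variable {f : ℂ → ℂ}

lemma limsupLE_Nbar_top (hT : Tendsto (T f) atTop atTop) : LimsupLE f (Nbar ⊤ f) (1 - Theta ⊤ f) :=
  .of_le_T_add hT (C := 0) fun r hr ↦ by simpa using Nbar_top_le_T f hr

lemma limsupLE_Ntrunc_zero (hf : Meromorphic f) (hT : Tendsto (T f) atTop atTop) (p : ℕ) :
    LimsupLE f (Ntrunc p 0 f) (1 - delta p 0 f) := by
  obtain ⟨C, hC⟩ := exists_Ntrunc_zero_le hf p
  exact .of_le_T_add hT hC

lemma limsupLE_Nbar_zero (hf : Meromorphic f) (hT : Tendsto (T f) atTop atTop) :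
    LimsupLE f (Nbar 0 f) (1 - Theta 0 f) := by
  have h := limsupLE_Ntrunc_zero hf hT 1
  rwa [delta, ← Nbar_zero_eq_Ntrunc] at h

namespace Sharing

variable {n : ℕ} {P : DiffPoly f} {a : ℂ → ℂ} {l : ℕ∞}

lemma limsupLE_weightTwoBound (hf : Meromorphic f) (hT : Tendsto (T f) atTop atTop) :
    LimsupLE f (weightTwoBound f n P)
      (((P.weight : ℝ) - P.lowerDegree + 3) * (1 - Theta ⊤ f) +
        mu n 2 * (1 - delta (muStar n 2) 0 f) +
        P.lowerDegree * (1 - delta (2 + (P.weight - P.lowerDegree)) 0 f)) := by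
  have hA := weight_sub_nonneg (P := P)
  exact (((limsupLE_Nbar_top hT).const_mul (by linarith)).add
    ((limsupLE_Ntrunc_zero hf hT _).const_mul (Nat.cast_nonneg _))).add
    ((limsupLE_Ntrunc_zero hf hT _).const_mul (Nat.cast_nonneg _))

/-- Since κ < n, the bound n T(r,f) ≤ v + S(r,f) is impossible. Every alternative to f^n ≡ P[f]
leads to it, through v itself or the degenerate bound below it. -/
lemma eventuallyEq_of_limsupLE (S : Sharing f n P a l) {v : ℝ → ℝ} {κ : ℝ} (hκ : κ < n)
    (hv : LimsupLE f v κ) (hle : ∀ r, 1 ≤ r → degenerateBound f P r ≤ v r)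
    (hmain : NonConstant (P.eval / a) →
      ¬ logDeriv (auxFun (f ^ n / a) (P.eval / a)) =ᶠ[codiscrete ℂ] 0 →
      AsympLE f (fun r ↦ n * T f r) v) :
    f ^ n =ᶠ[codiscrete ℂ] P.eval := by
  have hnot := hv.not_asympLE S.tendsto_T hκ
  have hdeg : ¬ AsympLE f (fun r ↦ n * T f r) (degenerateBound f P) :=
    fun h ↦ hnot (h.trans_le hle)
  by_cases hG : NonConstant (P.eval / a)
  · by_cases hH : logDeriv (auxFun (f ^ n / a) (P.eval / a)) =ᶠ[codiscrete ℂ] 0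
    · exact (S.eventuallyEq_or_asympLE_of_auxFun_const hG hH).resolve_right hdeg
    · exact absurd (hmain hG hH) hnot
  · obtain ⟨c, hc⟩ := exists_const_of_not_nonConstant hG
    by_cases hc1 : c = 1
    · refine S.eventuallyEq_of_right_eq_one ?_
      filter_upwards [hc, eventually_codiscrete_ne_zero S.negligible.meromorphic S.ne_zero]
        with z h1 h2
      rwa [hc1, Pi.div_apply, div_eq_one_iff_eq h2] at h1
    · exact absurd (S.asympLE_of_right_const hc hc1) hdeg

end Sharing

end Nevanlinna
end

theorem theorem2p1
    (f : ℂ → ℂ) (hf : Meromorphic f) (hfc : Nevanlinna.NonConstant f)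
    (n : ℕ) (hn : 1 ≤ n)
    (P : Nevanlinna.DiffPoly f) (hP : P.IsHomogeneous) (k : ℕ) (hk : 1 ≤ k) (hkP : P.order = k)
    (hΓ : ((k : ℝ) + 1) * P.lowerDegree - 2 < P.weight)
    (a : ℂ → ℂ) (ha : Nevanlinna.IsSmall f a) (ha0 : ¬ a =ᶠ[codiscrete ℂ] 0)
    (l : ℕ∞) (hshare : Nevanlinna.ShareZero l (f ^ n - a) (P.eval - a))
    (h :
      (2 ≤ l ∧
        ((P.weight : ℝ) - P.lowerDegree + 3) * Nevanlinna.Theta ⊤ f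
          + Nevanlinna.mu n 2 * Nevanlinna.delta (Nevanlinna.muStar n 2) 0 f
          + P.lowerDegree * Nevanlinna.delta (2 + (P.weight - P.lowerDegree)) 0 f
        > (P.weight : ℝ) + Nevanlinna.mu n 2 + 3 - n) ∨
      (l = 1 ∧
        ((P.weight : ℝ) - P.lowerDegree + 7 / 2) * Nevanlinna.Theta ⊤ f
          + 1 / 2 * Nevanlinna.Theta 0 f
          + Nevanlinna.mu n 2 * Nevanlinna.delta (Nevanlinna.muStar n 2) 0 f
          + P.lowerDegree * Nevanlinna.delta (2 + (P.weight - P.lowerDegree)) 0 f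
        > (P.weight : ℝ) + Nevanlinna.mu n 2 + 4 - n) ∨
      (l = 0 ∧
        (2 * ((P.weight : ℝ) - P.lowerDegree) + 6) * Nevanlinna.Theta ⊤ f
          + 2 * Nevanlinna.Theta 0 f
          + Nevanlinna.mu n 2 * Nevanlinna.delta (Nevanlinna.muStar n 2) 0 f
          + P.lowerDegree * Nevanlinna.delta (1 + (P.weight - P.lowerDegree)) 0 f
          + P.lowerDegree * Nevanlinna.delta (2 + (P.weight - P.lowerDegree)) 0 f
        > 2 * (P.weight : ℝ) + Nevanlinna.mu n 2 + 8 - n)) :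
    f ^ n =ᶠ[codiscrete ℂ] P.eval := by
  have S : Nevanlinna.Sharing f n P a l :=
    ⟨hf, hfc, hn, hP, hkP ▸ hk, ha.negligible, ha0, hshare⟩
  have hT := S.tendsto_T
  have h2 := Nevanlinna.Sharing.limsupLE_weightTwoBound (n := n) (P := P) hf hT
  have hA := Nevanlinna.Sharing.weight_sub_nonneg (P := P)
  have htop := Nevanlinna.limsupLE_Nbar_top hT
  have hzero := Nevanlinna.limsupLE_Nbar_zero hf hT
  -- In each case the deficiency inequality is exactly κ < n, once every Θ and δ is written as 1
  -- minus the corresponding limsup.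
  rcases h with ⟨hl, h⟩ | ⟨hl, h⟩ | ⟨-, h⟩
  · exact S.eventuallyEq_of_limsupLE (by linarith) h2 (fun r hr ↦ S.degenerateBound_le hr)
      fun hG hH ↦ S.asympLE_weight_two hG hH hl
  · refine S.eventuallyEq_of_limsupLE (by linarith)
      (h2.add ((htop.add hzero).const_mul (c := 1 / 2) (by norm_num))) (fun r hr ↦ ?_)
      fun hG hH ↦ S.asympLE_weight_one hG hH hl.ge
    linarith [S.degenerateBound_le hr, Nevanlinna.Sharing.Nbar_top_nonneg (f := f) hr,
      Nevanlinna.Sharing.Nbar_zero_nonneg (f := f) hr]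
  · refine S.eventuallyEq_of_limsupLE (by linarith)
      ((h2.add ((htop.add hzero).const_mul (c := 2) (by norm_num))).add
        ((htop.const_mul (c := (P.weight : ℝ) - P.lowerDegree + 1) (by linarith)).add
          ((Nevanlinna.limsupLE_Ntrunc_zero hf hT (1 + (P.weight - P.lowerDegree))).const_mul
            (Nat.cast_nonneg P.lowerDegree)))) (fun r hr ↦ ?_)
      fun hG hH ↦ S.asympLE_weight_zero hG hH
    have h3 := Nevanlinna.Sharing.Nbar_top_nonneg (f := f) hr
    have h4 := Nevanlinna.Sharing.Ntrunc_zero_nonneg (f := f) hr (1 + (P.weight - P.lowerDegree))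
    have h5 : 0 ≤ ((P.weight : ℝ) - P.lowerDegree + 1) * Nevanlinna.Nbar ⊤ f r +
        P.lowerDegree * Nevanlinna.Ntrunc (1 + (P.weight - P.lowerDegree)) 0 f r := by positivity
    linarith [S.degenerateBound_le hr, Nevanlinna.Sharing.Nbar_zero_nonneg (f := f) hr]
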